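/- \textbf{Setting.} Let $\mathbb C((z^{-1}))$ be the space of formal series $\sum_{k\le n}a_kz^k$, $\mathbb{C}[z]$ its quotient by $z^{-1}\mathbb C[[z^{-1}]]$, and let the Sato Grassmannian be the set of closed subspaces $W$ whose projection $W\to\mathbb C[z]$ is Fredholm. The stratum $\Sigma_1$ consists of those $W$ for which the set of orders (highest powers of $z$) of nonzero elements is $\{-1,0,2,3,4,\dots\}$. For parameters $H=(H^i_k)$, $H^i_k\in\mathbb C$, $i\ge 2$, $k\in\{-1,1,2,3,\dots\}$ (with the convention $H^i_0=0$), put $$p_i(z)=z^i+H^i_{-1}z+\sum_{k\ge1}H^i_kz^{-k}\quad(i\ge2),\qquad W_1(H)=\mathrm{span}_{\mathbb C}\{1,p_2(z),p_3(z),\dots\}.$$ Let $\mathcal H$ be the set of all $H$ such that for all $i,j\ge2$ and $l\in\{-1,1,2,3,\dots\}$ $$H^i_{j+l}+H^j_{i+l}+H^j_{-1}H^i_{l+1}+H^i_{-1}H^j_{l+1}+\sum_{n=1}^{l-1}H^j_nH^i_{l-n}=H^{i+j}_l+H^j_{-1}H^{i+1}_l+H^i_{-1}H^{j+1}_l+\sum_{n=2}^{i-1}H^j_{i-n}H^n_l+\sum_{n=2}^{j-1}H^i_{j-n}H^n_l+H^i_{-1}H^j_{-1}H^2_l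 ,$$ with the topology of coordinatewise convergence. For $H\in\mathcal H$ let $\Gamma^1_\infty(H)$ be the common zero set, in the infinite-dimensional affine space with coordinates $p_2,p_3,p_4,\dots$, of the quadrics $$f^{(1)}_{ij}=p_ip_j-p_{i+j}-H^j_{-1}p_{i+1}-H^i_{-1}p_{j+1}-\sum_{l=2}^{i-1}H^j_{i-l}p_l-\sum_{l=2}^{j-1}H^i_{j-l}p_l-H^i_{-1}H^j_{-1}p_2-\bigl(H^i_j+H^j_i+H^i_{-1}H^j_1+H^i_1H^j_{-1}\bigr),\quad i,j\ge2,$$ and let $\Gamma^1_d(H)$, $d\ge2$, be its projection to the $d$-dimensional space with coordinates $p_2,\dots,p_{d+1}$. Put $$\begin{aligned}\mathcal F^1_{23}={}&p_3^2-p_2^3+3H^2_{-1}p_3p_2-2H^3_{-1}p_2^2+\bigl((H^2_{-1})^3+3H^2_1+H^2_{-1}H^3_{-1}\bigr)p_3\\&-\bigl((H^3_{-1})^2+2H^3_1-3H^2_{-1}H^2_1-3H^2_2+H^3_{-1}(H^2_{-1})^2\bigr)p_2-2H^3_3-2H^3_{-1}H^3_1+3H^2_4+3H^2_2(H^2_{-1})^2\\&-\tfrac32H^2_{-1}H^2_3+3(H^2_1)^2-\tfrac32(H^2_{-1})^2H^3_1-\tfrac12H^2_{-1}H^2_1H^3_{-1}+4H^3_{-1}H^2_2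 .\end{aligned}$$ \textbf{Proposition.} The stratum $\Sigma_1$ contains the infinite family of varieties $\Gamma^1_\infty(H)$, parameterized by $H\in\mathcal H$, and this family is an infinite tower of algebraic curves, generically of genus $1$, with an elliptic curve at the base. Precisely: (1) The map $H\mapsto\Gamma^1_\infty(H)$ is injective on $\mathcal H$, and the set of the varieties $\Gamma^1_\infty(H)$, $H\in\mathcal H$, is infinite. (2) For $H\in\mathcal H$ and every series $q$ of order $-1$ the space $W_1(H)+\mathbb Cq$ is a point of $\Sigma_1$. The substitution $p_n\mapsto p_n(z)$ is a ring homomorphism from $\mathbb C[p_2,p_3,\dots]$ to $\mathbb C((z^{-1}))$ with image $W_1(H)$ (so $W_1(H)$ is closed under multiplication), and its kernel is the ideal of $\Gamma^1_\infty(H)$. (3) For $H\in\mathcal H$ there are polynomials $\alpha_n,\beta_n\in\mathbb C[X]$ $(n\ge4)$ of degrees at most $[n/2]$ and $[(n-3)/2]$ such that $p_n(z)=\alpha_n(p_2(z))+\beta_n(p_2(z))\,p_3(z)$ and, with $h^{(1)}_n=p_n-\alpha_n(p_2)-\beta_n(p_2)p_3$, $$I(\Gamma^1_\infty(H))=\langle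 f^{(1)}_{ij}: i,j\ge2\rangle=\langle\mathcal F^1_{23},h^{(1)}_4,h^{(1)}_5,\dots\rangle,\qquad I(\Gamma^1_d(H))=\langle\mathcal F^1_{23},h^{(1)}_4,\dots,h^{(1)}_{d+1}\rangle\quad(d\ge2).$$ (4) For $H\in\mathcal H$, $\Gamma^1_\infty(H)$ and all $\Gamma^1_d(H)$, $d\ge2$, are irreducible algebraic curves (Zariski closed, with prime ideal and coordinate ring of Krull dimension $1$). The projection $\Gamma^1_{d+1}(H)\to\Gamma^1_d(H)$ is bijective for every $d\ge2$, and $\Gamma^1_2(H)$ is the plane Weierstrass cubic $\mathcal F^1_{23}=0$. (5) The set of $H\in\mathcal H$ for which the cubic $\mathcal F^1_{23}=0$ has nonzero discriminant, so that it is an elliptic curve, is open and dense in $\mathcal H$. For each such $H$ the curves $\Gamma^1_\infty(H)$ and $\Gamma^1_d(H)$, $d\ge2$, all have geometric genus $1$. -/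

import Mathlib

open Polynomial

noncomputable section

namespace SatoStratum

/-! ### The Sato Grassmannian

Laurent series in `z` with finitely many positive powers are elements of `LaurentSeries ℂ` in the
variable `t = 1 / z`: the coefficient of `z ^ k` is the coefficient at exponent `-k`. -/

/-- The space `z⁻¹ ℂ⟦z⁻¹⟧` of series with negative powers of `z` only. The quotient of
`LaurentSeries ℂ` by it is the space `H₊ = ℂ[z]`. -/
def negPart : Submodule ℂ (LaurentSeries ℂ) where
  carrier := {f | ∀ m : ℤ, m ≤ 0 → f.coeff m = 0}
  add_mem' := by
    intro f g hf hg m hm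
    simp [hf m hm, hg m hm]
  zero_mem' := by
    intro m _
    simp
  smul_mem' := by
    intro c f hf m hm
    simp [hf m hm]

/-- The projection `W → H₊`. -/
def projPlus (W : Submodule ℂ (LaurentSeries ℂ)) :
    W →ₗ[ℂ] (LaurentSeries ℂ ⧸ negPart) :=
  negPart.mkQ.comp W.subtype

/-- `W` is closed in the topology in which the spaces `z⁻ᴺ ℂ⟦z⁻¹⟧` form a basis at `0`. -/
def IsClosedSubspace (W : Submodule ℂ (LaurentSeries ℂ)) : Prop :=
  ∀ f : LaurentSeries ℂ,
    (∀ N : ℤ, ∃ w ∈ W, ∀ m : ℤ, m < N → (f - w).coeff m = 0) → f ∈ W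

/-- The Sato Grassmannian: closed subspaces with Fredholm projection to `H₊`. -/
def satoGrassmannian : Set (Submodule ℂ (LaurentSeries ℂ)) :=
  {W | IsClosedSubspace W ∧
    Module.Finite ℂ (LinearMap.ker (projPlus W)) ∧
    Module.Finite ℂ ((LaurentSeries ℂ ⧸ negPart) ⧸ LinearMap.range (projPlus W))}

/-- The set `S_W` of the orders in `z` (the highest power that occurs) of the nonzero elements
of `W`. -/
def orderSet (W : Submodule ℂ (LaurentSeries ℂ)) : Set ℤ :=
  {s | ∃ w ∈ W, w ≠ 0 ∧ -w.order = s}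

/-- The Birkhoff stratum `Σ_S`. -/
def birkhoffStratum (S : Set ℤ) : Set (Submodule ℂ (LaurentSeries ℂ)) :=
  {W | W ∈ satoGrassmannian ∧ orderSet W = S}

/-- The stratum `Σ₁`, with `S = {-1, 0, 2, 3, 4, …}`. -/
def stratumOne : Set (Submodule ℂ (LaurentSeries ℂ)) :=
  birkhoffStratum {s | s = -1 ∨ s = 0 ∨ 2 ≤ s}

/-! ### The canonical series and their parameters -/

/-- The series `p_i(z) = z ^ i + H^i_{-1} z + ∑_{k ≥ 1} H^i_k z ^ (-k)`; the entry `H i k` is the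
parameter `H^i_k`. -/
def pSeries (H : ℕ → ℤ → ℂ) (i : ℕ) : LaurentSeries ℂ :=
  HahnSeries.single (-(i : ℤ)) 1 +
    HahnSeries.ofSuppBddBelow (fun k : ℤ => if k = -1 ∨ 1 ≤ k then H i k else 0)
      ⟨-1, by
        intro k hk
        by_contra hlt
        have h1 : ¬ (k = -1 ∨ 1 ≤ k) := by omega
        exact hk (if_neg h1)⟩

/-- The span of `1, p_2(z), p_3(z), …`. -/
def spanW (H : ℕ → ℤ → ℂ) : Submodule ℂ (LaurentSeries ℂ) :=
  Submodule.span ℂ (insert 1 (pSeries H '' Set.Ici 2))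

/-- The substitution `p_n ↦ p_n(z)` for polynomials in the coordinates `p_2, p_3, …`. -/
def substSeries (H : ℕ → ℤ → ℂ) : MvPolynomial (Set.Ici 2 : Set ℕ) ℂ →+* LaurentSeries ℂ :=
  MvPolynomial.eval₂Hom HahnSeries.C (fun n => pSeries H n.1)

/-- The parameters `H^i_k` (`i = 2, 3, …`, `k = -1, 1, 2, 3, …`) that obey the associativity
equations. The entries of `H` which are no parameters are set to `0`. -/
def params : Set (ℕ → ℤ → ℂ) :=
  {H | (∀ (i : ℕ) (k : ℤ), i < 2 ∨ k < -1 ∨ k = 0 → H i k = 0) ∧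
    ∀ (i j : ℕ) (l : ℤ), 2 ≤ i → 2 ≤ j → l = -1 ∨ 1 ≤ l →
      H i (j + l) + H j (i + l) + H j (-1) * H i (l + 1) + H i (-1) * H j (l + 1)
          + ∑ n ∈ Finset.Ico (1 : ℤ) l, H j n * H i (l - n)
        = H (i + j) l + H j (-1) * H (i + 1) l + H i (-1) * H (j + 1) l
          + ∑ n ∈ Finset.Ico 2 i, H j ((i : ℤ) - n) * H n l
          + ∑ n ∈ Finset.Ico 2 j, H i ((j : ℤ) - n) * H n l
          + H i (-1) * H j (-1) * H 2 l}

/-! ### The varieties -/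

open scoped Classical in
/-- The coordinate `p_n` on the affine space with coordinates indexed by `s ⊆ ℕ` (used for
`n ∈ s` only). -/
def coord (s : Set ℕ) (n : ℕ) : MvPolynomial s ℂ :=
  if h : n ∈ s then MvPolynomial.X ⟨n, h⟩ else 0

/-- The quadric `f^{(1)}_{ij}` in the coordinates `p_2, p_3, p_4, …`. -/
def quadric (H : ℕ → ℤ → ℂ) (i j : ℕ) : MvPolynomial (Set.Ici 2 : Set ℕ) ℂ :=
  let p := coord (Set.Ici 2)
  p i * p j - p (i + j) - MvPolynomial.C (H j (-1)) * p (i + 1)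
    - MvPolynomial.C (H i (-1)) * p (j + 1)
    - ∑ l ∈ Finset.Ico 2 i, MvPolynomial.C (H j ((i : ℤ) - l)) * p l
    - ∑ l ∈ Finset.Ico 2 j, MvPolynomial.C (H i ((j : ℤ) - l)) * p l
    - MvPolynomial.C (H i (-1) * H j (-1)) * p 2
    - MvPolynomial.C (H i j + H j i + H i (-1) * H j 1 + H i 1 * H j (-1))

/-- The quadrics `f^{(1)}_{ij}`, `i, j ≥ 2`. -/
def quadrics (H : ℕ → ℤ → ℂ) : Set (MvPolynomial (Set.Ici 2 : Set ℕ) ℂ) :=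
  {f | ∃ i j : ℕ, 2 ≤ i ∧ 2 ≤ j ∧ f = quadric H i j}

/-- The member with parameters `H` of the family `Γ¹_∞`: the intersection of the quadrics in
the infinite-dimensional affine space with coordinates `p_2, p_3, p_4, …`. -/
def gammaInf (H : ℕ → ℤ → ℂ) : Set ((Set.Ici 2 : Set ℕ) → ℂ) :=
  {x | ∀ i j : ℕ, 2 ≤ i → 2 ≤ j → MvPolynomial.aeval x (quadric H i j) = 0}

/-- The projection of the infinite-dimensional affine space to the coordinates
`p_2, …, p_{d+1}`. -/
def proj (d : ℕ) (x : (Set.Ici 2 : Set ℕ) → ℂ) : (Set.Icc 2 (d + 1) : Set ℕ) → ℂ :=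
  fun n => x ⟨n.1, n.2.1⟩

/-- The projection forgetting the coordinate `p_{d+2}`. -/
def dropLast (d : ℕ) (x : (Set.Icc 2 (d + 2) : Set ℕ) → ℂ) :
    (Set.Icc 2 (d + 1) : Set ℕ) → ℂ :=
  fun n => x ⟨n.1, n.2.1, n.2.2.trans (Nat.le_succ _)⟩

/-- The level `Γ¹_d` of the tower, in the `d`-dimensional space with coordinates
`p_2, …, p_{d+1}`. -/
def gammaLevel (H : ℕ → ℤ → ℂ) (d : ℕ) : Set ((Set.Icc 2 (d + 1) : Set ℕ) → ℂ) :=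
  proj d '' gammaInf H

/-- The Weierstrass cubic `y² + a₁ x y + a₃ y = x³ + a₂ x² + a₄ x + a₆`, with `x = p_2` and
`y = p_3`, at the base of the tower. -/
def baseCurve (H : ℕ → ℤ → ℂ) : WeierstrassCurve ℂ where
  a₁ := 3 * H 2 (-1)
  a₂ := 2 * H 3 (-1)
  a₃ := H 2 (-1) ^ 3 + 3 * H 2 1 + H 2 (-1) * H 3 (-1)
  a₄ := H 3 (-1) ^ 2 + 2 * H 3 1 - 3 * H 2 (-1) * H 2 1 - 3 * H 2 2
    + H 3 (-1) * H 2 (-1) ^ 2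
  a₆ := -(-2 * H 3 3 - 2 * H 3 (-1) * H 3 1 + 3 * H 2 4 + 3 * H 2 2 * H 2 (-1) ^ 2
    - 3 / 2 * H 2 (-1) * H 2 3 + 3 * H 2 1 ^ 2 - 3 / 2 * H 2 (-1) ^ 2 * H 3 1
    - 1 / 2 * H 2 (-1) * H 2 1 * H 3 (-1) + 4 * H 3 (-1) * H 2 2)

/-- The polynomial `𝓕¹₂₃` in the coordinates `p_2, p_3`. -/
def cubicF (s : Set ℕ) (H : ℕ → ℤ → ℂ) : MvPolynomial s ℂ :=
  let E := baseCurve H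
  let x := coord s 2
  let y := coord s 3
  y ^ 2 - x ^ 3 + MvPolynomial.C E.a₁ * y * x - MvPolynomial.C E.a₂ * x ^ 2
    + MvPolynomial.C E.a₃ * y - MvPolynomial.C E.a₄ * x - MvPolynomial.C E.a₆

/-- The polynomial `h^{(1)}_n = p_n - α_n(p_2) - β_n(p_2) p_3`. -/
def graphPoly (s : Set ℕ) (α β : ℕ → ℂ[X]) (n : ℕ) : MvPolynomial s ℂ :=
  coord s n - Polynomial.aeval (coord s 2) (α n)
    - Polynomial.aeval (coord s 2) (β n) * coord s 3

/-! ### Curves and their genus -/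

/-- `V` is an irreducible algebraic curve in the affine space `σ → ℂ`. -/
def IsIrreducibleCurve {σ : Type} (V : Set (σ → ℂ)) : Prop :=
  MvPolynomial.zeroLocus ℂ (MvPolynomial.vanishingIdeal ℂ V) = V ∧
    (MvPolynomial.vanishingIdeal ℂ V).IsPrime ∧
    ringKrullDim (MvPolynomial σ ℂ ⧸ MvPolynomial.vanishingIdeal ℂ V) = 1

/-- The differentials of a function field `K / ℂ` of one variable that are regular at every
place: for every valuation ring `O ⊇ ℂ` of `K` they lie in the `O`-span of the `db`, `b ∈ O`. -/
def regularDifferentials (K : Type) [Field K] [Algebra ℂ K] : Submodule ℂ (Ω[K⁄ℂ]) :=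
  ⨅ (O : ValuationSubring K) (_ : ∀ c : ℂ, algebraMap ℂ K c ∈ O),
    Submodule.span ℂ {η | ∃ a ∈ O, ∃ b ∈ O, η = a • KaehlerDifferential.D ℂ K b}

/-- The irreducible curve `V` has geometric genus `g`: the regular differentials of its function
field (the field of fractions of its coordinate ring), that is, of the smooth projective model of
`V`, form a space of dimension `g`. -/
def HasGenus {σ : Type} (V : Set (σ → ℂ)) (g : ℕ) : Prop :=
  IsIrreducibleCurve V ∧
    ∀ (K : Type) [Field K] [Algebra ℂ K]
      [Algebra (MvPolynomial σ ℂ ⧸ MvPolynomial.vanishingIdeal ℂ V) K]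
      [IsScalarTower ℂ (MvPolynomial σ ℂ ⧸ MvPolynomial.vanishingIdeal ℂ V) K]
      [IsFractionRing (MvPolynomial σ ℂ ⧸ MvPolynomial.vanishingIdeal ℂ V) K],
      Module.rank ℂ (regularDifferentials K) = g

end SatoStratum

end

noncomputable section

namespace SatoStratum

/-! ### Coefficients of Laurent series -/

/-! Compare the coefficients of p_i(z)p_j(z) with those of the linear combination prescribed by the
quadric. At z^0, z^2, z^3, … they agree for every H; at z and at the negative powers of z their
equality is exactly the system of associativity equations (`pSeries_mul_eq_iff`). So H lies in 𝓗 if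
and only if the span W_1(H) is a ring.

In any ring where this multiplication law holds, p_2p_j = p_{j+2} + … expresses every p_n as
α_n(p_2) + β_n(p_2)p_3 (`isLowCombination_of_mulLaw`), and comparing p_3² with p_2³ yields the
Weierstrass cubic (`cubicValue_eq_zero`). Modulo the quadrics the polynomial ring is therefore a
quotient of the coordinate ring ℂ[x] ⊕ ℂ[x]y of the cubic. No further relation exists, since this
ring embeds into the Laurent series: a(x) and b(x)y have poles of different parity at infinity.
Hence the ideal of the quadrics, the kernel of the substitution and the ideal of the graph over the
cubic coincide (`exists_describes`), and all levels of the tower have the coordinate ring of the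
cubic (`towerEquiv`).

For the genus, the invariant differential ω = dx/(2y + a₁x + a₃) of an elliptic curve is regular at
every place. Conversely, if kω is regular, then k is regular at the finite places, hence lies in the
Dedekind domain ℂ[x, y], and it has no pole at infinity, hence is constant
(`rank_regularDifferentials`).

For density, p_2(z) is kept and p_3(z) is replaced by the solution of the cubic with a₆ + ε in place
of a₆. The span remains a ring, so this is a continuous path in 𝓗 (`exists_perturbation`), and the
discriminant is a nonzero polynomial in ε. Injectivity holds because the ideal of the variety
determines the kernel of the substitution, from which the parameters can be read off
(`injOn_gammaInf`). -/

lemma coeff_mul_eq_sum_Icc {f g : LaurentSeries ℂ} {a b : ℤ} (hf : ∀ m < a, f.coeff m = 0)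
    (hg : ∀ m < b, g.coeff m = 0) (m : ℤ) :
    (f * g).coeff m = ∑ n ∈ Finset.Icc a (m - b), f.coeff n * g.coeff (m - n) := by
  rw [HahnSeries.coeff_mul]
  have key : ∀ ij ∈ Finset.antidiagonal f.isPWO_support g.isPWO_support m,
      f.coeff ij.1 ≠ 0 ∧ g.coeff ij.2 ≠ 0 ∧ ij.1 + ij.2 = m := fun ij hij => by
    simpa using hij
  refine Finset.sum_of_injOn Prod.fst ?_ ?_ ?_ ?_
  · intro p hp q hq hpq
    have h1 := (key p hp).2.2
    have h2 := (key q hq).2.2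
    exact Prod.ext hpq (by omega)
  · intro p hp
    obtain ⟨h1, h2, h3⟩ := key p hp
    have ha : a ≤ p.1 := by
      by_contra h
      exact h1 (hf _ (by omega))
    have hb : b ≤ p.2 := by
      by_contra h
      exact h2 (hg _ (by omega))
    simp only [Finset.coe_Icc, Set.mem_Icc]
    omega
  · intro n _ hn
    by_contra h
    apply hn
    refine ⟨(n, m - n), ?_, rfl⟩
    have h1 := left_ne_zero_of_mul h
    have h2 := right_ne_zero_of_mul h
    simp [h1, h2]
  · intro p hp
    have h3 := (key p hp).2.2
    rw [← h3]
    simp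

/-- `f` starts with the term `c t ^ a`, where `c` may vanish. -/
def StartsWith (f : LaurentSeries ℂ) (a : ℤ) (c : ℂ) : Prop :=
  (∀ m < a, f.coeff m = 0) ∧ f.coeff a = c

lemma StartsWith.mul {f g : LaurentSeries ℂ} {a b : ℤ} {c d : ℂ} (hf : StartsWith f a c)
    (hg : StartsWith g b d) : StartsWith (f * g) (a + b) (c * d) := by
  constructor
  · intro m hm
    rw [coeff_mul_eq_sum_Icc hf.1 hg.1, Finset.Icc_eq_empty (by omega), Finset.sum_empty]
  · rw [coeff_mul_eq_sum_Icc hf.1 hg.1, add_sub_cancel_right, Finset.Icc_self,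
      Finset.sum_singleton, hf.2, add_sub_cancel_left, hg.2]

lemma StartsWith.add {f g : LaurentSeries ℂ} {a : ℤ} {c d : ℂ} (hf : StartsWith f a c)
    (hg : StartsWith g a d) : StartsWith (f + g) a (c + d) :=
  ⟨fun m hm => by simp [hf.1 m hm, hg.1 m hm], by simp [hf.2, hg.2]⟩

lemma StartsWith.of_lt {f : LaurentSeries ℂ} {a b : ℤ} {c : ℂ} (hf : StartsWith f a c)
    (hb : b < a) : StartsWith f b 0 :=
  ⟨fun m hm => hf.1 m (by omega), hf.1 b hb⟩

lemma coeff_C_mul (c : ℂ) (f : LaurentSeries ℂ) (m : ℤ) :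
    (HahnSeries.C c * f).coeff m = c * f.coeff m := by
  rw [HahnSeries.C_mul_eq_smul]
  rfl

lemma smul_eq_C_mul (c : ℂ) (f : LaurentSeries ℂ) : c • f = HahnSeries.C c * f :=
  HahnSeries.C_mul_eq_smul.symm

lemma StartsWith.C_mul {f : LaurentSeries ℂ} {a : ℤ} {c : ℂ} (hf : StartsWith f a c) (e : ℂ) :
    StartsWith (HahnSeries.C e * f) a (e * c) :=
  ⟨fun m hm => by rw [coeff_C_mul, hf.1 m hm, mul_zero], by rw [coeff_C_mul, hf.2]⟩

lemma startsWith_C (c : ℂ) : StartsWith (HahnSeries.C c) 0 c := by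
  constructor
  · intro m hm
    simp [HahnSeries.C_apply, hm.ne]
  · simp

lemma startsWith_one : StartsWith 1 0 1 := by simpa using startsWith_C 1

lemma StartsWith.pow {f : LaurentSeries ℂ} {a : ℤ} (hf : StartsWith f a 1) (n : ℕ) :
    StartsWith (f ^ n) (n * a) 1 := by
  induction n with
  | zero => simpa using startsWith_one
  | succ n ih =>
    have h := ih.mul hf
    rw [← pow_succ, one_mul] at h
    convert h using 1
    push_cast
    ring

lemma StartsWith.eval₂ {f : LaurentSeries ℂ} (hf : StartsWith f (-2) 1) (p : ℂ[X]) :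
    StartsWith (p.eval₂ HahnSeries.C f) (-2 * p.natDegree) p.leadingCoeff := by
  have hterm : ∀ i, StartsWith (HahnSeries.C (p.coeff i) * f ^ i) (-2 * i) (p.coeff i) := by
    intro i
    simpa [mul_comm] using (hf.pow i).C_mul (p.coeff i)
  rw [Polynomial.eval₂_eq_sum_range, Finset.sum_range_succ]
  have hlow : StartsWith (∑ i ∈ Finset.range p.natDegree, HahnSeries.C (p.coeff i) * f ^ i)
      (-2 * p.natDegree) 0 := by
    have : ∀ i ∈ Finset.range p.natDegree,
        StartsWith (HahnSeries.C (p.coeff i) * f ^ i) (-2 * p.natDegree) 0 := fun i hi =>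
      (hterm i).of_lt (by have := Finset.mem_range.1 hi; omega)
    constructor
    · intro m hm
      rw [HahnSeries.coeff_sum]
      exact Finset.sum_eq_zero fun i hi => (this i hi).1 m hm
    · rw [HahnSeries.coeff_sum]
      exact Finset.sum_eq_zero fun i hi => (this i hi).2
  simpa using hlow.add (hterm p.natDegree)

lemma StartsWith.order {f : LaurentSeries ℂ} {a : ℤ} {c : ℂ} (hf : StartsWith f a c)
    (hc : c ≠ 0) : f.order = a := by
  have h0 : f ≠ 0 := by
    rintro rfl
    exact hc (by simpa using hf.2.symm)
  apply le_antisymm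
  · exact HahnSeries.order_le_of_coeff_ne_zero (by rw [hf.2]; exact hc)
  · exact (HahnSeries.le_order_iff_forall h0).2 hf.1

/-- If `g` starts with a nonzero term of exponent `b` and `f * g` has no terms of exponent less
than `a + b`, then `f` has no terms of exponent less than `a`. -/
lemma coeff_eq_zero_of_mul {f g : LaurentSeries ℂ} {a b : ℤ} {c : ℂ} (hg : StartsWith g b c)
    (hc : c ≠ 0) (h : ∀ m < a + b, (f * g).coeff m = 0) : ∀ m < a, f.coeff m = 0 := by
  intro m hm
  rcases eq_or_ne f 0 with rfl | hf
  · rfl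
  have hlead : f.coeff f.order ≠ 0 := fun h0 => hf (HahnSeries.coeff_order_eq_zero.1 h0)
  have hs : StartsWith f f.order (f.coeff f.order) :=
    ⟨fun m hm => HahnSeries.coeff_eq_zero_of_lt_order hm, rfl⟩
  have hmul := hs.mul hg
  refine HahnSeries.coeff_eq_zero_of_lt_order (lt_of_lt_of_le hm ?_)
  by_contra hneg
  have := h (f.order + b) (by omega)
  rw [hmul.2] at this
  exact mul_ne_zero hlead hc this

/-! ### The series `p_i` and their span -/

lemma coeff_pSeries (H : ℕ → ℤ → ℂ) (i : ℕ) (m : ℤ) :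
    (pSeries H i).coeff m =
      (if m = -(i : ℤ) then 1 else 0) + (if m = -1 ∨ 1 ≤ m then H i m else 0) := by
  rw [pSeries, HahnSeries.coeff_add]
  refine congrArg₂ (· + ·) ?_ rfl
  by_cases h : m = -(i : ℤ) <;> simp [h]

/-- The entries of `H` which are no parameters vanish. -/
def IsNormalized (H : ℕ → ℤ → ℂ) : Prop :=
  ∀ (i : ℕ) (k : ℤ), i < 2 ∨ k < -1 ∨ k = 0 → H i k = 0

lemma IsNormalized.coeff_pSeries {H : ℕ → ℤ → ℂ} (hH : IsNormalized H) (i : ℕ) (m : ℤ) :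
    (pSeries H i).coeff m = (if m = -(i : ℤ) then 1 else 0) + H i m := by
  rw [SatoStratum.coeff_pSeries]
  congr 1
  split_ifs with h
  · rfl
  · exact (hH i m (by omega)).symm

lemma startsWith_pSeries (H : ℕ → ℤ → ℂ) {i : ℕ} (hi : 2 ≤ i) :
    StartsWith (pSeries H i) (-i) 1 := by
  constructor
  · intro m hm
    rw [coeff_pSeries, if_neg hm.ne, if_neg (by omega), add_zero]
  · rw [coeff_pSeries, if_pos rfl, if_neg (by omega), add_zero]

lemma one_mem_spanW (H : ℕ → ℤ → ℂ) : 1 ∈ spanW H := Submodule.subset_span (by simp)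

lemma C_mem_spanW (H : ℕ → ℤ → ℂ) (c : ℂ) : HahnSeries.C c ∈ spanW H := by
  have := (spanW H).smul_mem c (one_mem_spanW H)
  rwa [← HahnSeries.C_mul_eq_smul, mul_one] at this

lemma pSeries_mem_spanW (H : ℕ → ℤ → ℂ) {i : ℕ} (hi : 2 ≤ i) : pSeries H i ∈ spanW H :=
  Submodule.subset_span (Or.inr ⟨i, hi, rfl⟩)

lemma C_mul_mem_spanW {H : ℕ → ℤ → ℂ} (c : ℂ) {f : LaurentSeries ℂ} (hf : f ∈ spanW H) :
    HahnSeries.C c * f ∈ spanW H := by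
  rw [HahnSeries.C_mul_eq_smul]
  exact (spanW H).smul_mem c hf

lemma mul_mem_spanW {H : ℕ → ℤ → ℂ} {f w : LaurentSeries ℂ} (hf : f ∈ spanW H)
    (h : ∀ j, 2 ≤ j → f * pSeries H j ∈ spanW H) (hw : w ∈ spanW H) : f * w ∈ spanW H := by
  induction hw using Submodule.span_induction with
  | mem w hw =>
    rcases hw with rfl | ⟨j, hj, rfl⟩
    · rwa [mul_one]
    · exact h j hj
  | zero =>
    rw [mul_zero]
    exact zero_mem _
  | add v w _ _ hv hw =>
    rw [mul_add]
    exact add_mem hv hw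
  | smul c w _ hw =>
    rw [smul_eq_C_mul, mul_left_comm]
    exact C_mul_mem_spanW c hw

/-- An element of the span is the combination of the generators given by its coefficients. -/
lemma exists_eq_sum_of_mem_spanW {H : ℕ → ℤ → ℂ} {w : LaurentSeries ℂ} (hw : w ∈ spanW H) :
    ∃ N : ℕ, ∀ M ≥ N, w = HahnSeries.C (w.coeff 0) +
      ∑ n ∈ Finset.Ico 2 M, HahnSeries.C (w.coeff (-(n : ℤ))) * pSeries H n := by
  induction hw using Submodule.span_induction with
  | mem x hx =>
    rcases hx with rfl | ⟨i, hi, rfl⟩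
    · refine ⟨0, fun M _ => ?_⟩
      rw [Finset.sum_eq_zero]
      · simp
      · intro n hn
        have := (Finset.mem_Ico.1 hn).1
        rw [HahnSeries.coeff_one, if_neg (by omega), map_zero, zero_mul]
    · rw [Set.mem_Ici] at hi
      refine ⟨i + 1, fun M hM => ?_⟩
      rw [Finset.sum_eq_single_of_mem i (Finset.mem_Ico.2 ⟨hi, by omega⟩)]
      · rw [(startsWith_pSeries H hi).2, coeff_pSeries, if_neg (by omega), if_neg (by omega)]
        simp
      · intro n hn hne
        have := (Finset.mem_Ico.1 hn).1
        rw [coeff_pSeries, if_neg (by omega), if_neg (by omega)]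
        simp
  | zero => exact ⟨0, fun M _ => by simp⟩
  | add x y _ _ hx hy =>
    obtain ⟨N, hN⟩ := hx
    obtain ⟨N', hN'⟩ := hy
    refine ⟨max N N', fun M hM => ?_⟩
    have h1 := hN M (le_trans (le_max_left _ _) hM)
    have h2 := hN' M (le_trans (le_max_right _ _) hM)
    simp only [HahnSeries.coeff_add, map_add, add_mul, Finset.sum_add_distrib]
    nth_rewrite 1 [h1]
    nth_rewrite 1 [h2]
    ring
  | smul c x _ hx =>
    obtain ⟨N, hN⟩ := hx
    refine ⟨N, fun M hM => ?_⟩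
    rw [smul_eq_C_mul]
    simp only [coeff_C_mul, map_mul, mul_assoc, ← Finset.mul_sum]
    rw [← mul_add, ← hN M hM]

/-- At the exponents 0 and -n, n ≥ 2, a generator has no term besides its own leading one, so these
coefficients are coordinates on the span. -/
lemma eq_zero_of_mem_spanW {H : ℕ → ℤ → ℂ} {w : LaurentSeries ℂ} (hw : w ∈ spanW H)
    (h : ∀ m : ℤ, m ≤ 0 → m ≠ -1 → w.coeff m = 0) : w = 0 := by
  obtain ⟨N, hN⟩ := exists_eq_sum_of_mem_spanW hw
  rw [hN N le_rfl, h 0 le_rfl (by norm_num), map_zero, zero_add]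
  refine Finset.sum_eq_zero fun n hn => ?_
  have := (Finset.mem_Ico.1 hn).1
  rw [h _ (by omega) (by omega), map_zero, zero_mul]

/-! ### The points of the stratum -/

lemma coeff_sum_C_mul_pSeries (H : ℕ → ℤ → ℂ) (c : ℤ → ℂ) (M : ℕ) {m : ℤ} (hm : m ≤ 0)
    (hm1 : m ≠ -1) :
    (HahnSeries.C (c 0) + ∑ n ∈ Finset.Ico 2 M, HahnSeries.C (c (-(n : ℤ))) * pSeries H n).coeff m
      = if m = 0 ∨ -(M : ℤ) < m then c m else 0 := by
  rw [HahnSeries.coeff_add, HahnSeries.coeff_sum]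
  simp only [coeff_C_mul, coeff_pSeries]
  have hneg : ¬(m = -1 ∨ 1 ≤ m) := by omega
  simp only [hneg, if_false, add_zero]
  rcases eq_or_lt_of_le hm with rfl | hlt
  · rw [Finset.sum_eq_zero]
    · simp
    · intro n hn
      have := (Finset.mem_Ico.1 hn).1
      rw [if_neg (by omega), mul_zero]
  · have h0 : (HahnSeries.C (c 0) : LaurentSeries ℂ).coeff m = 0 := (startsWith_C _).1 m hlt
    rw [h0, zero_add]
    obtain ⟨k, rfl⟩ : ∃ k : ℕ, m = -(k : ℤ) := ⟨m.natAbs, by omega⟩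
    by_cases hk : k < M
    · rw [if_pos (by omega), Finset.sum_eq_single_of_mem k (Finset.mem_Ico.2 ⟨by omega, hk⟩)]
      · simp
      · intro n _ hne
        rw [if_neg (by omega), mul_zero]
    · rw [if_neg (by omega), Finset.sum_eq_zero]
      intro n hn
      have := (Finset.mem_Ico.1 hn).2
      rw [if_neg (by omega), mul_zero]

lemma sum_mem_spanW (H : ℕ → ℤ → ℂ) (a : ℂ) (c : ℕ → ℂ) (M : ℕ) :
    HahnSeries.C a + ∑ n ∈ Finset.Ico 2 M, HahnSeries.C (c n) * pSeries H n ∈ spanW H :=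
  add_mem (C_mem_spanW H a) (sum_mem fun _ hn =>
    C_mul_mem_spanW _ (pSeries_mem_spanW H (Finset.mem_Ico.1 hn).1))

section Stratum

variable {H : ℕ → ℤ → ℂ} {q : LaurentSeries ℂ} 
lemma startsWith_of_order_eq_one (hq : q.order = 1) : (∀ m < 1, q.coeff m = 0) ∧ q.coeff 1 ≠ 0 := by
  have h0 : q ≠ 0 := by
    rintro rfl
    simp at hq
  refine ⟨fun m hm => HahnSeries.coeff_eq_zero_of_lt_order (by rw [hq]; exact hm), ?_⟩
  rw [← hq]
  simpa using h0

lemma mem_spanW_sup_iff {w : LaurentSeries ℂ} :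
    w ∈ spanW H ⊔ Submodule.span ℂ {q} ↔ ∃ v ∈ spanW H, ∃ c : ℂ, w = v + HahnSeries.C c * q := by
  rw [Submodule.mem_sup]
  constructor
  · rintro ⟨v, hv, u, hu, rfl⟩
    obtain ⟨c, rfl⟩ := Submodule.mem_span_singleton.1 hu
    exact ⟨v, hv, c, by rw [smul_eq_C_mul]⟩
  · rintro ⟨v, hv, c, rfl⟩
    exact ⟨v, hv, HahnSeries.C c * q, Submodule.mem_span_singleton.2 ⟨c, smul_eq_C_mul c q⟩, rfl⟩

/-- An element of the space without coefficients in nonpositive exponents is a multiple of `q`. -/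
lemma exists_eq_C_mul_of_coeff_eq_zero (hq : q.order = 1) {w : LaurentSeries ℂ}
    (hw : w ∈ spanW H ⊔ Submodule.span ℂ {q})
    (h : ∀ m : ℤ, m ≤ 0 → m ≠ -1 → w.coeff m = 0) : ∃ c : ℂ, w = HahnSeries.C c * q := by
  obtain ⟨v, hv, c, rfl⟩ := mem_spanW_sup_iff.1 hw
  refine ⟨c, ?_⟩
  rw [eq_zero_of_mem_spanW hv, zero_add]
  intro m hm hm1
  have := h m hm hm1
  rw [HahnSeries.coeff_add, coeff_C_mul,
    (startsWith_of_order_eq_one hq).1 m (by omega), mul_zero, add_zero] at this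
  exact this

lemma isClosedSubspace_sup (hq : q.order = 1) : IsClosedSubspace (spanW H ⊔ Submodule.span ℂ {q}) := by
  intro f hf
  -- Two elements of the space that agree below exponent 2 are equal: their difference is a multiple
  -- of `q` without leading term. So the approximation for N = 2 is already `f`.
  obtain ⟨w, hw, hw2⟩ := hf 2
  have key : ∀ N : ℤ, ∀ m < N, (f - w).coeff m = 0 := by
    intro N m hm
    obtain ⟨v, hv, hvN⟩ := hf (max N 2)
    have hz : ∀ m < 2, (v - w).coeff m = 0 := by
      intro m hm
      have h1 := hw2 m hm
      have h2 := hvN m (lt_of_lt_of_le hm (le_max_right _ _))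
      rw [HahnSeries.coeff_sub] at h1 h2 ⊢
      linear_combination h1 - h2
    obtain ⟨c, hc⟩ := exists_eq_C_mul_of_coeff_eq_zero hq (sub_mem hv hw)
      (fun m hm _ => hz m (by omega))
    have hc0 : c = 0 := by
      have := hz 1 (by norm_num)
      rw [hc, coeff_C_mul] at this
      exact (mul_eq_zero.1 this).resolve_right (startsWith_of_order_eq_one hq).2
    rw [hc0, map_zero, zero_mul, sub_eq_zero] at hc
    rw [← hc]
    exact hvN m (lt_of_lt_of_le hm (le_max_left _ _))
  have : f = w := by
    ext m
    have := key (m + 1) m (by omega)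
    rw [HahnSeries.coeff_sub] at this
    linear_combination this
  rwa [this]

lemma finite_ker_projPlus (hq : q.order = 1) :
    Module.Finite ℂ (LinearMap.ker (projPlus (spanW H ⊔ Submodule.span ℂ {q}))) := by
  set W := spanW H ⊔ Submodule.span ℂ {q} with hW
  let e : LinearMap.ker (projPlus W) →ₗ[ℂ] ℂ :=
    { toFun := fun w => w.1.1.coeff 1
      map_add' := fun _ _ => rfl
      map_smul' := fun _ _ => rfl }
  refine Module.Finite.of_injective e ?_
  rintro ⟨⟨v, hv⟩, hkv⟩ ⟨⟨w, hw⟩, hkw⟩ hvw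
  have hnv : v ∈ negPart := by
    simpa [projPlus, LinearMap.mem_ker] using hkv
  have hnw : w ∈ negPart := by
    simpa [projPlus, LinearMap.mem_ker] using hkw
  obtain ⟨c, hc⟩ := exists_eq_C_mul_of_coeff_eq_zero hq (sub_mem hv hw)
    (fun m hm _ => sub_mem hnv hnw m hm)
  have h1 : (v - w).coeff 1 = 0 := sub_eq_zero.2 hvw
  rw [hc, coeff_C_mul] at h1
  have hc0 := (mul_eq_zero.1 h1).resolve_right (startsWith_of_order_eq_one hq).2
  rw [hc0, map_zero, zero_mul, sub_eq_zero] at hc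
  subst hc
  rfl

/-- Subtracting the generators with the right leading coefficients leaves, modulo negative powers of
z, only a multiple of z. So the class of z spans the cokernel. -/
lemma finite_coker_projPlus :
    Module.Finite ℂ ((LaurentSeries ℂ ⧸ negPart) ⧸
      LinearMap.range (projPlus (spanW H ⊔ Submodule.span ℂ {q}))) := by
  set W := spanW H ⊔ Submodule.span ℂ {q} with hW
  refine Module.Finite.of_surjective (M := ℂ) ((LinearMap.range (projPlus W)).mkQ ∘ₗ
    LinearMap.toSpanSingleton ℂ _ (negPart.mkQ (HahnSeries.single (-1) (1 : ℂ)))) ?_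
  intro x
  obtain ⟨y, rfl⟩ := Submodule.mkQ_surjective _ x
  obtain ⟨f, rfl⟩ := Submodule.mkQ_surjective _ y
  obtain ⟨M, hM⟩ : ∃ M : ℕ, ∀ m : ℤ, m ≤ -M → f.coeff m = 0 := by
    refine ⟨f.order.natAbs + 1, fun m hm => HahnSeries.coeff_eq_zero_of_lt_order (by omega)⟩
  set w := HahnSeries.C (f.coeff 0) +
    ∑ n ∈ Finset.Ico 2 M, HahnSeries.C (f.coeff (-(n : ℤ))) * pSeries H n with hw
  have hwW : w ∈ W := Submodule.mem_sup_left (sum_mem_spanW H _ (fun n => f.coeff (-(n : ℤ))) M)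
  refine ⟨(f - w).coeff (-1), ?_⟩
  rw [LinearMap.comp_apply, ← sub_eq_zero, ← map_sub]
  rw [Submodule.mkQ_apply, Submodule.Quotient.mk_eq_zero]
  refine ⟨⟨-w, neg_mem hwW⟩, ?_⟩
  rw [LinearMap.toSpanSingleton_apply, ← map_smul, ← map_sub]
  change negPart.mkQ (-w) = _
  rw [← sub_eq_zero, ← map_sub, Submodule.mkQ_apply, Submodule.Quotient.mk_eq_zero,
    smul_eq_C_mul]
  intro m hm
  rw [HahnSeries.coeff_sub, HahnSeries.coeff_neg, HahnSeries.coeff_sub, coeff_C_mul,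
    HahnSeries.coeff_single]
  by_cases hm1 : m = -1
  · subst hm1
    simp
  · rw [if_neg hm1, mul_zero, hw, coeff_sum_C_mul_pSeries H f.coeff M hm hm1]
    split_ifs with h
    · ring
    · rw [hM m (by omega)]
      ring

lemma orderSet_sup (hq : q.order = 1) :
    orderSet (spanW H ⊔ Submodule.span ℂ {q}) = {s | s = -1 ∨ s = 0 ∨ 2 ≤ s} := by
  ext s
  constructor
  · rintro ⟨w, hw, hw0, rfl⟩
    by_cases h : ∀ m : ℤ, m ≤ 0 → m ≠ -1 → w.coeff m = 0
    · obtain ⟨c, rfl⟩ := exists_eq_C_mul_of_coeff_eq_zero hq hw h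
      left
      have hc : c ≠ 0 := by
        rintro rfl
        simp at hw0
      have hs := startsWith_of_order_eq_one hq
      have : StartsWith (HahnSeries.C c * q) 1 (c * q.coeff 1) :=
        ⟨fun m hm => by rw [coeff_C_mul, hs.1 m hm, mul_zero], coeff_C_mul _ _ _⟩
      rw [this.order (mul_ne_zero hc hs.2)]
    · obtain ⟨v, hv, c, rfl⟩ := mem_spanW_sup_iff.1 hw
      have hle : ∀ m ≤ 0, (v + HahnSeries.C c * q).coeff m = v.coeff m := fun m hm => by
        rw [HahnSeries.coeff_add, coeff_C_mul,
          (startsWith_of_order_eq_one hq).1 m (by omega), mul_zero, add_zero]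
      push Not at h
      obtain ⟨m, hm, hm1, hne⟩ := h
      have hord : (v + HahnSeries.C c * q).order ≤ m := HahnSeries.order_le_of_coeff_ne_zero hne
      right
      -- Only the order 1 in z has to be excluded. In that case `v` has no terms at the exponents
      -- -2, -3, …, so it is a constant, and then the coefficient of z vanishes.
      by_contra hs
      have hord1 : (v + HahnSeries.C c * q).order = -1 := by omega
      have hm0 : m = 0 := by
        have hlt : -1 ≤ m := by omega
        omega
      have hv0 : v = HahnSeries.C (v.coeff 0) := by
        have hsub : v - HahnSeries.C (v.coeff 0) ∈ spanW H := sub_mem hv (C_mem_spanW H _)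
        have := eq_zero_of_mem_spanW hsub (by
          intro k hk hk1
          rcases eq_or_lt_of_le hk with rfl | hlt
          · simp
          · rw [HahnSeries.coeff_sub, (startsWith_C _).1 k hlt, sub_zero, ← hle k hk]
            exact HahnSeries.coeff_eq_zero_of_lt_order (by omega))
        exact sub_eq_zero.1 this
      have hcoef : (v + HahnSeries.C c * q).coeff (-1) = 0 := by
        rw [hle _ (by norm_num), hv0]
        exact (startsWith_C _).1 _ (by norm_num)
      rw [← hord1] at hcoef
      exact hw0 (HahnSeries.coeff_order_eq_zero.1 hcoef)
  · rintro (rfl | rfl | hs)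
    · refine ⟨q, Submodule.mem_sup_right (Submodule.mem_span_singleton_self q), ?_, by rw [hq]⟩
      rintro rfl
      simp at hq
    · exact ⟨1, Submodule.mem_sup_left (one_mem_spanW H), one_ne_zero, by simp⟩
    · obtain ⟨n, rfl⟩ : ∃ n : ℕ, s = n := ⟨s.toNat, by omega⟩
      have hn : 2 ≤ n := by exact_mod_cast hs
      have hst := startsWith_pSeries H hn
      refine ⟨_, Submodule.mem_sup_left (pSeries_mem_spanW H hn), ?_, ?_⟩
      · intro h0
        have := hst.2
        rw [h0] at this
        simp at this
      · rw [hst.order one_ne_zero, neg_neg]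

theorem spanW_sup_mem_stratumOne (hq : q.order = 1) : spanW H ⊔ Submodule.span ℂ {q} ∈ stratumOne :=
  ⟨⟨isClosedSubspace_sup hq, finite_ker_projPlus hq, finite_coker_projPlus⟩, orderSet_sup hq⟩

end Stratum

/-! ### The multiplication law -/

/-- The linear combination to which the quadric `f_{ij}` reduces the product `p_i p_j`. -/
def reducedProduct (H : ℕ → ℤ → ℂ) {B : Type} [CommRing B] (c : ℂ →+* B) (P : ℕ → B)
    (i j : ℕ) : B :=
  P (i + j) + c (H j (-1)) * P (i + 1) + c (H i (-1)) * P (j + 1)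
    + ∑ l ∈ Finset.Ico 2 i, c (H j ((i : ℤ) - l)) * P l
    + ∑ l ∈ Finset.Ico 2 j, c (H i ((j : ℤ) - l)) * P l
    + c (H i (-1) * H j (-1)) * P 2
    + c (H i j + H j i + H i (-1) * H j 1 + H i 1 * H j (-1))

/-- The elements `P 2, P 3, …` obey the multiplication law given by the quadrics. -/
def MulLaw (H : ℕ → ℤ → ℂ) {B : Type} [CommRing B] (c : ℂ →+* B) (P : ℕ → B) : Prop :=
  ∀ i j : ℕ, 2 ≤ i → 2 ≤ j → P i * P j = reducedProduct H c P i j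

/-- The associativity equation with indices `i`, `j`, `l`. -/
def AssocEq (H : ℕ → ℤ → ℂ) (i j : ℕ) (l : ℤ) : Prop :=
  H i (j + l) + H j (i + l) + H j (-1) * H i (l + 1) + H i (-1) * H j (l + 1)
      + ∑ n ∈ Finset.Ico (1 : ℤ) l, H j n * H i (l - n)
    = H (i + j) l + H j (-1) * H (i + 1) l + H i (-1) * H (j + 1) l
      + ∑ n ∈ Finset.Ico 2 i, H j ((i : ℤ) - n) * H n l
      + ∑ n ∈ Finset.Ico 2 j, H i ((j : ℤ) - n) * H n l
      + H i (-1) * H j (-1) * H 2 l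

lemma mem_params_iff {H : ℕ → ℤ → ℂ} : H ∈ params ↔ IsNormalized H ∧
    ∀ (i j : ℕ) (l : ℤ), 2 ≤ i → 2 ≤ j → l = -1 ∨ 1 ≤ l → AssocEq H i j l := Iff.rfl

lemma reducedProduct_mem_spanW (H : ℕ → ℤ → ℂ) {i j : ℕ} (hi : 2 ≤ i) (hj : 2 ≤ j) :
    reducedProduct H HahnSeries.C (pSeries H) i j ∈ spanW H := by
  have hs : ∀ (a : ℕ) (f : ℕ → ℂ), ∑ l ∈ Finset.Ico 2 a,
      HahnSeries.C (f l) * pSeries H l ∈ spanW H := fun a f => sum_mem fun l hl =>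
    C_mul_mem_spanW _ (pSeries_mem_spanW H (Finset.mem_Ico.1 hl).1)
  have hp : ∀ (c : ℂ) (n : ℕ), 2 ≤ n → HahnSeries.C c * pSeries H n ∈ spanW H := fun c n hn =>
    C_mul_mem_spanW _ (pSeries_mem_spanW H hn)
  exact add_mem (add_mem (add_mem (add_mem (add_mem (add_mem (pSeries_mem_spanW H (by omega))
    (hp _ _ (by omega))) (hp _ _ (by omega))) (hs i fun l => H j ((i : ℤ) - l)))
    (hs j fun l => H i ((j : ℤ) - l))) (hp _ 2 le_rfl)) (C_mem_spanW H _)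

section Coeff

variable {H : ℕ → ℤ → ℂ} (hH : IsNormalized H)
include hH

lemma coeff_pSeries_mul_pSeries {i j : ℕ} (hi : 2 ≤ i) (hj : 2 ≤ j) (m : ℤ) :
    (pSeries H i * pSeries H j).coeff m =
      (if m = -((i : ℤ) + j) then 1 else 0) + H j (m + i)
        + H i (-1) * ((if m + 1 = -(j : ℤ) then 1 else 0) + H j (m + 1))
        + (if 1 ≤ m + j then H i (m + j) else 0)
        + H j (-1) * (if 1 ≤ m + 1 then H i (m + 1) else 0)
        + ∑ n ∈ Finset.Ico (1 : ℤ) m, H i n * H j (m - n) := by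
  have hN : ∀ i : ℕ, 2 ≤ i → ∃ N : LaurentSeries ℂ,
      pSeries H i = HahnSeries.single (-(i : ℤ)) 1 + HahnSeries.single (-1) (H i (-1)) + N ∧
      ∀ k, N.coeff k = if 1 ≤ k then H i k else 0 := by
    intro i hi
    refine ⟨pSeries H i - (HahnSeries.single (-(i : ℤ)) 1 + HahnSeries.single (-1) (H i (-1))),
      by ring, fun k => ?_⟩
    rw [HahnSeries.coeff_sub, HahnSeries.coeff_add, hH.coeff_pSeries]
    by_cases h1 : k = -1
    · subst h1
      have h2 : (-1 : ℤ) ≠ -(i : ℤ) := by omega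
      simp [h2]
    · rw [HahnSeries.coeff_single_of_ne h1]
      by_cases h2 : k = -(i : ℤ)
      · subst h2
        rw [hH i (-i) (by omega), if_neg (show ¬ (1 : ℤ) ≤ -i by omega)]
        simp
      · rw [HahnSeries.coeff_single_of_ne h2, if_neg h2]
        split_ifs with h3
        · ring
        · rw [hH i k (by omega)]
          ring
  obtain ⟨N, hpi, hNi⟩ := hN i hi
  obtain ⟨N', hpj, hNj⟩ := hN j hj
  -- Only the product of the two negative parts `N`, `N'` yields a convolution sum; in every other
  -- term one factor is a monomial or all of `pSeries H j` is shifted.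
  have hexp : pSeries H i * pSeries H j = HahnSeries.single (-(i : ℤ)) 1 * pSeries H j
      + HahnSeries.single (-1) (H i (-1)) * pSeries H j
      + N * HahnSeries.single (-(j : ℤ)) 1 + N * HahnSeries.single (-1) (H j (-1)) + N * N' := by
    nth_rewrite 1 [hpi]
    nth_rewrite 1 [add_mul, add_mul]
    nth_rewrite 3 [hpj]
    ring
  have hNN : (N * N').coeff m = ∑ n ∈ Finset.Ico (1 : ℤ) m, H i n * H j (m - n) := by
    rw [coeff_mul_eq_sum_Icc (a := 1) (b := 1) (fun m hm => by rw [hNi, if_neg (by omega)])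
      (fun m hm => by rw [hNj, if_neg (by omega)])]
    refine Finset.sum_congr ?_ fun n hn => ?_
    · ext n
      simp only [Finset.mem_Icc, Finset.mem_Ico]
      omega
    · have := Finset.mem_Ico.1 hn
      rw [hNi, hNj, if_pos (by omega), if_pos (by omega)]
  rw [hexp]
  simp only [HahnSeries.coeff_add]
  rw [hNN, HahnSeries.coeff_single_mul, HahnSeries.coeff_single_mul, HahnSeries.coeff_mul_single,
    HahnSeries.coeff_mul_single, hH.coeff_pSeries, hH.coeff_pSeries, hNi, hNi]
  have e1 : m + (i : ℤ) = -(j : ℤ) ↔ m = -((i : ℤ) + j) := by omega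
  simp only [sub_neg_eq_add, e1]
  ring

lemma coeff_C_mul_pSeries_of_param (c : ℂ) {n : ℕ} (hn : 2 ≤ n) {m : ℤ} (hm : m = -1 ∨ 1 ≤ m) :
    (HahnSeries.C c * pSeries H n).coeff m = c * H n m := by
  rw [coeff_C_mul, hH.coeff_pSeries, if_neg (by omega), zero_add]

lemma coeff_reducedProduct_of_param {i j : ℕ} (hi : 2 ≤ i) (hj : 2 ≤ j) {m : ℤ}
    (hm : m = -1 ∨ 1 ≤ m) :
    (reducedProduct H HahnSeries.C (pSeries H) i j).coeff m =
      H (i + j) m + H j (-1) * H (i + 1) m + H i (-1) * H (j + 1) m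
      + ∑ n ∈ Finset.Ico 2 i, H j ((i : ℤ) - n) * H n m
      + ∑ n ∈ Finset.Ico 2 j, H i ((j : ℤ) - n) * H n m
      + H i (-1) * H j (-1) * H 2 m := by
  have hsum : ∀ (a : ℕ) (f : ℕ → ℂ), (∑ l ∈ Finset.Ico 2 a,
      HahnSeries.C (f l) * pSeries H l).coeff m = ∑ l ∈ Finset.Ico 2 a, f l * H l m := by
    intro a f
    rw [HahnSeries.coeff_sum]
    exact Finset.sum_congr rfl fun l hl =>
      coeff_C_mul_pSeries_of_param hH _ (Finset.mem_Ico.1 hl).1 hm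
  have hC : ∀ c : ℂ, (HahnSeries.C c : LaurentSeries ℂ).coeff m = 0 := fun c => by
    rw [HahnSeries.C_apply, HahnSeries.coeff_single_of_ne (by omega)]
  simp only [reducedProduct, HahnSeries.coeff_add]
  rw [hsum i (fun l => H j ((i : ℤ) - l)), hsum j (fun l => H i ((j : ℤ) - l)), hC,
    coeff_C_mul_pSeries_of_param hH _ (by omega) hm, coeff_C_mul_pSeries_of_param hH _ (by omega) hm,
    coeff_C_mul_pSeries_of_param hH _ le_rfl hm, hH.coeff_pSeries, if_neg (by omega)]
  ring

/-- This explains the right-hand side of the quadric: its coefficients are those of p_ip_j at z^0,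
z^2, z^3, …, whatever the values of the parameters. -/
lemma coeff_reducedProduct_of_nonpos {i j : ℕ} (hi : 2 ≤ i) (hj : 2 ≤ j) {m : ℤ}
    (hm : m ≤ 0) (hm1 : m ≠ -1) :
    (reducedProduct H HahnSeries.C (pSeries H) i j).coeff m =
      (pSeries H i * pSeries H j).coeff m := by
  have hp : ∀ n : ℕ, (pSeries H n).coeff m = if m = -(n : ℤ) then 1 else 0 := fun n => by
    rw [hH.coeff_pSeries, hH n m (by omega), add_zero]
  rw [coeff_pSeries_mul_pSeries hH hi hj]
  simp only [reducedProduct, HahnSeries.coeff_add, HahnSeries.coeff_sum, coeff_C_mul, hp]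
  rw [Finset.Ico_eq_empty (a := (1 : ℤ)) (by omega), Finset.sum_empty]
  rcases eq_or_lt_of_le hm with rfl | hlt
  · have hs : ∀ (a : ℕ) (f : ℕ → ℂ), ∑ l ∈ Finset.Ico 2 a,
        f l * (if (0 : ℤ) = -(l : ℤ) then 1 else 0) = 0 := fun a f =>
      Finset.sum_eq_zero fun l hl => by
        have := (Finset.mem_Ico.1 hl).1
        rw [if_neg (by omega), mul_zero]
    rw [hs i (fun l => H j ((i : ℤ) - l)), hs j (fun l => H i ((j : ℤ) - l)),
      if_neg (by omega), if_neg (by omega), if_neg (by omega), if_neg (by omega),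
      if_neg (by omega), if_neg (by omega), if_pos (by omega), if_pos (by omega)]
    simp
    ring
  · obtain ⟨k, rfl⟩ : ∃ k : ℕ, m = -(k : ℤ) := ⟨m.natAbs, by omega⟩
    have hs : ∀ (a : ℕ) (f : ℕ → ℂ), ∑ l ∈ Finset.Ico 2 a,
        f l * (if -(k : ℤ) = -(l : ℤ) then 1 else 0) = if k < a then f k else 0 := by
      intro a f
      split_ifs with h
      · rw [Finset.sum_eq_single_of_mem k (Finset.mem_Ico.2 ⟨by omega, h⟩)]
        · simp
        · intro n _ hne
          rw [if_neg (by omega), mul_zero]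
      · refine Finset.sum_eq_zero fun l hl => ?_
        have := (Finset.mem_Ico.1 hl).2
        rw [if_neg (by omega), mul_zero]
    have hC : ∀ c : ℂ, (HahnSeries.C c : LaurentSeries ℂ).coeff (-(k : ℤ)) = 0 := fun c =>
      (startsWith_C c).1 _ hlt
    rw [hs i (fun l => H j ((i : ℤ) - l)), hs j (fun l => H i ((j : ℤ) - l)), hC,
      if_neg (show ¬ (1 : ℤ) ≤ -k + 1 by omega)]
    -- The product z^i p_j contributes H^j_{i-k} at z^k. For k < i this is a term of the sum over l,
    -- for k = i it is H^j_0 = 0, and for k = i + 1 it is the coefficient H^j_{-1} of p_{i+1}.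
    have e1 : H j (-(k : ℤ) + i) = (if k < i then H j ((i : ℤ) - k) else 0)
        + H j (-1) * (if -(k : ℤ) = -((i + 1 : ℕ) : ℤ) then 1 else 0) := by
      rcases lt_trichotomy k i with h | h | h
      · rw [if_pos h, if_neg (by omega), mul_zero, add_zero, neg_add_eq_sub]
      · rw [if_neg (by omega), if_neg (by omega), hH j _ (by omega)]
        simp
      · rw [if_neg (by omega), zero_add]
        split_ifs with h2
        · rw [mul_one]
          congr 1
          omega
        · rw [mul_zero, hH j _ (by omega)]
    have e2 : (if 1 ≤ -(k : ℤ) + j then H i (-(k : ℤ) + j) else 0) =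
        if k < j then H i ((j : ℤ) - k) else 0 := by
      refine if_congr (by omega) ?_ rfl
      rw [neg_add_eq_sub]
    have e3 : H j (-(k : ℤ) + 1) = H j (-1) * (if -(k : ℤ) = -((2 : ℕ) : ℤ) then 1 else 0) := by
      split_ifs with h
      · rw [mul_one]
        congr 1
        omega
      · rw [mul_zero, hH j _ (by omega)]
    have e4 : (if -(k : ℤ) + 1 = -(j : ℤ) then (1 : ℂ) else 0) =
        if -(k : ℤ) = -((j + 1 : ℕ) : ℤ) then 1 else 0 := if_congr (by omega) rfl rfl
    have e5 : (if -(k : ℤ) = -((i + j : ℕ) : ℤ) then (1 : ℂ) else 0) =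
        if -(k : ℤ) = -((i : ℤ) + j) then 1 else 0 := if_congr (by omega) rfl rfl
    rw [e1, e2, e3, e4, e5]
    ring

/-- At exponents -1 and l ≥ 1 the two sides of `AssocEq` are the coefficients of the product and of
its reduction; elsewhere the two series agree anyway. -/
lemma pSeries_mul_eq_iff {i j : ℕ} (hi : 2 ≤ i) (hj : 2 ≤ j) :
    pSeries H i * pSeries H j = reducedProduct H HahnSeries.C (pSeries H) i j ↔
      ∀ l : ℤ, l = -1 ∨ 1 ≤ l → AssocEq H i j l := by
  have key : ∀ l : ℤ, l = -1 ∨ 1 ≤ l → ((pSeries H i * pSeries H j).coeff l =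
      (reducedProduct H HahnSeries.C (pSeries H) i j).coeff l ↔ AssocEq H i j l) := by
    intro l hl
    rw [coeff_reducedProduct_of_param hH hi hj hl, coeff_pSeries_mul_pSeries hH hi hj, AssocEq,
      if_neg (by omega), if_neg (by omega), if_pos (by omega)]
    have e1 : (if 1 ≤ l + 1 then H i (l + 1) else 0) = H i (l + 1) := by
      split_ifs with h
      · rfl
      · exact (hH i _ (by omega)).symm
    have e2 : ∑ n ∈ Finset.Ico (1 : ℤ) l, H i n * H j (l - n) =
        ∑ n ∈ Finset.Ico (1 : ℤ) l, H j n * H i (l - n) := by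
      refine Finset.sum_nbij' (fun n => l - n) (fun n => l - n) ?_ ?_ ?_ ?_ ?_
      · intro n hn
        simp only [Finset.mem_Ico] at hn ⊢
        omega
      · intro n hn
        simp only [Finset.mem_Ico] at hn ⊢
        omega
      · intro n _
        ring
      · intro n _
        ring
      · intro n _
        rw [sub_sub_cancel, mul_comm]
    rw [e1, e2, add_comm l i, add_comm l j]
    constructor
    · intro h
      rw [← h]
      ring
    · intro h
      rw [← h]
      ring
  constructor
  · intro h l hl
    exact (key l hl).1 (by rw [h])
  · intro h
    ext m
    by_cases hm : m = -1 ∨ 1 ≤ m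
    · exact (key m hm).2 (h m hm)
    · exact (coeff_reducedProduct_of_nonpos hH hi hj (by omega) (by omega)).symm

lemma pSeries_mul_eq_of_mem {i j : ℕ} (hi : 2 ≤ i) (hj : 2 ≤ j)
    (h : pSeries H i * pSeries H j ∈ spanW H) :
    pSeries H i * pSeries H j = reducedProduct H HahnSeries.C (pSeries H) i j := by
  refine sub_eq_zero.1 (eq_zero_of_mem_spanW (sub_mem h (reducedProduct_mem_spanW H hi hj)) ?_)
  intro m hm hm1
  rw [HahnSeries.coeff_sub, coeff_reducedProduct_of_nonpos hH hi hj hm hm1, sub_self]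

/-- The associativity equations need not be verified one by one: closure of the span under
multiplication forces them. The perturbed parameters are recognized in this way. -/
lemma mem_params_of_mul_mem
    (h : ∀ i j : ℕ, 2 ≤ i → 2 ≤ j → pSeries H i * pSeries H j ∈ spanW H) : H ∈ params :=
  mem_params_iff.2 ⟨hH, fun i j l hi hj hl =>
    (pSeries_mul_eq_iff hH hi hj).1 (pSeries_mul_eq_of_mem hH hi hj (h i j hi hj)) l hl⟩

end Coeff

lemma mulLaw_pSeries {H : ℕ → ℤ → ℂ} (hH : H ∈ params) : MulLaw H HahnSeries.C (pSeries H) :=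
  fun i j hi hj => (pSeries_mul_eq_iff (mem_params_iff.1 hH).1 hi hj).2 fun l hl =>
    (mem_params_iff.1 hH).2 i j l hi hj hl

/-! ### The cubic relation and the elimination of `p_4, p_5, …` -/

lemma coord_of_mem {s : Set ℕ} {n : ℕ} (h : n ∈ s) : coord s n = MvPolynomial.X ⟨n, h⟩ :=
  dif_pos h

lemma quadric_eq (H : ℕ → ℤ → ℂ) (i j : ℕ) :
    quadric H i j = coord (Set.Ici 2) i * coord (Set.Ici 2) j
      - reducedProduct H MvPolynomial.C (coord (Set.Ici 2)) i j := by
  simp only [quadric, reducedProduct]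
  ring

/-- The multiplication law is used in the Laurent series and in the polynomial ring modulo the
quadrics, so it has to be transported along ring homomorphisms. -/
lemma map_reducedProduct {H : ℕ → ℤ → ℂ} {B B' : Type} [CommRing B] [CommRing B'] (c : ℂ →+* B)
    (P : ℕ → B) (f : B →+* B') (i j : ℕ) :
    f (reducedProduct H c P i j) = reducedProduct H (f.comp c) (fun n => f (P n)) i j := by
  simp [reducedProduct]

lemma reducedProduct_congr {H : ℕ → ℤ → ℂ} {B : Type} [CommRing B] {c : ℂ →+* B}
    {P P' : ℕ → B} (h : ∀ n, 2 ≤ n → P n = P' n) {i j : ℕ} (hi : 2 ≤ i) (hj : 2 ≤ j) :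
    reducedProduct H c P i j = reducedProduct H c P' i j := by
  have hs : ∀ (a : ℕ) (f : ℕ → ℂ), ∑ l ∈ Finset.Ico 2 a, c (f l) * P l =
      ∑ l ∈ Finset.Ico 2 a, c (f l) * P' l := fun a f => Finset.sum_congr rfl fun l hl => by
    rw [h l (Finset.mem_Ico.1 hl).1]
  simp only [reducedProduct]
  rw [h (i + j) (by omega), h (i + 1) (by omega), h (j + 1) (by omega), h 2 le_rfl,
    hs i (fun l => H j ((i : ℤ) - l)), hs j (fun l => H i ((j : ℤ) - l))]

section Cubic

variable {H : ℕ → ℤ → ℂ}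

/-- The value of the cubic `𝓕` at a pair of ring elements. -/
def cubicValue {B : Type} [CommRing B] (E : WeierstrassCurve ℂ) (c : ℂ →+* B) (x y : B) : B :=
  y ^ 2 - x ^ 3 + c E.a₁ * y * x - c E.a₂ * x ^ 2 + c E.a₃ * y - c E.a₄ * x - c E.a₆

/-- In p_3² - p_2³ the terms p_6 cancel; then p_5 and p_4 are removed by means of p_2p_3 and p_2².
The coefficients of p_3, p_2 and 1 that remain are those of `baseCurve` only modulo associativity
equations of low index. -/
lemma cubicValue_eq_zero (hH : H ∈ params) {B : Type} [CommRing B] {c : ℂ →+* B} {P : ℕ → B}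
    (hP : MulLaw H c P) : cubicValue (baseCurve H) c (P 2) (P 3) = 0 := by
  have h0 := (mem_params_iff.1 hH).1
  have hA := (mem_params_iff.1 hH).2
  have z2 : H 2 0 = 0 := h0 2 0 (by simp)
  have z3 : H 3 0 = 0 := h0 3 0 (by simp)
  have z4 : H 4 0 = 0 := h0 4 0 (by simp)
  have I1 : Finset.Ico (1 : ℤ) 2 = {1} := rfl
  have I2 : Finset.Ico 2 3 = {2} := rfl
  have I3 : Finset.Ico 2 4 = {2, 3} := rfl
  have e22m := hA 2 2 (-1) le_rfl le_rfl (by simp)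
  have e221 := hA 2 2 1 le_rfl le_rfl (by simp)
  have e222 := hA 2 2 2 le_rfl le_rfl (by simp)
  have e23m := hA 2 3 (-1) le_rfl (by simp) (by simp)
  have e24m := hA 2 4 (-1) le_rfl (by simp) (by simp)
  have e33m := hA 3 3 (-1) (by simp) (by simp) (by simp)
  norm_num [AssocEq, z2, z3, z4, I1, I2, I3] at e22m e221 e222 e23m e24m e33m
  have p22 := hP 2 2 le_rfl le_rfl
  have p23 := hP 2 3 le_rfl (by simp)
  have p24 := hP 2 4 le_rfl (by simp)
  have p33 := hP 3 3 (by simp) (by simp)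
  norm_num [reducedProduct, I1, I2, I3] at p22 p23 p24 p33
  have K3 : (baseCurve H).a₃ - H 4 (-1) - H 2 1 + H 2 (-1) * H 3 (-1)
      - 2 * H 2 (-1) * (H 2 (-1) ^ 2 + 2 * H 3 (-1)) = 0 := by
    simp only [baseCurve]
    linear_combination e22m
  have K2 : 2 * H 3 1 + H 3 (-1) ^ 2 - 2 * H 2 2 - 2 * H 2 (-1) * H 2 1 - H 2 2
      - H 2 (-1) * H 4 (-1) + H 2 (-1) * H 2 1 + H 2 (-1) ^ 2 * H 3 (-1)
      - (H 2 (-1) ^ 2 + 2 * H 3 (-1)) * H 2 (-1) ^ 2 - (baseCurve H).a₄ = 0 := by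
    simp only [baseCurve]
    linear_combination H 2 (-1) * e22m
  -- The constant term left by the elimination is not literally a₆; the two differ by a combination
  -- of the equations for (i, j, l) = (2,2,2), (2,2,1) and those with l = -1.
  have K0 : 2 * H 3 3 + 2 * H 3 (-1) * H 3 1
      - (H 2 4 + H 4 2 + H 2 (-1) * H 4 1 + H 2 1 * H 4 (-1))
      + H 2 (-1) * (H 2 3 + H 3 2 + H 2 (-1) * H 3 1 + H 2 1 * H 3 (-1))
      - (H 2 (-1) ^ 2 + 2 * H 3 (-1)) * (2 * H 2 2 + 2 * H 2 (-1) * H 2 1)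
      - (baseCurve H).a₆ = 0 := by
    simp only [baseCurve]
    linear_combination e222 - 2 * H 2 (-1) * e221 + (H 2 1 - 3 / 2 * H 2 (-1) * H 3 (-1)) * e22m
      + 3 / 2 * H 2 (-1) * (e33m - e24m + H 2 (-1) * e23m + e221)
  have k1 : (baseCurve H).a₁ = 3 * H 2 (-1) := rfl
  have k2 : (baseCurve H).a₂ = 2 * H 3 (-1) := rfl
  rw [cubicValue, k1, k2]
  replace K3 := congrArg c K3
  replace K2 := congrArg c K2
  replace K0 := congrArg c K0
  simp only [map_add, map_sub, map_mul, map_pow, map_zero, map_ofNat] at K3 K2 K0 ⊢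
  linear_combination p33 - P 2 * p22 - p24 + c (H 2 (-1)) * p23
    - (c (H 2 (-1)) ^ 2 + 2 * c (H 3 (-1))) * p22 + P 3 * K3 + P 2 * K2 + K0

end Cubic

/-! ### Elimination of `p_4, p_5, …` -/

section Elimination

variable {B : Type} [CommRing B]

/-- The elements `a(x) + b(x) y` with the degree bounds of `p_n`. -/
def IsLowCombination (c : ℂ →+* B) (x y : B) (n : ℕ) (z : B) : Prop :=
  ∃ a b : ℂ[X], a.natDegree ≤ n / 2 ∧ b.natDegree ≤ (n - 3) / 2 ∧ (n < 3 → b = 0) ∧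
    z = a.eval₂ c x + b.eval₂ c x * y

variable {c : ℂ →+* B} {x y : B}

lemma IsLowCombination.mono {m n : ℕ} (hmn : m ≤ n) {z : B} (hz : IsLowCombination c x y m z) :
    IsLowCombination c x y n z := by
  obtain ⟨a, b, ha, hb, h0, rfl⟩ := hz
  exact ⟨a, b, by omega, by omega, fun h => h0 (by omega), rfl⟩

lemma IsLowCombination.add {n : ℕ} {z w : B} (hz : IsLowCombination c x y n z)
    (hw : IsLowCombination c x y n w) : IsLowCombination c x y n (z + w) := by
  obtain ⟨a, b, ha, hb, h0, rfl⟩ := hz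
  obtain ⟨a', b', ha', hb', h0', rfl⟩ := hw
  refine ⟨a + a', b + b', Polynomial.natDegree_add_le_of_degree_le ha ha',
    Polynomial.natDegree_add_le_of_degree_le hb hb', fun h => by rw [h0 h, h0' h, add_zero], ?_⟩
  simp only [Polynomial.eval₂_add]
  ring

lemma IsLowCombination.const_mul {n : ℕ} {z : B} (e : ℂ) (hz : IsLowCombination c x y n z) :
    IsLowCombination c x y n (c e * z) := by
  obtain ⟨a, b, ha, hb, h0, rfl⟩ := hz
  refine ⟨C e * a, C e * b, (Polynomial.natDegree_C_mul_le _ _).trans ha,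
    (Polynomial.natDegree_C_mul_le _ _).trans hb, fun h => by rw [h0 h, mul_zero], ?_⟩
  simp only [Polynomial.eval₂_mul, Polynomial.eval₂_C]
  ring

lemma isLowCombination_const (n : ℕ) (e : ℂ) : IsLowCombination c x y n (c e) :=
  ⟨C e, 0, by simp, by simp, fun _ => rfl, by simp⟩

lemma IsLowCombination.sum {n : ℕ} {s : Finset ℕ} {f : ℕ → B}
    (h : ∀ l ∈ s, IsLowCombination c x y n (f l)) :
    IsLowCombination c x y n (∑ l ∈ s, f l) := by
  induction s using Finset.induction_on with
  | empty => simpa using isLowCombination_const (c := c) (x := x) (y := y) n 0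
  | insert a s ha ih =>
    rw [Finset.sum_insert ha]
    exact (h a (Finset.mem_insert_self a s)).add
      (ih fun l hl => h l (Finset.mem_insert_of_mem hl))

lemma IsLowCombination.mul_left {n : ℕ} (hn : 2 ≤ n) {z : B} (hz : IsLowCombination c x y n z) :
    IsLowCombination c x y (n + 2) (x * z) := by
  obtain ⟨a, b, ha, hb, h0, rfl⟩ := hz
  refine ⟨X * a, X * b, ?_, ?_, fun h => by omega, ?_⟩
  · refine (Polynomial.natDegree_mul_le).trans ?_
    rw [Polynomial.natDegree_X]
    omega
  · rcases lt_or_ge n 3 with h | h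
    · rw [h0 h, mul_zero, Polynomial.natDegree_zero]
      exact Nat.zero_le _
    · refine (Polynomial.natDegree_mul_le).trans ?_
      rw [Polynomial.natDegree_X]
      omega
  · simp only [Polynomial.eval₂_mul, Polynomial.eval₂_X]
    ring

/-- Up to terms of index less than j + 2, p_{j+2} is p_2p_j. Only products with p_2 enter, so the
lemma also applies before the other products are known to obey the law. -/
lemma isLowCombination_of_mulLaw {H : ℕ → ℤ → ℂ} {P : ℕ → B}
    (hP : ∀ j : ℕ, 2 ≤ j → P 2 * P j = reducedProduct H c P 2 j) (n : ℕ) (hn : 2 ≤ n) :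
    IsLowCombination c (P 2) (P 3) n (P n) := by
  induction n using Nat.strong_induction_on with
  | _ n ih =>
    rcases (by omega : n = 2 ∨ n = 3 ∨ 4 ≤ n) with rfl | rfl | h4
    · exact ⟨X, 0, by simp, by simp, fun _ => rfl, by simp⟩
    · exact ⟨0, 1, by simp, by simp, fun h => by omega, by simp⟩
    · obtain ⟨j, rfl⟩ : ∃ j, n = j + 2 := ⟨n - 2, by omega⟩
      have hj : 2 ≤ j := by omega
      have hmul := hP j hj
      rw [reducedProduct, Finset.Ico_self, Finset.sum_empty] at hmul
      have hlow : ∀ e : ℂ, ∀ l : ℕ, 2 ≤ l → l < j + 2 →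
          IsLowCombination c (P 2) (P 3) (j + 2) (c e * P l) := fun e l h2 hl =>
        ((ih l hl h2).mono hl.le).const_mul e
      have hs : IsLowCombination c (P 2) (P 3) (j + 2)
          (∑ l ∈ Finset.Ico 2 j, c (-H 2 ((j : ℤ) - l)) * P l) :=
        IsLowCombination.sum fun l hl =>
          hlow _ l (Finset.mem_Ico.1 hl).1 (by have := (Finset.mem_Ico.1 hl).2; omega)
      have key := (((((ih j (by omega) hj).mul_left hj).add
        (hlow (-H j (-1)) 3 (by omega) (by omega))).add
        (hlow (-H 2 (-1)) (j + 1) (by omega) (by omega))).add hs).add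
        (((hlow (-(H 2 (-1) * H j (-1))) 2 le_rfl (by omega))).add (isLowCombination_const _
        (-(H 2 j + H j 2 + H 2 (-1) * H j 1 + H 2 1 * H j (-1)))))
      convert key using 1
      rw [hmul, add_comm 2 j]
      simp only [map_neg, neg_mul, Finset.sum_neg_distrib]
      ring_nf

end Elimination

/-! ### The coordinate ring of a Weierstrass cubic -/

open WeierstrassCurve.Affine (CoordinateRing)

namespace CubicRing

variable (E : WeierstrassCurve ℂ)

/-- The affine coordinate ring of the cubic. -/
abbrev Coord : Type := CoordinateRing E.toAffine

/-- The coordinate function `x`. -/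
def x : Coord E := CoordinateRing.mk E.toAffine (C X)

/-- The coordinate function `y`. -/
def y : Coord E := CoordinateRing.mk E.toAffine X

/-- The constant functions. -/
def const : ℂ →+* Coord E := algebraMap ℂ (Coord E)

lemma const_apply (c : ℂ) : const E c = CoordinateRing.mk E.toAffine (C (C c)) := rfl

lemma mk_C (p : ℂ[X]) : CoordinateRing.mk E.toAffine (C p) = p.eval₂ (const E) (x E) := by
  have : ((CoordinateRing.mk E.toAffine).comp C) = eval₂RingHom (const E) (x E) := by
    apply Polynomial.ringHom_ext
    · intro c
      simp [const_apply]
    · simp [x]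
  exact congrArg (fun f => f p) this

lemma cubicValue_eq_zero : cubicValue E (const E) (x E) (y E) = 0 := by
  have h : CoordinateRing.mk E.toAffine (X ^ 2 + C (C E.a₁ * X + C E.a₃) * X -
      C (X ^ 3 + C E.a₂ * X ^ 2 + C E.a₄ * X + C E.a₆)) = 0 := AdjoinRoot.mk_self
  simp only [map_add, map_sub, map_mul, map_pow] at h
  simp only [cubicValue, const_apply, x, y]
  linear_combination h

lemma exists_eq (r : Coord E) :
    ∃ p q : ℂ[X], r = p.eval₂ (const E) (x E) + q.eval₂ (const E) (x E) * y E := by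
  obtain ⟨p, q, h⟩ := CoordinateRing.exists_smul_basis_eq r
  refine ⟨p, q, ?_⟩
  rw [← h, CoordinateRing.smul, CoordinateRing.smul, mul_one, mk_C, mk_C, y]

variable {E}

lemma eq_zero_of_eval₂_eq_zero {p q : ℂ[X]}
    (h : p.eval₂ (const E) (x E) + q.eval₂ (const E) (x E) * y E = 0) : p = 0 ∧ q = 0 := by
  apply CoordinateRing.smul_basis_eq_zero (W' := E.toAffine)
  rw [CoordinateRing.smul, CoordinateRing.smul, mul_one, mk_C, mk_C]
  exact h

/-- The ring homomorphism from the coordinate ring determined by a solution of the equation. -/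
def lift {B : Type} [CommRing B] (c : ℂ →+* B) (a b : B) (h : cubicValue E c a b = 0) :
    Coord E →+* B :=
  AdjoinRoot.lift (eval₂RingHom c a) b (by
    rw [WeierstrassCurve.Affine.polynomial]
    simp only [eval₂_add, eval₂_sub, eval₂_mul, eval₂_pow, eval₂_X, eval₂_C, coe_eval₂RingHom]
    rw [cubicValue] at h
    linear_combination h)

section Lift

variable {B : Type} [CommRing B] {c : ℂ →+* B} {a b : B} (h : cubicValue E c a b = 0)

@[simp] lemma lift_x : lift c a b h (x E) = a := by
  simp [lift, x, CoordinateRing.mk]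

@[simp] lemma lift_y : lift c a b h (y E) = b := by
  simp [lift, y, CoordinateRing.mk]

@[simp] lemma lift_const (e : ℂ) : lift c a b h (const E e) = c e := by
  simp [lift, const_apply, CoordinateRing.mk]

lemma lift_comp_const : (lift c a b h).comp (const E) = c := RingHom.ext (lift_const h)

lemma lift_eval₂ (p : ℂ[X]) :
    lift c a b h (p.eval₂ (const E) (x E)) = p.eval₂ c a := by
  rw [Polynomial.hom_eval₂, lift_x, lift_comp_const]

end Lift

lemma finite : Module.Finite ℂ[X] (Coord E) :=
  Module.Finite.of_basis (CoordinateRing.basis E.toAffine)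

/-- The norm of p + qy over ℂ[x] is the product of its values at the two points above each a. It
vanishes for every a, hence is zero, and in a domain finite over ℂ[x] so is the element. -/
lemma eq_zero_of_forall_eval {p q : ℂ[X]}
    (h : ∀ a b : ℂ, cubicValue E (RingHom.id ℂ) a b = 0 → p.eval a + q.eval a * b = 0) :
    p = 0 ∧ q = 0 := by
  have hN : Algebra.norm ℂ[X] (p • (1 : Coord E) + q • CoordinateRing.mk E.toAffine X) = 0 := by
    rw [CoordinateRing.norm_smul_basis]
    apply Polynomial.funext
    intro a
    -- `s` is a square root of the discriminant of the equation as a quadratic in y; the two points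
    -- above `a` have y = (±s - (a₁a + a₃))/2.
    obtain ⟨s, hs⟩ := IsAlgClosed.exists_pow_nat_eq ((E.a₁ * a + E.a₃) ^ 2
      + 4 * (a ^ 3 + E.a₂ * a ^ 2 + E.a₄ * a + E.a₆)) (n := 2) (by norm_num)
    have hb := h a ((s - (E.a₁ * a + E.a₃)) / 2) (by
      simp only [cubicValue, RingHom.id_apply]
      linear_combination 1 / 4 * hs)
    simp only [eval_add, eval_sub, eval_mul, eval_pow, eval_C, eval_X, eval_zero]
    linear_combination (p.eval a + q.eval a * ((-s - (E.a₁ * a + E.a₃)) / 2)) * hb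
      + (q.eval a) ^ 2 / 4 * hs
  have := finite (E := E)
  rw [Algebra.norm_eq_zero_iff] at hN
  exact CoordinateRing.smul_basis_eq_zero hN

lemma isIntegral : Algebra.IsIntegral ℂ[X] (Coord E) :=
  have := finite (E := E)
  Algebra.IsIntegral.of_finite _ _

lemma isNoetherianRing : IsNoetherianRing (Coord E) :=
  have := finite (E := E)
  IsNoetherianRing.of_finite ℂ[X] (Coord E)

lemma not_isField : ¬ IsField (Coord E) := by
  intro hF
  have := isIntegral (E := E)
  exact Polynomial.not_isField ℂ (isField_of_isIntegral_of_isField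
    (FaithfulSMul.algebraMap_injective ℂ[X] (Coord E)) hF)

lemma dimensionLEOne : Ring.DimensionLEOne (Coord E) :=
  have := isIntegral (E := E)
  Ring.DimensionLEOne.of_isIntegral ℂ[X] (Coord E)

lemma ringKrullDim_eq_one : ringKrullDim (Coord E) = 1 := by
  have := dimensionLEOne (E := E)
  apply le_antisymm
  · exact Ring.krullDimLE_iff.1 (inferInstance : Ring.KrullDimLE 1 (Coord E))
  · by_contra h
    have h0 : ringKrullDim (Coord E) ≤ 0 := by
      rw [not_le] at h
      exact Order.le_of_lt_succ h
    have : Ring.KrullDimLE 0 (Coord E) := Ring.krullDimLE_iff.2 h0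
    exact not_isField (E := E) Ring.KrullDimLE.isField_of_isDomain

end CubicRing

/-! ### Towers over the cubic -/

section Tower

open CubicRing

variable (E : WeierstrassCurve ℂ) (α β : ℕ → ℂ[X]) (s : Set ℕ)

/-- The part of the tower over the cubic `E` with coordinates indexed by `s`. -/
def towerSet (h2 : 2 ∈ s) (h3 : 3 ∈ s) : Set (s → ℂ) :=
  {v | cubicValue E (RingHom.id ℂ) (v ⟨2, h2⟩) (v ⟨3, h3⟩) = 0 ∧
    ∀ n : s, v n = (α n).eval (v ⟨2, h2⟩) + (β n).eval (v ⟨2, h2⟩) * v ⟨3, h3⟩}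

/-- The homomorphism from polynomials to functions on the cubic. -/
def towerHom : MvPolynomial s ℂ →ₐ[ℂ] Coord E :=
  MvPolynomial.aeval fun n => (α n).eval₂ (const E) (x E) + (β n).eval₂ (const E) (x E) * y E

/-- The functions `α_n`, `β_n` have the values that belong to the coordinates `x` and `y`. -/
structure IsTowerData : Prop where
  α_two : α 2 = X
  β_two : β 2 = 0
  α_three : α 3 = 0
  β_three : β 3 = 1

variable {E α β s} (hαβ : IsTowerData α β) (h2 : 2 ∈ s) (h3 : 3 ∈ s)

lemma towerHom_X (n : s) : towerHom E α β s (MvPolynomial.X n) =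
    (α n).eval₂ (const E) (x E) + (β n).eval₂ (const E) (x E) * y E :=
  MvPolynomial.aeval_X _ _

lemma towerHom_C (c : ℂ) : towerHom E α β s (MvPolynomial.C c) = const E c :=
  MvPolynomial.aeval_C _ _

include hαβ in
lemma towerHom_X_two : towerHom E α β s (MvPolynomial.X ⟨2, h2⟩) = x E := by
  simp [towerHom_X, hαβ.α_two, hαβ.β_two]

include hαβ in
lemma towerHom_X_three : towerHom E α β s (MvPolynomial.X ⟨3, h3⟩) = y E := by
  simp [towerHom_X, hαβ.α_three, hαβ.β_three]

lemma towerHom_eval₂ (p : ℂ[X]) (f : MvPolynomial s ℂ) :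
    towerHom E α β s (p.eval₂ MvPolynomial.C f) = p.eval₂ (const E) (towerHom E α β s f) := by
  have h := Polynomial.hom_eval₂ p MvPolynomial.C (towerHom E α β s).toRingHom f
  have hc : (towerHom E α β s).toRingHom.comp MvPolynomial.C = const E :=
    RingHom.ext fun c => towerHom_C c
  rw [hc] at h
  exact h

include hαβ h2 h3 in
lemma towerHom_surjective : Function.Surjective (towerHom E α β s) := by
  intro r
  obtain ⟨p, q, rfl⟩ := exists_eq E r
  refine ⟨p.eval₂ MvPolynomial.C (MvPolynomial.X ⟨2, h2⟩) +
    q.eval₂ MvPolynomial.C (MvPolynomial.X ⟨2, h2⟩) * MvPolynomial.X ⟨3, h3⟩, ?_⟩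
  rw [map_add, map_mul, towerHom_eval₂, towerHom_eval₂, towerHom_X_two hαβ, towerHom_X_three hαβ]

/-- Evaluation at a point, expansion at infinity and reduction modulo an ideal all factor through
the coordinate ring of the cubic in this way. -/
lemma lift_towerHom {B : Type} [CommRing B] {c : ℂ →+* B} {a b : B}
    (h : cubicValue E c a b = 0) (f : MvPolynomial s ℂ) :
    CubicRing.lift c a b h (towerHom E α β s f) =
      MvPolynomial.eval₂ c (fun n : s => (α n).eval₂ c a + (β n).eval₂ c a * b) f := by
  induction f using MvPolynomial.induction_on with
  | C e => rw [towerHom_C, lift_const, MvPolynomial.eval₂_C]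
  | add f g hf hg => rw [map_add, map_add, MvPolynomial.eval₂_add, hf, hg]
  | mul_X f n hf =>
    rw [map_mul, map_mul, MvPolynomial.eval₂_mul, hf, MvPolynomial.eval₂_X, towerHom_X, map_add,
      map_mul, lift_eval₂, lift_eval₂, lift_y]

lemma lift_towerHom_of_mem {v : s → ℂ} (hv : v ∈ towerSet E α β s h2 h3) (f : MvPolynomial s ℂ) :
    CubicRing.lift (RingHom.id ℂ) (v ⟨2, h2⟩) (v ⟨3, h3⟩) hv.1 (towerHom E α β s f) =
      MvPolynomial.aeval v f := by
  rw [lift_towerHom, MvPolynomial.aeval_def]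
  congr 1
  funext n
  rw [hv.2 n]
  rfl

include hαβ in
lemma towerPoint_mem {a b : ℂ} (h : cubicValue E (RingHom.id ℂ) a b = 0) :
    (fun n : s => (α n).eval a + (β n).eval a * b) ∈ towerSet E α β s h2 h3 := by
  have e2 : (α 2).eval a + (β 2).eval a * b = a := by simp [hαβ.α_two, hαβ.β_two]
  have e3 : (α 3).eval a + (β 3).eval a * b = b := by simp [hαβ.α_three, hαβ.β_three]
  refine ⟨?_, fun n => ?_⟩
  · simp only [e2, e3]
    exact h
  · simp only [e2, e3]

include hαβ in
-- For singular cubics too, a function p + qy that vanishes at all points is zero, so the kernel is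
-- the full vanishing ideal and not merely an ideal with the same zeros.
theorem ker_towerHom :
    RingHom.ker (towerHom E α β s) = MvPolynomial.vanishingIdeal ℂ (towerSet E α β s h2 h3) := by
  ext f
  rw [RingHom.mem_ker, MvPolynomial.mem_vanishingIdeal_iff]
  constructor
  · intro hf v hv
    rw [← lift_towerHom_of_mem h2 h3 hv, hf, map_zero]
  · intro hf
    obtain ⟨p, q, hpq⟩ := exists_eq E (towerHom E α β s f)
    have h0 : p = 0 ∧ q = 0 := by
      apply eq_zero_of_forall_eval (E := E)
      intro a b hab
      have hv := towerPoint_mem hαβ h2 h3 (s := s) hab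
      have e2 : (α 2).eval a + (β 2).eval a * b = a := by simp [hαβ.α_two, hαβ.β_two]
      have e3 : (α 3).eval a + (β 3).eval a * b = b := by simp [hαβ.α_three, hαβ.β_three]
      have h := hf _ hv
      rw [← lift_towerHom_of_mem h2 h3 hv, hpq, map_add, map_mul, lift_eval₂, lift_eval₂,
        lift_y] at h
      simpa only [e2, e3, Polynomial.eval₂_id] using h
    rw [hpq, h0.1, h0.2]
    simp

include hαβ in
/-- An ideal in the kernel that contains the cubic and the graph equations is the kernel. -/
lemma ker_towerHom_eq_of_mem {J : Ideal (MvPolynomial s ℂ)} (hJ : J ≤ RingHom.ker (towerHom E α β s))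
    (hcubic : cubicValue E MvPolynomial.C (MvPolynomial.X ⟨2, h2⟩ : MvPolynomial s ℂ)
      (MvPolynomial.X ⟨3, h3⟩) ∈ J)
    (hgraph : ∀ n : s, 4 ≤ n.1 → MvPolynomial.X n
      - (α n).eval₂ MvPolynomial.C (MvPolynomial.X ⟨2, h2⟩)
      - (β n).eval₂ MvPolynomial.C (MvPolynomial.X ⟨2, h2⟩) * MvPolynomial.X ⟨3, h3⟩ ∈ J)
    (hs : ∀ n ∈ s, 2 ≤ n) :
    J = RingHom.ker (towerHom E α β s) := by
  refine le_antisymm hJ fun f hf => ?_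
  set π := Ideal.Quotient.mk J with hπ
  have hc : cubicValue E (π.comp MvPolynomial.C) (π (MvPolynomial.X ⟨2, h2⟩))
      (π (MvPolynomial.X ⟨3, h3⟩)) = 0 := by
    have := Ideal.Quotient.eq_zero_iff_mem.2 hcubic
    simpa only [cubicValue, map_add, map_sub, map_mul, map_pow, RingHom.comp_apply] using this
  have hX : ∀ n : s, (α n).eval₂ (π.comp MvPolynomial.C) (π (MvPolynomial.X ⟨2, h2⟩))
      + (β n).eval₂ (π.comp MvPolynomial.C) (π (MvPolynomial.X ⟨2, h2⟩))
        * π (MvPolynomial.X ⟨3, h3⟩) = π (MvPolynomial.X n) := by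
    rintro ⟨n, hn⟩
    rcases (by have := hs n hn; omega : n = 2 ∨ n = 3 ∨ 4 ≤ n) with rfl | rfl | h4
    · simp [hαβ.α_two, hαβ.β_two]
    · simp [hαβ.α_three, hαβ.β_three]
    · have := Ideal.Quotient.eq_zero_iff_mem.2 (hgraph ⟨n, hn⟩ h4)
      rw [map_sub, map_sub, map_mul, Polynomial.hom_eval₂, Polynomial.hom_eval₂] at this
      linear_combination -this
  -- The cubic relation holds modulo `J`, so the coordinate ring maps to the quotient. By the graph
  -- equations its composite with `towerHom` is the quotient map, which therefore kills the kernel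
  -- of `towerHom`.
  have key := lift_towerHom (α := α) (β := β) (s := s) hc f
  rw [RingHom.mem_ker.1 hf, map_zero] at key
  simp only [hX] at key
  rw [← Ideal.Quotient.eq_zero_iff_mem, ← hπ]
  rw [key]
  have := MvPolynomial.eval₂_comp_left π MvPolynomial.C MvPolynomial.X f
  rw [MvPolynomial.eval₂_eta] at this
  exact this

lemma map_cubicValue {B B' : Type} [CommRing B] [CommRing B'] (c : ℂ →+* B) (f : B →+* B')
    (a b : B) : f (cubicValue E c a b) = cubicValue E (f.comp c) (f a) (f b) := by
  simp [cubicValue]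

include hαβ in
lemma cubicValue_mem_ker : cubicValue E MvPolynomial.C (MvPolynomial.X ⟨2, h2⟩ : MvPolynomial s ℂ)
    (MvPolynomial.X ⟨3, h3⟩) ∈ RingHom.ker (towerHom E α β s) := by
  have h := map_cubicValue (E := E) MvPolynomial.C (towerHom E α β s).toRingHom
    (MvPolynomial.X ⟨2, h2⟩) (MvPolynomial.X ⟨3, h3⟩)
  have hc : (towerHom E α β s).toRingHom.comp MvPolynomial.C = const E :=
    RingHom.ext fun c => towerHom_C c
  rw [RingHom.mem_ker]
  refine h.trans ?_
  rw [hc]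
  change cubicValue E (const E) (towerHom E α β s _) (towerHom E α β s _) = 0
  rw [towerHom_X_two hαβ, towerHom_X_three hαβ]
  exact CubicRing.cubicValue_eq_zero E

include hαβ in
lemma graph_mem_ker (n : s) : MvPolynomial.X n
      - (α n).eval₂ MvPolynomial.C (MvPolynomial.X ⟨2, h2⟩)
      - (β n).eval₂ MvPolynomial.C (MvPolynomial.X ⟨2, h2⟩) * MvPolynomial.X ⟨3, h3⟩ ∈
    RingHom.ker (towerHom E α β s) := by
  rw [RingHom.mem_ker, map_sub, map_sub, map_mul, towerHom_eval₂, towerHom_eval₂,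
    towerHom_X_two hαβ, towerHom_X_three hαβ, towerHom_X]
  ring

lemma graphPoly_eq {n : ℕ} (hn : n ∈ s) : graphPoly s α β n = MvPolynomial.X ⟨n, hn⟩
      - (α n).eval₂ MvPolynomial.C (MvPolynomial.X ⟨2, h2⟩)
      - (β n).eval₂ MvPolynomial.C (MvPolynomial.X ⟨2, h2⟩) * MvPolynomial.X ⟨3, h3⟩ := by
  rw [graphPoly, coord_of_mem hn, coord_of_mem h2, coord_of_mem h3]
  rfl

include hαβ in
theorem span_eq_ker_towerHom (hs : ∀ n ∈ s, 2 ≤ n) {T : Set ℕ} (hT : ∀ n, n ∈ T ↔ n ∈ s ∧ 4 ≤ n) :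
    Ideal.span (insert (cubicValue E MvPolynomial.C (MvPolynomial.X ⟨2, h2⟩ : MvPolynomial s ℂ)
      (MvPolynomial.X ⟨3, h3⟩)) (graphPoly s α β '' T)) = RingHom.ker (towerHom E α β s) := by
  refine ker_towerHom_eq_of_mem hαβ h2 h3 ?_ (Ideal.subset_span (Set.mem_insert _ _)) ?_ hs
  · rw [Ideal.span_le]
    rintro f (rfl | ⟨n, hn, rfl⟩)
    · exact cubicValue_mem_ker hαβ h2 h3
    · rw [graphPoly_eq h2 h3 ((hT n).1 hn).1]
      exact graph_mem_ker hαβ h2 h3 _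
  · intro n hn
    rw [← graphPoly_eq h2 h3 n.2]
    exact Ideal.subset_span (Or.inr ⟨n, (hT n).2 ⟨n.2, hn⟩, rfl⟩)

/-- The coordinate ring of a tower is that of the cubic. -/
def towerEquiv : (MvPolynomial s ℂ ⧸ MvPolynomial.vanishingIdeal ℂ (towerSet E α β s h2 h3)) ≃ₐ[ℂ]
    Coord E :=
  (Ideal.quotientEquivAlgOfEq ℂ (ker_towerHom hαβ h2 h3).symm).trans
    (Ideal.quotientKerAlgEquivOfSurjective (towerHom_surjective hαβ h2 h3))

include hαβ in
theorem isIrreducibleCurve_towerSet : IsIrreducibleCurve (towerSet E α β s h2 h3) := by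
  refine ⟨?_, ?_, ?_⟩
  · refine le_antisymm (fun v hv => ?_) (MvPolynomial.zeroLocus_vanishingIdeal_le _)
    rw [← ker_towerHom hαβ h2 h3] at hv
    refine ⟨?_, fun n => ?_⟩
    · have h := hv _ (cubicValue_mem_ker hαβ h2 h3)
      have h' := map_cubicValue (E := E) MvPolynomial.C
        (MvPolynomial.aeval v : MvPolynomial s ℂ →ₐ[ℂ] ℂ).toRingHom
        (MvPolynomial.X ⟨2, h2⟩) (MvPolynomial.X ⟨3, h3⟩)
      have h'' := h'.symm.trans h
      simpa [cubicValue] using h''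
    · have h := hv _ (graph_mem_ker hαβ h2 h3 n)
      have hev : ∀ p : ℂ[X], MvPolynomial.aeval v (p.eval₂ MvPolynomial.C
          (MvPolynomial.X ⟨2, h2⟩ : MvPolynomial s ℂ)) = p.eval (v ⟨2, h2⟩) := by
        intro p
        have := Polynomial.hom_eval₂ p MvPolynomial.C
          (MvPolynomial.aeval v : MvPolynomial s ℂ →ₐ[ℂ] ℂ).toRingHom (MvPolynomial.X ⟨2, h2⟩)
        refine this.trans ?_
        have hc : (MvPolynomial.aeval v : MvPolynomial s ℂ →ₐ[ℂ] ℂ).toRingHom.comp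
            MvPolynomial.C = RingHom.id ℂ := RingHom.ext fun c => by simp
        rw [hc]
        simp
      rw [map_sub, map_sub, map_mul, hev, hev, MvPolynomial.aeval_X, MvPolynomial.aeval_X] at h
      linear_combination h
  · rw [← ker_towerHom hαβ h2 h3]
    exact RingHom.ker_isPrime _
  · rw [ringKrullDim_eq_of_ringEquiv (towerEquiv hαβ h2 h3 (E := E)).toRingEquiv]
    exact ringKrullDim_eq_one

end Tower

namespace CubicRing

variable {E : WeierstrassCurve ℂ}

/-! ### Points of an elliptic curve and the Dedekind property -/

lemma ringHom_ext {B : Type} [CommRing B] {f g : Coord E →+* B}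
    (hc : ∀ c, f (const E c) = g (const E c)) (hx : f (x E) = g (x E)) (hy : f (y E) = g (y E)) :
    f = g := by
  have hc' : f.comp (const E) = g.comp (const E) := RingHom.ext hc
  refine RingHom.ext fun r => ?_
  obtain ⟨p, q, rfl⟩ := exists_eq E r
  rw [map_add, map_add, map_mul, map_mul, hy]
  simp only [Polynomial.hom_eval₂, hc', hx]

/-- Nullstellensatz: the residue field is a finitely generated ℂ-algebra, hence finite over ℂ, hence
ℂ itself. -/
lemma exists_point {m : Ideal (Coord E)} (hm : m.IsMaximal) :
    ∃ ev : Coord E →+* ℂ, (∀ c, ev (const E c) = c) ∧ RingHom.ker ev = m := by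
  let : Field (Coord E ⧸ m) := Ideal.Quotient.field m
  have : Algebra.FiniteType ℂ[X] (Coord E) := by
    have := finite (E := E)
    infer_instance
  have : Algebra.FiniteType ℂ (Coord E) := Algebra.FiniteType.trans (S := ℂ[X])
    inferInstance inferInstance
  have : Algebra.FiniteType ℂ (Coord E ⧸ m) :=
    Algebra.FiniteType.of_surjective (Ideal.Quotient.mkₐ ℂ m) Ideal.Quotient.mk_surjective
  have : Module.Finite ℂ (Coord E ⧸ m) := finite_of_finite_type_of_isJacobsonRing ℂ (Coord E ⧸ m)
  have hb : Function.Bijective (algebraMap ℂ (Coord E ⧸ m)) :=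
    IsAlgClosed.algebraMap_bijective_of_isIntegral
  let e := RingEquiv.ofBijective _ hb
  refine ⟨e.symm.toRingHom.comp (Ideal.Quotient.mk m), fun c => ?_, ?_⟩
  · exact e.symm_apply_apply c
  · ext r
    rw [RingHom.mem_ker]
    change e.symm (Ideal.Quotient.mk m r) = 0 ↔ r ∈ m
    rw [map_eq_zero_iff _ e.symm.injective, Ideal.Quotient.eq_zero_iff_mem]

lemma cubicValue_point {ev : Coord E →+* ℂ} (hev : ∀ c, ev (const E c) = c) :
    cubicValue E (RingHom.id ℂ) (ev (x E)) (ev (y E)) = 0 := by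
  have h := congrArg ev (CubicRing.cubicValue_eq_zero E)
  rw [map_cubicValue, map_zero] at h
  rwa [show ev.comp (const E) = RingHom.id ℂ from RingHom.ext hev] at h

lemma cubicValue_id_eq_zero_iff (a b : ℂ) :
    cubicValue E (RingHom.id ℂ) a b = 0 ↔ E.toAffine.Equation a b := by
  rw [WeierstrassCurve.Affine.equation_iff, cubicValue]
  simp only [RingHom.id_apply]
  constructor <;> intro h <;> linear_combination h

lemma nonsingular_point [E.IsElliptic] {a b : ℂ} (h : cubicValue E (RingHom.id ℂ) a b = 0) :
    E.a₁ * b - (3 * a ^ 2 + 2 * E.a₂ * a + E.a₄) ≠ 0 ∨ 2 * b + E.a₁ * a + E.a₃ ≠ 0 := by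
  rw [cubicValue_id_eq_zero_iff, WeierstrassCurve.Affine.equation_iff_nonsingular,
    WeierstrassCurve.Affine.nonsingular_iff'] at h
  exact h.2

variable (E) in
/-- The partial derivative of the equation with respect to `x`. -/
def derivX : Coord E :=
  const E E.a₁ * y E - (3 * x E ^ 2 + 2 * const E E.a₂ * x E + const E E.a₄)

variable (E) in
/-- The partial derivative of the equation with respect to `y`. -/
def derivY : Coord E := 2 * y E + const E E.a₁ * x E + const E E.a₃

/-- Otherwise both derivatives lie in a maximal ideal, and its point would be singular. -/
lemma exists_mul_derivX_add_mul_derivY [E.IsElliptic] :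
    ∃ A B : Coord E, A * derivX E + B * derivY E = 1 := by
  rw [← Ideal.mem_span_pair, ← Ideal.eq_top_iff_one]
  by_contra hne
  obtain ⟨m, hm, hle⟩ := Ideal.exists_le_maximal _ hne
  obtain ⟨ev, hev, hker⟩ := exists_point hm
  have hX : ev (derivX E) = 0 := by
    rw [← RingHom.mem_ker, hker]
    exact hle (Ideal.subset_span (by simp))
  have hY : ev (derivY E) = 0 := by
    rw [← RingHom.mem_ker, hker]
    exact hle (Ideal.subset_span (by simp))
  simp only [derivX, derivY, map_add, map_sub, map_mul, map_pow, map_ofNat, hev] at hX hY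
  rcases nonsingular_point (cubicValue_point hev) with h | h
  · exact h hX
  · exact h hY

lemma derivY_ne_zero : derivY E ≠ 0 := by
  intro h
  have := (eq_zero_of_eval₂_eq_zero (E := E) (p := C E.a₁ * X + C E.a₃) (q := C 2) (by
    simp only [eval₂_add, eval₂_mul, eval₂_C, eval₂_X, map_ofNat, Polynomial.eval₂_ofNat]
    rw [← h, derivY]
    ring)).2
  simp at this

/-- Modulo the right-hand ideal, the quotient map agrees with evaluation followed by the constants
on x, y and ℂ, hence everywhere. -/
lemma ker_point_eq_span {ev : Coord E →+* ℂ} (hev : ∀ c, ev (const E c) = c) :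
    RingHom.ker ev =
      Ideal.span {x E - const E (ev (x E)), y E - const E (ev (y E))} := by
  set I := Ideal.span {x E - const E (ev (x E)), y E - const E (ev (y E))} with hI
  apply le_antisymm
  · intro r hr
    have h : Ideal.Quotient.mk I = ((Ideal.Quotient.mk I).comp (const E)).comp ev := by
      apply ringHom_ext
      · intro c
        simp [hev]
      · exact Ideal.Quotient.eq.2 (Ideal.subset_span (by simp))
      · exact Ideal.Quotient.eq.2 (Ideal.subset_span (by simp))
    rw [← Ideal.Quotient.eq_zero_iff_mem, h, RingHom.comp_apply, RingHom.mem_ker.1 hr, map_zero]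
  · rw [hI, Ideal.span_le]
    rintro r (rfl | rfl)
    · simp [RingHom.mem_ker, hev]
    · simp [RingHom.mem_ker, hev]

lemma isPrincipal_span_pair_of_mul_eq {S : Type} [CommRing S] {u v A B : S} (hB : IsUnit B)
    (h : v * B = u * A) : (Ideal.span {u, v}).IsPrincipal := by
  refine ⟨u, ?_⟩
  apply le_antisymm
  · rw [Ideal.span_le]
    rintro r (rfl | rfl)
    · exact Ideal.mem_span_singleton_self _
    · obtain ⟨b, rfl⟩ := hB
      refine Ideal.mem_span_singleton.2 ⟨A * ↑b⁻¹, ?_⟩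
      rw [← mul_assoc, ← h, mul_assoc, Units.mul_inv, mul_one]
  · exact Ideal.span_mono (by simp)

/-- It suffices that the maximal ideal of each point becomes principal in the local ring, which is
where smoothness enters. -/
theorem isDedekindDomain [E.IsElliptic] : IsDedekindDomain (Coord E) := by
  have := isNoetherianRing (E := E)
  have := dimensionLEOne (E := E)
  have : IsDedekindDomainDvr (Coord E) :=
    { is_dvr_at_nonzero_prime := by
        intro P hP hprime
        have := hprime
        have hmax : P.IsMaximal := hprime.isMaximal hP
        obtain ⟨ev, hev, hker⟩ := exists_point hmax
        have hnf : ¬ IsField (Localization.AtPrime P) :=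
          IsLocalization.AtPrime.not_isField (Coord E) hP _
        have : IsNoetherianRing (Localization.AtPrime P) :=
          IsLocalization.isNoetherianRing P.primeCompl _ inferInstance
        refine ((IsDiscreteValuationRing.TFAE (Localization.AtPrime P) hnf).out 0 4).2 ?_
        set j := algebraMap (Coord E) (Localization.AtPrime P) with hj
        have hspan : P = Ideal.span {x E - const E (ev (x E)), y E - const E (ev (y E))} :=
          hker.symm.trans (ker_point_eq_span hev)
        have hgen : IsLocalRing.maximalIdeal (Localization.AtPrime P) =
            Ideal.span {j (x E - const E (ev (x E))), j (y E - const E (ev (y E)))} := by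
          rw [← Localization.AtPrime.map_eq_maximalIdeal, congrArg (Ideal.map _) hspan,
            Ideal.map_span, Set.image_pair]
        have hunit : ∀ r : Coord E, ev r ≠ 0 → IsUnit (j r) := by
          intro r hr
          refine IsLocalization.map_units _ (⟨r, ?_⟩ : P.primeCompl)
          intro hrP
          rw [← hker] at hrP
          exact hr hrP
        set a := ev (x E) with ha
        set b := ev (y E) with hb
        set A : Coord E := x E ^ 2 + const E a * x E + const E a ^ 2
          + const E E.a₂ * (x E + const E a) + const E E.a₄ - const E E.a₁ * const E b with hA
        set B : Coord E := y E + const E b + const E E.a₁ * x E + const E E.a₃ with hB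
        -- This is the difference of the equations at (x, y) and at (a, b), factored. At the point,
        -- `B` is the y-derivative and `A` is minus the x-derivative, so one of them is a local unit
        -- and one of x - a, y - b generates the maximal ideal.
        have hAB : (y E - const E b) * B = (x E - const E a) * A := by
          have h1 := CubicRing.cubicValue_eq_zero E
          have h2 := congrArg (const E) (cubicValue_point hev)
          simp only [cubicValue, map_add, map_sub, map_mul, map_pow, RingHom.id_apply,
            map_zero] at h1 h2
          rw [hA, hB]
          linear_combination h1 - h2
        have hAB' : j (y E - const E b) * j B = j (x E - const E a) * j A := by
          rw [← map_mul, hAB, map_mul]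
        rw [hgen]
        rcases nonsingular_point (cubicValue_point hev) with h | h
        · rw [Set.pair_comm]
          refine isPrincipal_span_pair_of_mul_eq (A := j B) (B := j A) (hunit A ?_) hAB'.symm
          rw [hA]
          simp only [map_add, map_sub, map_mul, map_pow, hev]
          rw [← ha]
          intro h0
          apply h
          linear_combination -h0
        · refine isPrincipal_span_pair_of_mul_eq (A := j A) (B := j B) (hunit B ?_) hAB'
          rw [hB]
          simp only [map_add, map_mul, hev]
          rw [← ha, ← hb]
          intro h0
          apply h
          linear_combination h0 }
  infer_instance

end CubicRing

/-! ### The Euler derivation of Laurent series -/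

/-- The derivation `t d/dt`. -/
def euler (f : LaurentSeries ℂ) : LaurentSeries ℂ where
  coeff m := m * f.coeff m
  isPWO_support' := f.isPWO_support.mono fun m hm h0 => hm (by
    have h0' : f.coeff m = 0 := h0
    simp [h0'])

lemma coeff_euler (f : LaurentSeries ℂ) (m : ℤ) : (euler f).coeff m = m * f.coeff m := rfl

lemma support_euler_subset (f : LaurentSeries ℂ) : (euler f).support ⊆ f.support := by
  intro m hm
  rw [HahnSeries.mem_support, coeff_euler] at hm
  exact right_ne_zero_of_mul hm

lemma euler_add (f g : LaurentSeries ℂ) : euler (f + g) = euler f + euler g := by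
  ext m
  simp only [coeff_euler, HahnSeries.coeff_add]
  ring

lemma euler_C (c : ℂ) : euler (HahnSeries.C c) = 0 := by
  ext m
  rw [coeff_euler]
  rcases eq_or_ne m 0 with rfl | hm
  · simp
  · rw [HahnSeries.C_apply, HahnSeries.coeff_single_of_ne hm]
    simp

lemma euler_mul (f g : LaurentSeries ℂ) : euler (f * g) = f * euler g + g * euler f := by
  rw [mul_comm g]
  ext m
  rw [coeff_euler, HahnSeries.coeff_add,
    HahnSeries.coeff_mul_left' f.isPWO_support (support_euler_subset f),
    HahnSeries.coeff_mul_right' g.isPWO_support (support_euler_subset g), HahnSeries.coeff_mul,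
    Finset.mul_sum, ← Finset.sum_add_distrib]
  refine Finset.sum_congr rfl fun ij hij => ?_
  have h : ij.1 + ij.2 = m := by
    have := hij
    simp only [Finset.mem_antidiagonal] at this
    exact this.2.2
  rw [coeff_euler, coeff_euler, ← h]
  push_cast
  ring

lemma StartsWith.euler {f : LaurentSeries ℂ} {a : ℤ} {c : ℂ} (hf : StartsWith f a c) :
    StartsWith (SatoStratum.euler f) a (a * c) :=
  ⟨fun m hm => by rw [coeff_euler, hf.1 m hm, mul_zero], by rw [coeff_euler, hf.2]⟩

namespace CubicRing

variable {E : WeierstrassCurve ℂ}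

/-! ### Expansion at infinity -/

section Expansion

variable {f g : LaurentSeries ℂ} (hf : StartsWith f (-2) 1) (hg : StartsWith g (-3) 1)
include hf hg

lemma startsWith_eval₂_mul (q : ℂ[X]) : StartsWith (q.eval₂ HahnSeries.C f * g)
    (-2 * q.natDegree - 3) q.leadingCoeff := by
  simpa [sub_eq_add_neg] using (hf.eval₂ q).mul hg

/-- The leading exponents -2 deg p and -2 deg q - 3 have different parity, so leading terms cannot
cancel. This is the source of both the injectivity of the expansion and the constancy of functions
without pole. -/
lemma natDegree_eq_zero_of_expansion {p q : ℂ[X]}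
    (h : ∀ m < 0, (p.eval₂ HahnSeries.C f + q.eval₂ HahnSeries.C f * g).coeff m = 0) :
    q = 0 ∧ p.natDegree = 0 := by
  have hp := hf.eval₂ p
  have hq := startsWith_eval₂_mul hf hg q
  by_cases hlt : q ≠ 0 ∧ 2 * p.natDegree < 2 * q.natDegree + 3
  · have h1 := h (-2 * q.natDegree - 3) (by omega)
    rw [HahnSeries.coeff_add, hp.1 _ (by omega), hq.2, zero_add] at h1
    exact absurd (Polynomial.leadingCoeff_eq_zero.1 h1) hlt.1
  · rcases Nat.eq_zero_or_pos p.natDegree with hp0 | hp0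
    · refine ⟨?_, hp0⟩
      by_contra hq0
      exact hlt ⟨hq0, by omega⟩
    · have h1 := h (-2 * p.natDegree) (by omega)
      have hq1 : (q.eval₂ HahnSeries.C f * g).coeff (-2 * p.natDegree) = 0 := by
        by_cases hq0 : q = 0
        · simp [hq0]
        · have : 2 * q.natDegree + 3 ≤ 2 * p.natDegree := by
            by_contra hcon
            exact hlt ⟨hq0, by omega⟩
          exact hq.1 _ (by omega)
      rw [HahnSeries.coeff_add, hp.2, hq1, add_zero, Polynomial.leadingCoeff_eq_zero] at h1
      rw [h1] at hp0
      simp at hp0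

end Expansion

/-- An expansion of the functions on the cubic at infinity, with `z = 1 / t` a local coordinate. -/
structure IsExpansion (σ : Coord E →+* LaurentSeries ℂ) : Prop where
  map_const : ∀ c, σ (const E c) = HahnSeries.C c
  map_x : StartsWith (σ (x E)) (-2) 1
  map_y : StartsWith (σ (y E)) (-3) 1

namespace IsExpansion

variable {σ : Coord E →+* LaurentSeries ℂ} (hσ : IsExpansion σ)
include hσ

lemma map_eval₂ (p : ℂ[X]) : σ (p.eval₂ (const E) (x E)) = p.eval₂ HahnSeries.C (σ (x E)) := by
  rw [Polynomial.hom_eval₂]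
  congr 1
  exact RingHom.ext hσ.map_const

lemma exists_const {r : Coord E} (h : ∀ m < 0, (σ r).coeff m = 0) : ∃ c, r = const E c := by
  obtain ⟨p, q, rfl⟩ := exists_eq E r
  simp only [map_add, map_mul, hσ.map_eval₂] at h
  obtain ⟨hq, hp⟩ := natDegree_eq_zero_of_expansion hσ.map_x hσ.map_y h
  rw [Polynomial.eq_C_of_natDegree_eq_zero hp, hq]
  exact ⟨p.coeff 0, by simp⟩

lemma injective : Function.Injective σ := by
  rw [injective_iff_map_eq_zero]
  intro r hr
  obtain ⟨c, rfl⟩ := hσ.exists_const (r := r) fun m _ => by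
    rw [hr]
    rfl
  rw [hσ.map_const] at hr
  have h0 : (HahnSeries.C c : LaurentSeries ℂ).coeff 0 = 0 := by
    rw [hr]
    rfl
  rw [(startsWith_C c).2] at h0
  rw [h0, map_zero]

end IsExpansion


/-! ### Differentials of the function field -/

section Differentials

open KaehlerDifferential

variable (K : Type) [Field K] [Algebra ℂ K] [Algebra (Coord E) K] [IsScalarTower ℂ (Coord E) K]

/-- The inclusion of the coordinate ring into the function field. -/
abbrev incl : Coord E →+* K := algebraMap (Coord E) K

lemma incl_const (c : ℂ) : incl (E := E) K (const E c) = algebraMap ℂ K c :=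
  (IsScalarTower.algebraMap_apply ℂ (Coord E) K c).symm

/-- The invariant differential `dx / (2 y + a₁ x + a₃)`. -/
def omega : Ω[K⁄ℂ] := (incl K (derivY E))⁻¹ • D ℂ K (incl K (x E))

lemma cubic_incl : (incl K (y E)) ^ 2 - (incl K (x E)) ^ 3
    + algebraMap ℂ K E.a₁ * incl K (y E) * incl K (x E)
    - algebraMap ℂ K E.a₂ * (incl K (x E)) ^ 2 + algebraMap ℂ K E.a₃ * incl K (y E)
    - algebraMap ℂ K E.a₄ * incl K (x E) - algebraMap ℂ K E.a₆ = 0 := by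
  have h := congrArg (incl K) (CubicRing.cubicValue_eq_zero E)
  simp only [cubicValue, map_add, map_sub, map_mul, map_pow, map_zero, incl_const] at h
  exact h

lemma incl_derivX : incl K (derivX E) = algebraMap ℂ K E.a₁ * incl K (y E)
    - (3 * (incl K (x E)) ^ 2 + 2 * algebraMap ℂ K E.a₂ * incl K (x E) + algebraMap ℂ K E.a₄) := by
  simp only [derivX, map_add, map_sub, map_mul, map_pow, map_ofNat, incl_const]

lemma incl_derivY : incl K (derivY E) = 2 * incl K (y E) + algebraMap ℂ K E.a₁ * incl K (x E)
    + algebraMap ℂ K E.a₃ := by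
  simp only [derivY, map_add, map_mul, map_ofNat, incl_const]

lemma derivX_smul_add_derivY_smul : incl K (derivX E) • D ℂ K (incl K (x E))
    + incl K (derivY E) • D ℂ K (incl K (y E)) = 0 := by
  have h := congrArg (D ℂ K) (cubic_incl (E := E) K)
  simp only [map_add, map_sub, map_zero, Derivation.leibniz, Derivation.map_algebraMap, smul_zero,
    add_zero, pow_succ, pow_zero, one_mul] at h
  rw [incl_derivX, incl_derivY, ← h]
  module

variable [IsFractionRing (Coord E) K]

omit [Algebra ℂ K] [IsScalarTower ℂ (Coord E) K] in
lemma incl_derivY_ne_zero : incl K (derivY E) ≠ 0 := by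
  rw [Ne, map_eq_zero_iff _ (IsFractionRing.injective (Coord E) K)]
  exact derivY_ne_zero

omit [IsScalarTower ℂ (Coord E) K] in
lemma D_x : D ℂ K (incl K (x E)) = incl K (derivY E) • omega (E := E) K := by
  rw [omega, smul_smul, mul_inv_cancel₀ (incl_derivY_ne_zero K), one_smul]

lemma D_y : D ℂ K (incl K (y E)) = -incl K (derivX E) • omega (E := E) K := by
  have h := derivX_smul_add_derivY_smul (E := E) K
  rw [D_x, smul_smul, mul_comm, ← smul_smul, ← smul_add,
    smul_eq_zero_iff_right (incl_derivY_ne_zero K)] at h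
  rw [neg_smul]
  exact eq_neg_of_add_eq_zero_right h

lemma D_eval₂ (p : ℂ[X]) (k : K) : ∃ p' : ℂ[X],
    D ℂ K (p.eval₂ (algebraMap ℂ K) k) = p'.eval₂ (algebraMap ℂ K) k • D ℂ K k :=
  ⟨derivative p, Derivation.map_aeval (D ℂ K) p k⟩

omit [IsFractionRing (Coord E) K] in
lemma incl_eval₂ (p : ℂ[X]) : incl K (p.eval₂ (const E) (x E)) =
    p.eval₂ (algebraMap ℂ K) (incl K (x E)) := by
  rw [Polynomial.hom_eval₂]
  congr 1
  exact RingHom.ext (incl_const K)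

/-- From dx = F_y ω and dy = -F_x ω, the differential of a regular function is a regular multiple of
ω. -/
lemma exists_D_incl (r : Coord E) : ∃ r' : Coord E,
    D ℂ K (incl K r) = incl K r' • omega (E := E) K := by
  obtain ⟨p, q, rfl⟩ := exists_eq E r
  obtain ⟨p', hp⟩ := D_eval₂ K p (incl K (x E))
  obtain ⟨q', hq⟩ := D_eval₂ K q (incl K (x E))
  refine ⟨p'.eval₂ (const E) (x E) * derivY E - q.eval₂ (const E) (x E) * derivX E
    + y E * q'.eval₂ (const E) (x E) * derivY E, ?_⟩
  rw [map_add, map_mul, map_add, Derivation.leibniz, incl_eval₂, incl_eval₂, hp, hq, D_x, D_y]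
  simp only [map_add, map_sub, map_mul, incl_eval₂]
  module

lemma smul_D_div (r s : K) (hs : s ≠ 0) :
    s • D ℂ K (r / s) = D ℂ K r - (r / s) • D ℂ K s := by
  have h : D ℂ K r = D ℂ K (s * (r / s)) := by rw [mul_div_cancel₀ _ hs]
  rw [h, Derivation.leibniz, add_sub_cancel_right]

/-- The differential of a fraction `r / s`. -/
lemma exists_D_div (r s : Coord E) (hs : s ≠ 0) : ∃ r' s' : Coord E,
    D ℂ K (incl K r / incl K s) = ((incl K r' - incl K r / incl K s * incl K s') / incl K s)
      • omega (E := E) K := by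
  have hs' : incl K s ≠ 0 := by
    rwa [Ne, map_eq_zero_iff _ (IsFractionRing.injective (Coord E) K)]
  obtain ⟨r', hr'⟩ := exists_D_incl (E := E) K r
  obtain ⟨t, ht⟩ := exists_D_incl (E := E) K s
  refine ⟨r', t, ?_⟩
  have h := smul_D_div K (incl K r) (incl K s) hs'
  rw [hr', ht, smul_smul, ← sub_smul] at h
  rw [div_eq_inv_mul (_ - _), ← smul_smul, ← h, smul_smul, inv_mul_cancel₀ hs', one_smul]

lemma exists_eq_smul_omega (η : Ω[K⁄ℂ]) : ∃ k : K, η = k • omega (E := E) K := by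
  have hη : η ∈ Submodule.span K (Set.range (D ℂ K)) := by
    rw [KaehlerDifferential.span_range_derivation]
    trivial
  induction hη using Submodule.span_induction with
  | mem z hz =>
    obtain ⟨k, rfl⟩ := hz
    obtain ⟨r, s, hs, rfl⟩ := IsFractionRing.div_surjective (A := Coord E) k
    obtain ⟨r', s', h⟩ := exists_D_div (E := E) K r s (nonZeroDivisors.ne_zero hs)
    exact ⟨_, h⟩
  | zero => exact ⟨0, by simp⟩
  | add a b _ _ ha hb =>
    obtain ⟨k, rfl⟩ := ha
    obtain ⟨l, rfl⟩ := hb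
    exact ⟨k + l, by rw [add_smul]⟩
  | smul c a _ ha =>
    obtain ⟨k, rfl⟩ := ha
    exact ⟨c * k, by rw [mul_smul]⟩

end Differentials

end CubicRing

namespace CubicRing

open KaehlerDifferential

/-! ### The invariant differential is regular -/

variable (K : Type) [Field K]

lemma inv_mem_of_not_mem {O : ValuationSubring K} {k : K} (hk : k ∉ O) : k⁻¹ ∈ O :=
  (O.mem_or_inv_mem k).resolve_left hk

/-- A root of a monic cubic whose coefficients are in the valuation ring is in the ring. -/
lemma mem_of_cubic_eq {O : ValuationSubring K} {u a b c : K} (ha : a ∈ O) (hb : b ∈ O)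
    (hc : c ∈ O) (h : u ^ 3 = a * u ^ 2 + b * u + c) : u ∈ O := by
  by_contra hu
  apply hu
  have hu' := inv_mem_of_not_mem K hu
  have h0 : u ≠ 0 := by
    rintro rfl
    exact hu (zero_mem O)
  have : u = a + b * u⁻¹ + c * u⁻¹ ^ 2 := by
    field_simp
    linear_combination h
  rw [this]
  exact add_mem (add_mem ha (mul_mem hb hu')) (mul_mem hc (pow_mem hu' _))

variable {E : WeierstrassCurve ℂ} [Algebra ℂ K] [Algebra (Coord E) K]
  [IsScalarTower ℂ (Coord E) K]

lemma incl_mem {O : ValuationSubring K} (hO : ∀ c : ℂ, algebraMap ℂ K c ∈ O)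
    (hx : incl (E := E) K (x E) ∈ O) (hy : incl (E := E) K (y E) ∈ O) (r : Coord E) :
    incl K r ∈ O := by
  have hp : ∀ p : ℂ[X], p.eval₂ (algebraMap ℂ K) (incl K (x E)) ∈ O := by
    intro p
    rw [Polynomial.eval₂_eq_sum_range]
    exact sum_mem fun i _ => mul_mem (hO _) (pow_mem hx _)
  obtain ⟨p, q, rfl⟩ := exists_eq E r
  rw [map_add, map_mul, incl_eval₂, incl_eval₂]
  exact add_mem (hp p) (mul_mem (hp q) hy)

/-- If y were not in `O`, then 1/y would be, and the equation divided by y would write y as an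
element of `O`. -/
lemma y_mem_of_x_mem {O : ValuationSubring K} (hO : ∀ c : ℂ, algebraMap ℂ K c ∈ O)
    (hx : incl (E := E) K (x E) ∈ O) : incl (E := E) K (y E) ∈ O := by
  by_contra hy
  apply hy
  have hy' := inv_mem_of_not_mem K hy
  have h0 : incl (E := E) K (y E) ≠ 0 := by
    intro h
    rw [h] at hy
    exact hy (zero_mem O)
  have h := cubic_incl (E := E) K
  set a := incl (E := E) K (x E)
  set b := incl (E := E) K (y E)
  have hb : b = -(algebraMap ℂ K E.a₁ * a + algebraMap ℂ K E.a₃) + (a ^ 3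
      + algebraMap ℂ K E.a₂ * a ^ 2 + algebraMap ℂ K E.a₄ * a + algebraMap ℂ K E.a₆) * b⁻¹ := by
    field_simp
    linear_combination h
  rw [hb]
  refine add_mem (neg_mem (add_mem (mul_mem (hO _) hx) (hO _))) (mul_mem ?_ hy')
  exact add_mem (add_mem (add_mem (pow_mem hx _) (mul_mem (hO _) (pow_mem hx _)))
    (mul_mem (hO _) hx)) (hO _)

lemma y_not_mem_of_x_not_mem {O : ValuationSubring K} (hO : ∀ c : ℂ, algebraMap ℂ K c ∈ O)
    (hx : incl (E := E) K (x E) ∉ O) : incl (E := E) K (y E) ∉ O := by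
  intro hy
  apply hx
  have hx' := inv_mem_of_not_mem K hx
  have h0 : incl (E := E) K (x E) ≠ 0 := by
    intro h
    rw [h] at hx
    exact hx (zero_mem O)
  have h := cubic_incl (E := E) K
  set a := incl (E := E) K (x E)
  set b := incl (E := E) K (y E)
  have ha : a = b ^ 2 * a⁻¹ ^ 2 + algebraMap ℂ K E.a₁ * b * a⁻¹ - algebraMap ℂ K E.a₂
      + algebraMap ℂ K E.a₃ * b * a⁻¹ ^ 2 - algebraMap ℂ K E.a₄ * a⁻¹
      - algebraMap ℂ K E.a₆ * a⁻¹ ^ 2 := by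
    field_simp
    linear_combination -h
  rw [ha]
  exact sub_mem (sub_mem (add_mem (sub_mem (add_mem (mul_mem (pow_mem hy _) (pow_mem hx' _))
    (mul_mem (mul_mem (hO _) hy) hx')) (hO _)) (mul_mem (mul_mem (hO _) hy) (pow_mem hx' _)))
    (mul_mem (hO _) hx')) (mul_mem (hO _) (pow_mem hx' _))

variable [IsFractionRing (Coord E) K]

/-- If A F_x + B F_y = 1, then ω = B dx - A dy. -/
lemma omega_mem_of_x_mem [E.IsElliptic] {O : ValuationSubring K}
    (hO : ∀ c : ℂ, algebraMap ℂ K c ∈ O) (hx : incl (E := E) K (x E) ∈ O) :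
    omega (E := E) K ∈ Submodule.span ℂ {η | ∃ a ∈ O, ∃ b ∈ O, η = a • D ℂ K b} := by
  have hy := y_mem_of_x_mem K hO hx
  obtain ⟨A, B, hAB⟩ := exists_mul_derivX_add_mul_derivY (E := E)
  have h : omega (E := E) K = incl K B • D ℂ K (incl K (x E))
      + (-incl K A) • D ℂ K (incl K (y E)) := by
    have h1 := congrArg (incl K) hAB
    rw [map_add, map_mul, map_mul, map_one] at h1
    rw [D_x, D_y, smul_smul, smul_smul, ← add_smul]
    rw [show incl K B * incl K (derivY E) + -incl K A * -incl K (derivX E) = 1 by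
      linear_combination h1, one_smul]
  rw [h]
  exact add_mem (Submodule.subset_span ⟨_, incl_mem K hO hx hy B, _, hx, rfl⟩)
    (Submodule.subset_span ⟨_, neg_mem (incl_mem K hO hx hy A), _, hy, rfl⟩)

/-- Near infinity the coordinates w = 1/y and u = x/y lie in `O`. There du = F ω, where -F is the
w-derivative of the equation in this chart; F is a unit of `O` because it is -1 modulo the maximal
ideal. -/
lemma omega_mem_of_x_not_mem {O : ValuationSubring K}
    (hO : ∀ c : ℂ, algebraMap ℂ K c ∈ O) (hx : incl (E := E) K (x E) ∉ O) :
    omega (E := E) K ∈ Submodule.span ℂ {η | ∃ a ∈ O, ∃ b ∈ O, η = a • D ℂ K b} := by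
  have hy := y_not_mem_of_x_not_mem K hO hx
  have h0 : incl (E := E) K (y E) ≠ 0 := by
    intro h
    rw [h] at hy
    exact hy (zero_mem O)
  have hw := inv_mem_of_not_mem K hy
  have h := cubic_incl (E := E) K
  have hX := incl_derivX (E := E) K
  have hY := incl_derivY (E := E) K
  have hDx := D_x (E := E) K
  have hDy := D_y (E := E) K
  generalize incl (E := E) K (derivX E) = WX at *
  generalize incl (E := E) K (derivY E) = WY at *
  generalize incl (E := E) K (x E) = a at *
  generalize incl (E := E) K (y E) = b at *
  generalize omega (E := E) K = ω at *
  have hc₁ := hO E.a₁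
  have hc₂ := hO E.a₂
  have hc₃ := hO E.a₃
  have hc₄ := hO E.a₄
  have hc₆ := hO E.a₆
  generalize algebraMap ℂ K E.a₁ = a₁ at *
  generalize algebraMap ℂ K E.a₂ = a₂ at *
  generalize algebraMap ℂ K E.a₃ = a₃ at *
  generalize algebraMap ℂ K E.a₄ = a₄ at *
  generalize algebraMap ℂ K E.a₆ = a₆ at *
  set w := b⁻¹ with hwdef
  set u := a * w with hudef
  have hbw : b * w = 1 := mul_inv_cancel₀ h0
  have hcub : u ^ 3 = -(a₂ * w) * u ^ 2 + (a₁ * w - a₄ * w ^ 2) * u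
      + w * (1 + a₃ * w - a₆ * w ^ 2) := by
    rw [hudef, hwdef]
    field_simp
    linear_combination -h
  have hcoef : 1 + a₃ * w - a₆ * w ^ 2 ∈ O :=
    sub_mem (add_mem (one_mem O) (mul_mem hc₃ hw)) (mul_mem hc₆ (pow_mem hw _))
  have hu : u ∈ O := mem_of_cubic_eq K (neg_mem (mul_mem hc₂ hw))
    (sub_mem (mul_mem hc₁ hw) (mul_mem hc₄ (pow_mem hw _))) (mul_mem hw hcoef) hcub
  set F := a₂ * u ^ 2 + 2 * a₄ * u * w + 3 * a₆ * w ^ 2 - 1 - a₁ * u - 2 * a₃ * w with hF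
  have hFinv : F ≠ 0 ∧ F⁻¹ ∈ O := by
    let w' : O := ⟨w, hw⟩
    let u' : O := ⟨u, hu⟩
    let c₁ : O := ⟨a₁, hc₁⟩
    let c₂ : O := ⟨a₂, hc₂⟩
    let c₃ : O := ⟨a₃, hc₃⟩
    let c₄ : O := ⟨a₄, hc₄⟩
    let c₆ : O := ⟨a₆, hc₆⟩
    let F' : O := c₂ * u' ^ 2 + 2 * c₄ * u' * w' + 3 * c₆ * w' ^ 2 - 1 - c₁ * u' - 2 * c₃ * w'
    have hFF : (F' : K) = F := rfl
    have hwm : w' ∈ IsLocalRing.maximalIdeal O := by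
      rw [IsLocalRing.mem_maximalIdeal, mem_nonunits_iff]
      intro hunit
      obtain ⟨v, hv⟩ := hunit.exists_right_inv
      have hv' : w * (v : K) = 1 := congrArg Subtype.val hv
      have hbv : b = v := by
        have : b * (w * (v : K)) = b := by rw [hv', mul_one]
        rw [← this, ← mul_assoc, hbw, one_mul]
      exact hy (hbv ▸ v.2)
    -- By the equation, u³ is a multiple of w, which is a non-unit since its inverse y is not in
    -- `O`.
    have hum : u' ∈ IsLocalRing.maximalIdeal O := by
      refine Ideal.IsPrime.mem_of_pow_mem (inferInstance : (IsLocalRing.maximalIdeal O).IsPrime)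
        3 ?_
      have : u' ^ 3 = -(c₂ * w') * u' ^ 2 + (c₁ * w' - c₄ * w' ^ 2) * u'
          + w' * (1 + c₃ * w' - c₆ * w' ^ 2) := Subtype.ext hcub
      rw [this, show -(c₂ * w') * u' ^ 2 + (c₁ * w' - c₄ * w' ^ 2) * u'
          + w' * (1 + c₃ * w' - c₆ * w' ^ 2) = (-c₂ * u' ^ 2 + (c₁ - c₄ * w') * u'
          + (1 + c₃ * w' - c₆ * w' ^ 2)) * w' by ring]
      exact Ideal.mul_mem_left _ _ hwm
    have hunit : IsUnit F' := by
      by_contra hn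
      have h1 : F' ∈ IsLocalRing.maximalIdeal O := hn
      have h2 : F' + 1 ∈ IsLocalRing.maximalIdeal O := by
        rw [show F' + 1 = (c₂ * u' + 2 * c₄ * w' - c₁) * u' + (3 * c₆ * w' - 2 * c₃) * w' by
          simp only [F']
          ring]
        exact add_mem (Ideal.mul_mem_left _ _ hum) (Ideal.mul_mem_left _ _ hwm)
      have h3 : (1 : O) ∈ IsLocalRing.maximalIdeal O := by
        have := sub_mem h2 h1
        rwa [add_sub_cancel_left] at this
      exact (Ideal.ne_top_iff_one _).1 (IsLocalRing.maximalIdeal.isMaximal O).ne_top h3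
    obtain ⟨v, hv⟩ := hunit.exists_right_inv
    have hv' : F * (v : K) = 1 := congrArg Subtype.val hv
    have hF0 : F ≠ 0 := left_ne_zero_of_mul_eq_one hv'
    refine ⟨hF0, ?_⟩
    rw [← eq_inv_of_mul_eq_one_right hv']
    exact v.2
  have hDw : D ℂ K w = (w ^ 2 * WX) • ω := by
    have h1 : D ℂ K (b * w) = 0 := by
      rw [hbw]
      exact Derivation.map_one_eq_zero _
    rw [Derivation.leibniz, hDy] at h1
    have h2 := congrArg (fun η => w • η) h1
    simp only [smul_add, smul_smul, smul_zero] at h2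
    rw [mul_comm w b, hbw, one_smul] at h2
    rw [eq_neg_of_add_eq_zero_left h2, ← neg_smul]
    congr 1
    ring
  have hDu : D ℂ K u = F • ω := by
    rw [hudef, Derivation.leibniz, hDw, hDx, smul_smul, smul_smul, ← add_smul]
    congr 1
    rw [hF, hudef, hwdef, hX, hY]
    field_simp
    linear_combination 3 * h
  have hω : ω = F⁻¹ • D ℂ K u := by
    rw [hDu, smul_smul, inv_mul_cancel₀ hFinv.1, one_smul]
  rw [hω]
  exact Submodule.subset_span ⟨_, hFinv.2, _, hu, rfl⟩

theorem omega_mem_regularDifferentials [E.IsElliptic] :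
    omega (E := E) K ∈ regularDifferentials K := by
  rw [regularDifferentials, Submodule.mem_iInf]
  intro O
  rw [Submodule.mem_iInf]
  intro hO
  by_cases hx : incl (E := E) K (x E) ∈ O
  · exact omega_mem_of_x_mem K hO hx
  · exact omega_mem_of_x_not_mem K hO hx

end CubicRing

namespace CubicRing

open KaehlerDifferential

variable {E : WeierstrassCurve ℂ} (K : Type) [Field K] [Algebra ℂ K] [Algebra (Coord E) K]
  [IsScalarTower ℂ (Coord E) K] [IsFractionRing (Coord E) K]

/-! ### Regular differentials are constant multiples of the invariant differential -/

omit [IsFractionRing (Coord E) K] [IsScalarTower ℂ (Coord E) K] in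
/-- If the differentials of all elements of `O` are multiples of `ω` by elements of `O`, so are
the combinations of such differentials. -/
lemma exists_mem_eq_smul_omega {O : ValuationSubring K} (hO : ∀ c : ℂ, algebraMap ℂ K c ∈ O)
    (hD : ∀ b ∈ O, ∃ g ∈ O, D ℂ K b = g • omega (E := E) K) {η : Ω[K⁄ℂ]}
    (hη : η ∈ Submodule.span ℂ {η | ∃ a ∈ O, ∃ b ∈ O, η = a • D ℂ K b}) :
    ∃ g ∈ O, η = g • omega (E := E) K := by
  induction hη using Submodule.span_induction with
  | mem z hz =>
    obtain ⟨a, ha, b, hb, rfl⟩ := hz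
    obtain ⟨g, hg, h⟩ := hD b hb
    exact ⟨a * g, mul_mem ha hg, by rw [h, smul_smul]⟩
  | zero => exact ⟨0, zero_mem O, by simp⟩
  | add a b _ _ ha hb =>
    obtain ⟨k, hk, rfl⟩ := ha
    obtain ⟨l, hl, rfl⟩ := hb
    exact ⟨k + l, add_mem hk hl, by rw [add_smul]⟩
  | smul c a _ ha =>
    obtain ⟨k, hk, rfl⟩ := ha
    exact ⟨algebraMap ℂ K c * k, mul_mem (hO c) hk, by rw [mul_smul, algebraMap_smul]⟩

omit [IsScalarTower ℂ (Coord E) K] [IsFractionRing (Coord E) K] in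
lemma mem_of_mem_regularDifferentials (hω : omega (E := E) K ≠ 0) {O : ValuationSubring K}
    (hO : ∀ c : ℂ, algebraMap ℂ K c ∈ O)
    (hD : ∀ b ∈ O, ∃ g ∈ O, D ℂ K b = g • omega (E := E) K) {k : K}
    (hk : k • omega (E := E) K ∈ regularDifferentials K) : k ∈ O := by
  rw [regularDifferentials, Submodule.mem_iInf] at hk
  have h := hk O
  rw [Submodule.mem_iInf] at h
  obtain ⟨g, hg, hkg⟩ := exists_mem_eq_smul_omega K hO hD (h hO)
  rw [← sub_eq_zero, ← sub_smul, smul_eq_zero_iff_left hω, sub_eq_zero] at hkg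
  rwa [hkg]

/-- At a prime `v`, an integral b is n/d with d a unit at `v`, so db is a `v`-integral multiple of
ω. Regularity of kω thus makes k integral at every `v`, and a Dedekind domain is the intersection of
its valuation rings. -/
lemma exists_incl_eq [E.IsElliptic] (hω : omega (E := E) K ≠ 0) {k : K}
    (hk : k • omega (E := E) K ∈ regularDifferentials K) : ∃ r : Coord E, incl K r = k := by
  have := isDedekindDomain (E := E)
  refine IsDedekindDomain.HeightOneSpectrum.mem_integers_of_valuation_le_one (R := Coord E) K k
    fun v => ?_
  have hle : ∀ r : Coord E, incl K r ∈ (v.valuation K).valuationSubring := fun r =>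
    (Valuation.mem_valuationSubring_iff _ _).2 (v.valuation_le_one r)
  have hmem : k ∈ (v.valuation K).valuationSubring := by
    refine mem_of_mem_regularDifferentials (E := E) K hω (fun c => ?_) (fun b hb => ?_) hk
    · rw [← incl_const (E := E)]
      exact hle _
    · obtain ⟨n, d, hnd⟩ := v.exists_primeCompl_mul_eq_of_integer b
        ((Valuation.mem_valuationSubring_iff _ _).1 hb)
      have hd0 : (d : Coord E) ≠ 0 := fun h => d.2 (h ▸ zero_mem _)
      have hd0' : incl K (d : Coord E) ≠ 0 := by
        rwa [Ne, map_eq_zero_iff _ (IsFractionRing.injective (Coord E) K)]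
      have hval : v.valuation K (incl K (d : Coord E)) = 1 :=
        v.valuation_eq_one_iff_notMem.2 d.2
      have hbd : b = incl K n / incl K (d : Coord E) := by
        rw [eq_div_iff hd0']
        exact hnd
      obtain ⟨r', s', h⟩ := exists_D_div (E := E) K n d hd0
      rw [← hbd] at h
      refine ⟨_, ?_, h⟩
      rw [div_eq_mul_inv]
      refine mul_mem (sub_mem (hle _) (mul_mem hb (hle _))) ?_
      rw [Valuation.mem_valuationSubring_iff, map_inv₀, hval, inv_one]
  exact (Valuation.mem_valuationSubring_iff _ _).1 hmem

section Infinity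

variable {K}

omit [Algebra (Coord E) K] [IsScalarTower ℂ (Coord E) K] [IsFractionRing (Coord E) K] in
/-- A derivation of an extension of `K` induces a map on the differentials of `K`. -/
lemma exists_functional {M : Type} [Field M] (ι : K →+* M) (d : M → M)
    (hadd : ∀ a b, d (a + b) = d a + d b) (hmul : ∀ a b, d (a * b) = a * d b + b * d a)
    (hconst : ∀ c : ℂ, d (ι (algebraMap ℂ K c)) = 0) :
    ∃ Λ : Ω[K⁄ℂ] →+ M, (∀ k η, Λ (k • η) = ι k * Λ η) ∧ ∀ k, Λ (D ℂ K k) = d (ι k) := by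
  let : Algebra K M := ι.toAlgebra
  let : Algebra ℂ M := (ι.comp (algebraMap ℂ K)).toAlgebra
  have : IsScalarTower ℂ K M := IsScalarTower.of_algebraMap_eq fun _ => rfl
  let δ : Derivation ℂ K M := Derivation.mk'
    { toFun := fun k => d (ι k)
      map_add' := fun a b => by rw [map_add, hadd]
      map_smul' := fun c k => by
        rw [Algebra.smul_def, map_mul, hmul, hconst, mul_zero, add_zero, RingHom.id_apply,
          Algebra.smul_def]
        rfl }
    (fun a b => by
      change d (ι (a * b)) = ι a * d (ι b) + ι b * d (ι a)
      rw [map_mul, hmul])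
  refine ⟨δ.liftKaehlerDifferential.toAddMonoidHom, fun k η => ?_, fun k => ?_⟩
  · exact δ.liftKaehlerDifferential.map_smul k η
  · exact δ.liftKaehlerDifferential_comp_D k

/-- The place at infinity: the elements with an expansion in nonnegative powers. -/
def placeAtInfinity (ι : K →+* LaurentSeries ℂ) : ValuationSubring K where
  carrier := {k | ∀ m < 0, (ι k).coeff m = 0}
  mul_mem' := by
    intro a b ha hb m hm
    rw [map_mul]
    exact (StartsWith.mul (a := 0) (b := 0) ⟨ha, rfl⟩ ⟨hb, rfl⟩).1 m (by omega)
  one_mem' := by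
    intro m hm
    rw [map_one]
    exact startsWith_one.1 m hm
  add_mem' := by
    intro a b ha hb m hm
    rw [map_add, HahnSeries.coeff_add, ha m hm, hb m hm, add_zero]
  zero_mem' := by
    intro m _
    rw [map_zero]
    rfl
  neg_mem' := by
    intro a ha m hm
    rw [map_neg, HahnSeries.coeff_neg, ha m hm, neg_zero]
  mem_or_inv_mem' := by
    intro k
    rcases eq_or_ne k 0 with rfl | hk
    · left
      intro m _
      rw [map_zero]
      rfl
    · have hne : ι k ≠ 0 := (map_ne_zero ι).2 hk
      have hne' : ι k⁻¹ ≠ 0 := (map_ne_zero ι).2 (inv_ne_zero hk)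
      have h1 : ι k * ι k⁻¹ = 1 := by rw [← map_mul, mul_inv_cancel₀ hk, map_one]
      have hsum : (ι k).order + (ι k⁻¹).order = 0 := by
        rw [← HahnSeries.order_mul hne hne', h1, HahnSeries.order_one]
      rcases le_total 0 (ι k).order with h | h
      · left
        intro m hm
        exact HahnSeries.coeff_eq_zero_of_lt_order (by omega)
      · right
        intro m hm
        exact HahnSeries.coeff_eq_zero_of_lt_order (by omega)

variable {σ : Coord E →+* LaurentSeries ℂ}

lemma IsExpansion.startsWith_derivY (hσ : IsExpansion σ) : StartsWith (σ (derivY E)) (-3) 2 := by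
  have h2 : (2 : Coord E) = const E 2 := (map_ofNat (const E) 2).symm
  rw [derivY, h2]
  simp only [map_add, map_mul, hσ.map_const]
  have h := (((hσ.map_y.C_mul 2).add ((hσ.map_x.C_mul E.a₁).of_lt (by norm_num))).add
    ((startsWith_C E.a₃).of_lt (by norm_num)))
  simpa using h

omit [IsScalarTower ℂ (Coord E) K] in
/-- The value of the derivation at `ω`. -/
lemma startsWith_functional_omega (hσ : IsExpansion σ) {ι : K →+* LaurentSeries ℂ} (hι : ∀ r, ι (incl K r) = σ r)
    {Λ : Ω[K⁄ℂ] →+ LaurentSeries ℂ} (hΛ : ∀ k η, Λ (k • η) = ι k * Λ η)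
    (hΛD : ∀ k, Λ (D ℂ K k) = euler (ι k)) : StartsWith (Λ (omega (E := E) K)) 1 (-1) := by
  have h := congrArg Λ (D_x (E := E) K)
  rw [hΛ, hΛD, hι, hι] at h
  -- The Euler derivative of x starts with -2t⁻² and the y-derivative of the equation with 2t⁻³, so
  -- their quotient starts with -t.
  have hx := hσ.map_x.euler
  have hy := hσ.startsWith_derivY
  rw [h] at hx
  set f := Λ (omega (E := E) K)
  have hf0 : f ≠ 0 := by
    intro hf0
    have := hx.2
    rw [hf0, mul_zero] at this
    norm_num at this
  have hlead : f.coeff f.order ≠ 0 := fun h0 => hf0 (HahnSeries.coeff_order_eq_zero.1 h0)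
  have hs : StartsWith f f.order (f.coeff f.order) :=
    ⟨fun m hm => HahnSeries.coeff_eq_zero_of_lt_order hm, rfl⟩
  have hmul := hy.mul hs
  have hord : f.order = 1 := by
    have h1 := hmul.order (mul_ne_zero two_ne_zero hlead)
    have h2 := hx.order (by norm_num)
    omega
  rw [hord] at hs hmul
  have hc : f.coeff 1 = -1 := by
    have h1 := hmul.2
    have h2 := hx.2
    norm_num at h1 h2
    rw [h1] at h2
    linear_combination h2 / 2
  rwa [hc] at hs

lemma omega_ne_zero_and_const (hσ : IsExpansion σ) : omega (E := E) K ≠ 0 ∧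
    ∀ r : Coord E, incl K r • omega (E := E) K ∈ regularDifferentials K → ∃ c, r = const E c := by
  let ι : K →+* LaurentSeries ℂ := IsFractionRing.lift (A := Coord E) hσ.injective
  have hι : ∀ r, ι (incl K r) = σ r := fun r => IsFractionRing.lift_algebraMap hσ.injective r
  have hιc : ∀ c, ι (algebraMap ℂ K c) = HahnSeries.C c := fun c => by
    rw [← incl_const (E := E), hι, hσ.map_const]
  obtain ⟨Λ, hΛ, hΛD⟩ := exists_functional ι euler euler_add euler_mul
    fun c => by rw [hιc, euler_C]
  have hω := startsWith_functional_omega hσ hι hΛ hΛD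
  have hne : omega (E := E) K ≠ 0 := by
    intro h0
    have := hω.2
    rw [h0, map_zero] at this
    norm_num at this
  refine ⟨hne, fun r hr => hσ.exists_const ?_⟩
  rw [← hι]
  refine mem_of_mem_regularDifferentials (E := E) K hne (O := placeAtInfinity ι) (fun c m hm => ?_)
    (fun b hb => ?_) hr
  · rw [hιc]
    exact (startsWith_C c).1 m hm
  · obtain ⟨g, hg⟩ := exists_eq_smul_omega (E := E) K (D ℂ K b)
    refine ⟨g, ?_, hg⟩
    have h := congrArg Λ hg
    rw [hΛ, hΛD] at h
    refine coeff_eq_zero_of_mul (a := 0) hω (by norm_num) fun m hm => ?_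
    rw [← h, coeff_euler]
    -- The Euler derivation kills the constant term, so for b without pole the image of db starts at
    -- exponent 1. Since the image of ω starts there with a nonzero coefficient, g has no pole.
    rcases lt_or_ge m 0 with h0 | h0
    · rw [hb m h0, mul_zero]
    · rw [show m = 0 by omega]
      simp

theorem rank_regularDifferentials [E.IsElliptic] (hσ : IsExpansion σ) :
    Module.rank ℂ (regularDifferentials K) = 1 := by
  obtain ⟨hω, hconst⟩ := omega_ne_zero_and_const (K := K) hσ
  have hspan : regularDifferentials K = Submodule.span ℂ {omega (E := E) K} := by
    apply le_antisymm
    · intro η hη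
      obtain ⟨k, rfl⟩ := exists_eq_smul_omega (E := E) K η
      obtain ⟨r, rfl⟩ := exists_incl_eq (E := E) K hω hη
      obtain ⟨c, rfl⟩ := hconst r hη
      rw [incl_const, algebraMap_smul]
      exact Submodule.smul_mem _ _ (Submodule.mem_span_singleton_self _)
    · rw [Submodule.span_singleton_le_iff_mem]
      exact omega_mem_regularDifferentials K
  rw [hspan]
  exact (rank_submodule_eq_one_iff _).2 ⟨omega K, Submodule.mem_span_singleton_self _, hω, le_rfl⟩

end Infinity

end CubicRing

/-! ### The genus of the tower -/

open CubicRing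

theorem hasGenus_towerSet {E : WeierstrassCurve ℂ} [E.IsElliptic] {α β : ℕ → ℂ[X]} {s : Set ℕ}
    (hαβ : IsTowerData α β) (h2 : 2 ∈ s) (h3 : 3 ∈ s) {σ : Coord E →+* LaurentSeries ℂ}
    (hσ : IsExpansion σ) : HasGenus (towerSet E α β s h2 h3) 1 := by
  refine ⟨isIrreducibleCurve_towerSet hαβ h2 h3, ?_⟩
  intro K _ _ _ _ _
  let e := (towerEquiv hαβ h2 h3 (E := E)).symm
  -- Through `towerEquiv`, a fraction field of the coordinate ring of the tower is one of the
  -- coordinate ring of the cubic.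
  let : Algebra (Coord E) K := ((algebraMap _ K).comp e.toRingEquiv.toRingHom).toAlgebra
  have : IsScalarTower ℂ (Coord E) K := IsScalarTower.of_algebraMap_eq fun c => by
    refine (IsScalarTower.algebraMap_apply ℂ (MvPolynomial s ℂ ⧸
      MvPolynomial.vanishingIdeal ℂ (towerSet E α β s h2 h3)) K c).trans ?_
    rw [← e.commutes]
    rfl
  have : IsFractionRing (Coord E) K :=
    (IsFractionRing.isFractionRing_iff_of_base_ringEquiv K e.symm.toRingEquiv).1 inferInstance
  rw [Nat.cast_one]
  exact rank_regularDifferentials hσ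

/-! ### Square roots depending on a parameter -/

/-- The root is the binomial series of exponent 1/2 at εU. Since U has no constant term, each
coefficient is a polynomial in ε, which gives continuity. -/
lemma exists_powerSeries_sqrt (U : PowerSeries ℂ) (hU : PowerSeries.constantCoeff U = 0) :
    ∃ r : ℂ → PowerSeries ℂ, (∀ ε, r ε ^ 2 = 1 + PowerSeries.C ε * U) ∧ r 0 = 1 ∧
      (∀ ε, PowerSeries.constantCoeff (r ε) = 1) ∧
      ∀ n, Continuous fun ε => PowerSeries.coeff n (r ε) := by
  set b : PowerSeries ℂ := PowerSeries.binomialSeries ℂ (1 / 2 : ℚ) with hb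
  have hb2 : b * b = 1 + PowerSeries.X := by
    rw [hb, ← PowerSeries.binomialSeries_add]
    have := PowerSeries.binomialSeries_nat (R := ℚ) (A := ℂ) 1
    norm_num at this ⊢
    exact this
  have hs : ∀ ε, PowerSeries.HasSubst (PowerSeries.C ε * U) := fun ε =>
    PowerSeries.HasSubst.of_constantCoeff_zero' (by simp [hU])
  have hcoeff : ∀ ε n, PowerSeries.coeff n (b.subst (PowerSeries.C ε * U)) =
      ∑ d ∈ Finset.range (n + 1),
        PowerSeries.coeff d b * (ε ^ d * PowerSeries.coeff n (U ^ d)) := by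
    intro ε n
    rw [PowerSeries.coeff_subst' (hs ε)]
    rw [finsum_eq_sum_of_support_subset (s := Finset.range (n + 1))]
    · refine Finset.sum_congr rfl fun d _ => ?_
      rw [mul_pow, ← map_pow, PowerSeries.coeff_C_mul, smul_eq_mul]
    · intro d hd
      rw [Finset.coe_range, Set.mem_Iio]
      by_contra h
      refine hd ?_
      have hdvd : (PowerSeries.X : PowerSeries ℂ) ^ d ∣ (PowerSeries.C ε * U) ^ d :=
        pow_dvd_pow_of_dvd (PowerSeries.X_dvd_iff.2 (by simp [hU])) d
      change PowerSeries.coeff d b • PowerSeries.coeff n ((PowerSeries.C ε * U) ^ d) = 0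
      rw [PowerSeries.X_pow_dvd_iff.1 hdvd n (by omega), smul_zero]
  refine ⟨fun ε => b.subst (PowerSeries.C ε * U), fun ε => ?_, ?_, fun ε => ?_, fun n => ?_⟩
  · rw [pow_two, ← PowerSeries.subst_mul (hs ε), hb2, PowerSeries.subst_add (hs ε),
      PowerSeries.subst_X (hs ε)]
    congr 1
    rw [← PowerSeries.coe_substAlgHom (hs ε), map_one]
  · ext n
    rw [hcoeff, Finset.sum_eq_single_of_mem 0 (by simp)]
    · simp [hb]
    · intro d _ hd
      simp [hd]
  · rw [← PowerSeries.coeff_zero_eq_constantCoeff_apply, hcoeff]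
    simp [hb]
  · simp only [hcoeff]
    fun_prop

lemma exists_sqrt (u : LaurentSeries ℂ) (hu : ∀ m < 1, u.coeff m = 0) :
    ∃ r : ℂ → LaurentSeries ℂ, (∀ ε, r ε ^ 2 = 1 + HahnSeries.C ε * u) ∧ r 0 = 1 ∧
      (∀ ε, StartsWith (r ε) 0 1) ∧ ∀ m, Continuous fun ε => (r ε).coeff m := by
  obtain ⟨r, hr, hr0, hrc, hcont⟩ := exists_powerSeries_sqrt
    (PowerSeries.mk fun n => u.coeff n) (by simp [hu 0])
  have hU : HahnSeries.ofPowerSeries ℤ ℂ (PowerSeries.mk fun n => u.coeff n) = u := by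
    ext m
    rw [PowerSeries.coeff_coe]
    split_ifs with h
    · exact (hu m (by omega)).symm
    · rw [PowerSeries.coeff_mk]
      congr 1
      omega
  refine ⟨fun ε => HahnSeries.ofPowerSeries ℤ ℂ (r ε), fun ε => ?_, ?_, fun ε => ⟨?_, ?_⟩,
    fun m => ?_⟩
  · rw [← map_pow, hr, map_add, map_one, map_mul, hU, HahnSeries.ofPowerSeries_C]
  · simp only [hr0, map_one]
  · intro m hm
    rw [PowerSeries.coeff_coe, if_pos hm]
  · rw [PowerSeries.coeff_coe]
    simpa using hrc ε
  · simp only [PowerSeries.coeff_coe]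
    split_ifs
    · exact continuous_const
    · exact hcont _

/-! ### Parameters from the first two series -/

/-- The parameters obtained from `H²_k = A k` and `H³_k = B k` by the associativity equations
with `i = 2`. -/
def extendParams (A B : ℤ → ℂ) : ℕ → ℤ → ℂ
  | 0 => 0
  | 1 => 0
  | 2 => A
  | 3 => B
  | j + 4 => fun l => if l = -1 ∨ 1 ≤ l then
      A ((j + 2 : ℕ) + l) + extendParams A B (j + 2) (2 + l)
        + extendParams A B (j + 2) (-1) * A (l + 1) + A (-1) * extendParams A B (j + 2) (l + 1)
        + ∑ n ∈ Finset.Ico (1 : ℤ) l, extendParams A B (j + 2) n * A (l - n)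
        - (extendParams A B (j + 2) (-1) * B l + A (-1) * extendParams A B (j + 3) l
          + ∑ n ∈ (Finset.Ico 2 (j + 2)).attach,
            A (((j + 2 : ℕ) : ℤ) - (n.1 : ℕ)) * extendParams A B n.1 l
          + A (-1) * extendParams A B (j + 2) (-1) * A l)
    else 0
  termination_by j => j
  decreasing_by
    all_goals first
      | omega
      | (have := (Finset.mem_Ico.1 n.2).2; omega)

lemma extendParams_eq (A B : ℤ → ℂ) (j : ℕ) (l : ℤ) : extendParams A B (j + 4) l =
    if l = -1 ∨ 1 ≤ l then
      A ((j + 2 : ℕ) + l) + extendParams A B (j + 2) (2 + l)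
        + extendParams A B (j + 2) (-1) * A (l + 1) + A (-1) * extendParams A B (j + 2) (l + 1)
        + ∑ n ∈ Finset.Ico (1 : ℤ) l, extendParams A B (j + 2) n * A (l - n)
        - (extendParams A B (j + 2) (-1) * B l + A (-1) * extendParams A B (j + 3) l
          + ∑ n ∈ Finset.Ico 2 (j + 2), A (((j + 2 : ℕ) : ℤ) - n) * extendParams A B n l
          + A (-1) * extendParams A B (j + 2) (-1) * A l)
    else 0 := by
  rw [extendParams, ← Finset.sum_attach (Finset.Ico 2 (j + 2))]

lemma extendParams_two (A B : ℤ → ℂ) : extendParams A B 2 = A := by rw [extendParams]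

lemma extendParams_three (A B : ℤ → ℂ) : extendParams A B 3 = B := by rw [extendParams]

lemma isNormalized_extendParams {A B : ℤ → ℂ} (hA : ∀ k, k < -1 ∨ k = 0 → A k = 0)
    (hB : ∀ k, k < -1 ∨ k = 0 → B k = 0) : IsNormalized (extendParams A B) := by
  intro i k hik
  match i with
  | 0 => rw [extendParams]; rfl
  | 1 => rw [extendParams]; rfl
  | 2 => rw [extendParams_two]; exact hA k (by omega)
  | 3 => rw [extendParams_three]; exact hB k (by omega)
  | j + 4 => rw [extendParams_eq, if_neg (by omega)]

lemma assocEq_extendParams (A B : ℤ → ℂ) {j : ℕ} (hj : 2 ≤ j) {l : ℤ} (hl : l = -1 ∨ 1 ≤ l) :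
    AssocEq (extendParams A B) 2 j l := by
  obtain ⟨j, rfl⟩ : ∃ k, j = k + 2 := ⟨j - 2, by omega⟩
  rw [AssocEq, show 2 + (j + 2) = j + 4 by omega, extendParams_eq, if_pos hl, extendParams_two,
    show 2 + 1 = 3 by rfl, extendParams_three, Finset.Ico_self, Finset.sum_empty]
  push_cast
  ring

/-- The equations with i = 2 determine all rows of H from rows 2 and 3. This makes the perturbation
return to H at ε = 0. -/
lemma eq_extendParams {H : ℕ → ℤ → ℂ} (hH : H ∈ params) : extendParams (H 2) (H 3) = H := by
  obtain ⟨h0, hA⟩ := mem_params_iff.1 hH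
  funext i
  induction i using Nat.strong_induction_on with
  | _ i ih =>
    match i with
    | 0 => rw [extendParams]; exact funext fun k => (h0 0 k (by simp)).symm
    | 1 => rw [extendParams]; exact funext fun k => (h0 1 k (by simp)).symm
    | 2 => rw [extendParams_two]
    | 3 => rw [extendParams_three]
    | j + 4 =>
      funext l
      by_cases hl : l = -1 ∨ 1 ≤ l
      · have h1 := assocEq_extendParams (H 2) (H 3) (j := j + 2) (by omega) hl
        have h2 := hA 2 (j + 2) l le_rfl (by omega) hl
        have hs : ∑ n ∈ Finset.Ico 2 (j + 2), extendParams (H 2) (H 3) 2 (((j + 2 : ℕ) : ℤ) - n)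
            * extendParams (H 2) (H 3) n l =
            ∑ n ∈ Finset.Ico 2 (j + 2), H 2 (((j + 2 : ℕ) : ℤ) - n) * H n l :=
          Finset.sum_congr rfl fun n hn => by
            rw [ih n (by have := (Finset.mem_Ico.1 hn).2; omega), extendParams_two]
        simp only [AssocEq, Finset.Ico_self, Finset.sum_empty] at h1 h2
        rw [hs, ih (j + 2) (by omega), ih (j + 2 + 1) (by omega), extendParams_two,
          show 2 + 1 = 3 by rfl, extendParams_three, h2, show 2 + (j + 2) = j + 4 by omega] at h1
        linear_combination -h1
      · rw [extendParams_eq, if_neg hl, h0 _ _ (by omega)]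

lemma continuous_extendParams {T : Type} [TopologicalSpace T] {A B : T → ℤ → ℂ}
    (hA : ∀ k, Continuous fun t => A t k) (hB : ∀ k, Continuous fun t => B t k) (i : ℕ) :
    ∀ k, Continuous fun t => extendParams (A t) (B t) i k := by
  induction i using Nat.strong_induction_on with
  | _ i ih =>
    intro k
    match i with
    | 0 => simp only [extendParams]; exact continuous_const
    | 1 => simp only [extendParams]; exact continuous_const
    | 2 => simp only [extendParams_two]; exact hA k
    | 3 => simp only [extendParams_three]; exact hB k
    | j + 4 =>
      simp only [extendParams_eq]
      split_ifs
      · have h2 := ih (j + 2) (by omega)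
        have h3 := ih (j + 3) (by omega)
        have hs : Continuous fun t => ∑ n ∈ Finset.Ico 2 (j + 2),
            A t (((j + 2 : ℕ) : ℤ) - n) * extendParams (A t) (B t) n k :=
          continuous_finsetSum _ fun n hn => (hA _).mul
            (ih n (by have := (Finset.mem_Ico.1 hn).2; omega) k)
        fun_prop
      · exact continuous_const

/-- The equations with i = 2 make the span stable under p_2(z) and write each p_n(z) as a(p_2) +
b(p_2)p_3. A cubic relation puts p_3² into the span. So the span is closed under multiplication,
which implies the equations for all i. -/
lemma mem_params_of_cubicValue_eq_zero {H : ℕ → ℤ → ℂ} (hH : IsNormalized H)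
    (hA : ∀ (j : ℕ) (l : ℤ), 2 ≤ j → (l = -1 ∨ 1 ≤ l) → AssocEq H 2 j l) {E : WeierstrassCurve ℂ}
    (hE : cubicValue E HahnSeries.C (pSeries H 2) (pSeries H 3) = 0) : H ∈ params := by
  have hP : ∀ j, 2 ≤ j →
      pSeries H 2 * pSeries H j = reducedProduct H HahnSeries.C (pSeries H) 2 j := fun j hj =>
    (pSeries_mul_eq_iff hH le_rfl hj).2 fun l hl => hA j l hj hl
  have h2 := fun w => mul_mem_spanW (pSeries_mem_spanW H le_rfl) (w := w) fun j hj => by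
    rw [hP j hj]
    exact reducedProduct_mem_spanW H le_rfl hj
  have hpow : ∀ (n : ℕ), ∀ w ∈ spanW H, pSeries H 2 ^ n * w ∈ spanW H := by
    intro n
    induction n with
    | zero => intro w hw; rwa [pow_zero, one_mul]
    | succ n ih => intro w hw; rw [pow_succ, mul_assoc]; exact ih _ (h2 w hw)
  have heval : ∀ (a : ℂ[X]), ∀ w ∈ spanW H,
      a.eval₂ HahnSeries.C (pSeries H 2) * w ∈ spanW H := by
    intro a w hw
    rw [Polynomial.eval₂_eq_sum, Polynomial.sum, Finset.sum_mul]
    refine sum_mem fun n _ => ?_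
    rw [mul_assoc]
    exact C_mul_mem_spanW _ (hpow n w hw)
  have p2 := pSeries_mem_spanW H le_rfl
  have p3 := pSeries_mem_spanW H (i := 3) (by omega)
  have h33 : pSeries H 3 * pSeries H 3 ∈ spanW H := by
    have e : pSeries H 3 * pSeries H 3 = pSeries H 2 ^ 2 * pSeries H 2
        - HahnSeries.C E.a₁ * (pSeries H 2 * pSeries H 3)
        + HahnSeries.C E.a₂ * (pSeries H 2 * pSeries H 2) - HahnSeries.C E.a₃ * pSeries H 3
        + HahnSeries.C E.a₄ * pSeries H 2 + HahnSeries.C E.a₆ := by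
      rw [cubicValue] at hE
      linear_combination hE
    rw [e]
    exact add_mem (add_mem (sub_mem (add_mem (sub_mem (hpow 2 _ p2)
      (C_mul_mem_spanW _ (h2 _ p3))) (C_mul_mem_spanW _ (h2 _ p2))) (C_mul_mem_spanW _ p3))
      (C_mul_mem_spanW _ p2)) (C_mem_spanW H _)
  have h3 := fun w => mul_mem_spanW p3 (w := w) fun j hj => by
    obtain ⟨a, b, -, -, -, h⟩ := isLowCombination_of_mulLaw hP j hj
    rw [h, show ∀ u v : LaurentSeries ℂ, pSeries H 3 * (u + v * pSeries H 3) =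
      u * pSeries H 3 + v * (pSeries H 3 * pSeries H 3) from fun u v => by ring]
    exact add_mem (heval a _ p3) (heval b _ h33)
  refine mem_params_of_mul_mem hH fun i j hi hj => ?_
  obtain ⟨a, b, -, -, -, h⟩ := isLowCombination_of_mulLaw hP i hi
  have hw := pSeries_mem_spanW H hj
  rw [h, add_mul, mul_assoc]
  exact add_mem (heval a _ hw) (heval b _ (h3 _ hw))

/-! ### Perturbation of the constant term of the cubic -/

/-- The curve with constant term `a₆ + ε`. -/
def shiftCurve (E : WeierstrassCurve ℂ) (ε : ℂ) : WeierstrassCurve ℂ :=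
  { E with a₆ := E.a₆ + ε }

lemma cubicValue_shiftCurve (E : WeierstrassCurve ℂ) (ε : ℂ) {B : Type} [CommRing B] (c : ℂ →+* B)
    (x y : B) : cubicValue (shiftCurve E ε) c x y = cubicValue E c x y - c ε := by
  simp only [cubicValue, shiftCurve, map_add]
  ring

/-- Completing the square with Y = y + (a₁x + a₃)/2 turns the equation into Y² = cubic in x, so the
shift by ε is solved by Y √(1 + εY⁻²). As Y⁻² starts at t^6 and Y at t^{-3}, the solution changes
only from t^3 on. -/
lemma exists_shifted_solution {E : WeierstrassCurve ℂ} {x y : LaurentSeries ℂ}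
    (hx : StartsWith x (-2) 1) (hy : StartsWith y (-3) 1)
    (h : cubicValue E HahnSeries.C x y = 0) :
    ∃ r : ℂ → LaurentSeries ℂ, (∀ ε, cubicValue (shiftCurve E ε) HahnSeries.C x (r ε) = 0) ∧
      r 0 = y ∧ (∀ ε, ∀ m < 3, (r ε).coeff m = y.coeff m) ∧
      ∀ m, Continuous fun ε => (r ε).coeff m := by
  set Y := y + HahnSeries.C (1 / 2) * (HahnSeries.C E.a₁ * x + HahnSeries.C E.a₃) with hYdef
  have hY : StartsWith Y (-3) 1 := by
    have h1 := ((hx.C_mul E.a₁).of_lt (b := -3) (by norm_num)).add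
      ((startsWith_C E.a₃).of_lt (b := -3) (by norm_num))
    convert hy.add (h1.C_mul (1 / 2)) using 1
    norm_num
  have hY0 : Y ≠ 0 := by
    intro h0
    have := hY.2
    rw [h0] at this
    simp at this
  have hY2 : StartsWith (Y ^ 2) (-6) 1 := by simpa using hY.pow 2
  have huY : (Y⁻¹) ^ 2 * Y ^ 2 = 1 := by rw [← mul_pow, inv_mul_cancel₀ hY0, one_pow]
  have hu : ∀ m < 6, ((Y⁻¹) ^ 2).coeff m = 0 := coeff_eq_zero_of_mul hY2 one_ne_zero fun m hm => by
    rw [huY]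
    exact startsWith_one.1 m (by omega)
  obtain ⟨s, hs, hs0, hs1, hcont⟩ := exists_sqrt ((Y⁻¹) ^ 2) fun m hm => hu m (by omega)
  have hsu : ∀ ε, ∀ m < 6, (s ε - 1).coeff m = 0 := by
    intro ε
    have h2 : StartsWith (s ε + 1) 0 2 := by
      have := (hs1 ε).add startsWith_one
      norm_num at this
      exact this
    refine coeff_eq_zero_of_mul h2 two_ne_zero fun m hm => ?_
    rw [show (s ε - 1) * (s ε + 1) = HahnSeries.C ε * (Y⁻¹) ^ 2 by linear_combination hs ε,
      coeff_C_mul, hu m (by omega), mul_zero]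
  -- The range of summation does not depend on ε, so each coefficient is a fixed finite sum of
  -- continuous functions.
  have hYs : ∀ ε, ∀ m, (Y * (s ε - 1)).coeff m =
      ∑ n ∈ Finset.Icc (-3) (m - 6), Y.coeff n * (s ε - 1).coeff (m - n) := fun ε =>
    coeff_mul_eq_sum_Icc hY.1 (hsu ε)
  refine ⟨fun ε => y + Y * (s ε - 1), fun ε => ?_, ?_, fun ε m hm => ?_, fun m => ?_⟩
  · have e : cubicValue E HahnSeries.C x (y + Y * (s ε - 1)) =
        cubicValue E HahnSeries.C x y + Y ^ 2 * (s ε ^ 2 - 1) := by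
      have h2 : (HahnSeries.C (1 / 2) : LaurentSeries ℂ) * 2 = 1 := by
        rw [← map_ofNat (HahnSeries.C : ℂ →+* LaurentSeries ℂ) 2, ← map_mul]
        norm_num
      simp only [cubicValue]
      have hYd : 2 * Y = 2 * y + (HahnSeries.C E.a₁ * x + HahnSeries.C E.a₃) := by
        rw [hYdef]
        linear_combination (HahnSeries.C E.a₁ * x + HahnSeries.C E.a₃) * h2
      linear_combination -Y * (s ε - 1) * hYd
    rw [cubicValue_shiftCurve, e, h, hs]
    linear_combination HahnSeries.C ε * huY
  · simp only [hs0, sub_self, mul_zero, add_zero]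
  · rw [HahnSeries.coeff_add, hYs, Finset.Icc_eq_empty (by omega), Finset.sum_empty, add_zero]
  · simp only [HahnSeries.coeff_add, hYs, HahnSeries.coeff_sub]
    fun_prop

/-- Rows 2 and 3 are read off x = p_2(z) and the shifted solution, and the other rows come from the
recursion. The coefficients a₁, …, a₄ involve row 3 only at the indices -1 and 1, which the shift
leaves unchanged. -/
lemma exists_perturbation {H : ℕ → ℤ → ℂ} (hH : H ∈ params) :
    ∃ G : ℂ → ℕ → ℤ → ℂ, (∀ ε, G ε ∈ params) ∧ G 0 = H ∧ Continuous G ∧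
      ∀ ε, baseCurve (G ε) = shiftCurve (baseCurve H) ε := by
  have h0 := (mem_params_iff.1 hH).1
  obtain ⟨r, hr, hr0, hr3, hcont⟩ := exists_shifted_solution (startsWith_pSeries H le_rfl)
    (startsWith_pSeries H (i := 3) (by omega)) (cubicValue_eq_zero hH (mulLaw_pSeries hH))
  set B : ℂ → ℤ → ℂ := fun ε k => if k = -1 ∨ 1 ≤ k then (r ε).coeff k else 0 with hB
  set G : ℂ → ℕ → ℤ → ℂ := fun ε => extendParams (H 2) (B ε) with hG
  have hBlow : ∀ ε k, k < 3 → B ε k = H 3 k := by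
    intro ε k hk
    simp only [hB]
    split_ifs with h
    · rw [hr3 ε k hk, h0.coeff_pSeries, if_neg (by omega), zero_add]
    · rw [h0 3 k (by omega)]
  have hnorm : ∀ ε, IsNormalized (G ε) := fun ε =>
    isNormalized_extendParams (fun k hk => h0 2 k (by omega)) fun k hk => by
      simp only [hB]
      rw [if_neg (by omega)]
  have hG2 : ∀ ε, G ε 2 = H 2 := fun ε => extendParams_two _ _
  have hG3 : ∀ ε, G ε 3 = B ε := fun ε => extendParams_three _ _
  have hp2 : ∀ ε, pSeries (G ε) 2 = pSeries H 2 := by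
    intro ε
    ext m
    rw [(hnorm ε).coeff_pSeries, h0.coeff_pSeries, hG2]
  have hp3 : ∀ ε, pSeries (G ε) 3 = r ε := by
    intro ε
    ext m
    rw [(hnorm ε).coeff_pSeries, hG3]
    rcases lt_or_ge m 3 with hm | hm
    · rw [hBlow ε m hm, hr3 ε m hm, h0.coeff_pSeries]
    · simp only [hB]
      rw [if_neg (by omega), if_pos (by omega), zero_add]
  have hval : ∀ ε, cubicValue (shiftCurve (baseCurve H) ε) HahnSeries.C (pSeries (G ε) 2)
      (pSeries (G ε) 3) = 0 := fun ε => by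
    rw [hp2, hp3]
    exact hr ε
  have hmem : ∀ ε, G ε ∈ params := fun ε =>
    mem_params_of_cubicValue_eq_zero (hnorm ε)
      (fun j l hj hl => assocEq_extendParams _ _ hj hl) (hval ε)
  refine ⟨G, hmem, ?_, ?_, fun ε => ?_⟩
  · have hB0 : B 0 = H 3 := by
      funext k
      rw [← hG3, ← zero_add (G 0 3 k)]
      have h1 := (hnorm 0).coeff_pSeries 3 k
      rw [hp3, hr0, h0.coeff_pSeries] at h1
      rw [zero_add]
      exact (add_left_cancel h1).symm
    simp only [hG, hB0]
    exact eq_extendParams hH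
  · refine continuous_pi fun i => continuous_pi fun k => ?_
    refine continuous_extendParams (A := fun _ => H 2) (B := B) (fun _ => continuous_const)
      (fun k => ?_) i k
    simp only [hB]
    split_ifs
    · exact hcont k
    · exact continuous_const
  · have h1 := cubicValue_eq_zero (hmem ε) (mulLaw_pSeries (hmem ε))
    have h2 := hval ε
    have e1 : (baseCurve (G ε)).a₁ = (shiftCurve (baseCurve H) ε).a₁ := by
      simp only [baseCurve, shiftCurve, hG2]
    have e2 : (baseCurve (G ε)).a₂ = (shiftCurve (baseCurve H) ε).a₂ := by
      simp only [baseCurve, shiftCurve, hG3, hBlow ε (-1) (by norm_num)]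
    have e3 : (baseCurve (G ε)).a₃ = (shiftCurve (baseCurve H) ε).a₃ := by
      simp only [baseCurve, shiftCurve, hG2, hG3, hBlow ε (-1) (by norm_num)]
    have e4 : (baseCurve (G ε)).a₄ = (shiftCurve (baseCurve H) ε).a₄ := by
      simp only [baseCurve, shiftCurve, hG2, hG3, hBlow ε (-1) (by norm_num),
        hBlow ε 1 (by norm_num)]
    refine WeierstrassCurve.ext e1 e2 e3 e4 ?_
    refine HahnSeries.C_injective (Γ := ℤ) ?_
    simp only [cubicValue, e1, e2, e3, e4] at h1 h2
    linear_combination h2 - h1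

/-! ### Generic smoothness -/

lemma isElliptic_iff_ne_zero (E : WeierstrassCurve ℂ) : E.IsElliptic ↔ E.Δ ≠ 0 := by
  rw [WeierstrassCurve.isElliptic_iff, isUnit_iff_ne_zero]

theorem isOpen_isElliptic : IsOpen {H : params | (baseCurve H.1).IsElliptic} := by
  simp only [isElliptic_iff_ne_zero]
  have hc : Continuous fun H : ℕ → ℤ → ℂ => (baseCurve H).Δ := by
    simp only [WeierstrassCurve.Δ, WeierstrassCurve.b₂, WeierstrassCurve.b₄, WeierstrassCurve.b₆,
      WeierstrassCurve.b₈, baseCurve]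
    fun_prop
  exact (hc.comp continuous_subtype_val).isOpen_preimage _ isOpen_compl_singleton

lemma finite_setOf_not_isElliptic_shiftCurve (E : WeierstrassCurve ℂ) :
    {ε | ¬ (shiftCurve E ε).IsElliptic}.Finite := by
  -- This is the discriminant as a polynomial in ε: the shift replaces b₆ by b₆ + 4ε and b₈ by b₈ +
  -- b₂ε, and -27b₆² gives the leading coefficient -432.
  let p : ℂ[X] := C (-432) * X ^ 2 +
    C (-E.b₂ ^ 3 - 216 * E.b₆ + 36 * E.b₂ * E.b₄) * X + C E.Δ
  have hp : p ≠ 0 := ne_zero_of_natDegree_gt (n := 0) (by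
    rw [natDegree_quadratic (by norm_num)]
    norm_num)
  refine p.roots.toFinset.finite_toSet.subset fun ε hε => ?_
  have h0 : (shiftCurve E ε).Δ = 0 := by
    by_contra h
    exact hε ((isElliptic_iff_ne_zero _).2 h)
  rw [Finset.mem_coe, Multiset.mem_toFinset, mem_roots hp, IsRoot.def, ← h0]
  simp only [p, eval_add, eval_mul, eval_C, eval_pow, eval_X, shiftCurve, WeierstrassCurve.Δ,
    WeierstrassCurve.b₂, WeierstrassCurve.b₄, WeierstrassCurve.b₆, WeierstrassCurve.b₈]
  ring

theorem dense_isElliptic : Dense {H : params | (baseCurve H.1).IsElliptic} := by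
  intro H
  obtain ⟨G, hG, hG0, hcont, hE⟩ := exists_perturbation H.2
  let g : ℂ → params := fun ε => ⟨G ε, hG ε⟩
  have hg : Continuous g := hcont.subtype_mk _
  have hd : Dense {ε | ¬ (shiftCurve (baseCurve H.1) ε).IsElliptic}ᶜ :=
    (finite_setOf_not_isElliptic_shiftCurve _).countable.dense_compl ℝ
  have h0 : g 0 = H := Subtype.ext hG0
  rw [← h0]
  refine closure_mono ?_ (image_closure_subset_closure_image hg ⟨0, hd 0, rfl⟩)
  rintro _ ⟨ε, hε, rfl⟩
  rw [Set.mem_ofPred_eq, hE]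
  exact not_not.1 hε

/-- The perturbations of H = 0 are distinguished by a₆ of their base curves. -/
theorem infinite_params : params.Infinite := by
  have h0 : (0 : ℕ → ℤ → ℂ) ∈ params :=
    mem_params_iff.2 ⟨fun _ _ _ => rfl, fun i j l _ _ _ => by simp [AssocEq]⟩
  obtain ⟨G, hG, -, -, hE⟩ := exists_perturbation h0
  refine Set.infinite_of_injective_forall_mem (f := G) (fun ε δ h => ?_) hG
  have := congrArg WeierstrassCurve.a₆ ((hE ε).symm.trans ((congrArg baseCurve h).trans (hE δ)))
  exact add_left_cancel this

open CubicRing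

/-! ### The substitution homomorphism -/

lemma substSeries_coord (H : ℕ → ℤ → ℂ) {n : ℕ} (hn : 2 ≤ n) :
    substSeries H (coord (Set.Ici 2) n) = pSeries H n := by
  rw [coord_of_mem (Set.mem_Ici.2 hn)]
  exact MvPolynomial.eval₂_X _ _ _

lemma substSeries_comp_C (H : ℕ → ℤ → ℂ) :
    (substSeries H).comp MvPolynomial.C = HahnSeries.C :=
  RingHom.ext fun c => MvPolynomial.eval₂_C _ _ c

lemma substSeries_quadric (H H' : ℕ → ℤ → ℂ) {i j : ℕ} (hi : 2 ≤ i) (hj : 2 ≤ j) :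
    substSeries H' (quadric H i j) = pSeries H' i * pSeries H' j
      - reducedProduct H HahnSeries.C (pSeries H') i j := by
  rw [quadric_eq, map_sub, map_mul, map_reducedProduct, substSeries_comp_C,
    substSeries_coord H' hi, substSeries_coord H' hj]
  congr 1
  exact reducedProduct_congr (fun n hn => substSeries_coord H' hn) hi hj

lemma range_substSeries {H : ℕ → ℤ → ℂ} (hH : H ∈ params) :
    Set.range (substSeries H) = (spanW H : Set (LaurentSeries ℂ)) := by
  have hmul : ∀ i, 2 ≤ i → ∀ w ∈ spanW H, pSeries H i * w ∈ spanW H := fun i hi w hw =>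
    mul_mem_spanW (pSeries_mem_spanW H hi) (fun j hj => by
      rw [mulLaw_pSeries hH i j hi hj]
      exact reducedProduct_mem_spanW H hi hj) hw
  apply Set.Subset.antisymm
  · rintro _ ⟨f, rfl⟩
    induction f using MvPolynomial.induction_on with
    | C c =>
      rw [show substSeries H (MvPolynomial.C c) = HahnSeries.C c from
        MvPolynomial.eval₂_C _ _ c]
      exact C_mem_spanW H c
    | add f g hf hg =>
      rw [map_add]
      exact add_mem hf hg
    | mul_X f n hf =>
      rw [map_mul, mul_comm, ← coord_of_mem n.2, substSeries_coord H n.2]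
      exact hmul n n.2 _ hf
  · intro w hw
    induction hw using Submodule.span_induction with
    | mem w hw =>
      rcases hw with rfl | ⟨j, hj, rfl⟩
      · exact ⟨1, map_one _⟩
      · exact ⟨_, substSeries_coord H hj⟩
    | zero => exact ⟨0, map_zero _⟩
    | add v w _ _ hv hw =>
      obtain ⟨f, rfl⟩ := hv
      obtain ⟨g, rfl⟩ := hw
      exact ⟨f + g, map_add _ _ _⟩
    | smul c w _ hw =>
      obtain ⟨f, rfl⟩ := hw
      refine ⟨MvPolynomial.C c * f, ?_⟩
      rw [map_mul, smul_eq_C_mul]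
      congr 1
      exact MvPolynomial.eval₂_C _ _ c

/-! ### The varieties as towers -/

lemma exists_lift (E : WeierstrassCurve ℂ) {B : Type} [CommRing B] (c : ℂ →+* B) (a b : B)
    (h : cubicValue E c a b = 0) : ∃ σ : Coord E →+* B, (∀ e, σ (const E e) = c e) ∧
      σ (x E) = a ∧ σ (y E) = b ∧ ∀ (α β : ℕ → ℂ[X]) (s : Set ℕ) (f : MvPolynomial s ℂ),
        σ (towerHom E α β s f) =
          MvPolynomial.eval₂ c (fun n : s => (α n).eval₂ c a + (β n).eval₂ c a * b) f :=
  ⟨CubicRing.lift c a b h, lift_const h, lift_x h, lift_y h, fun _ _ _ => lift_towerHom h⟩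

lemma exists_expansion {H : ℕ → ℤ → ℂ} (hH : H ∈ params) :
    ∃ σ : Coord (baseCurve H) →+* LaurentSeries ℂ, IsExpansion σ ∧
      ∀ α β : ℕ → ℂ[X], (∀ n, 2 ≤ n → pSeries H n = (α n).eval₂ HahnSeries.C (pSeries H 2)
        + (β n).eval₂ HahnSeries.C (pSeries H 2) * pSeries H 3) →
        ∀ f, σ (towerHom (baseCurve H) α β (Set.Ici 2) f) = substSeries H f := by
  have h0 := cubicValue_eq_zero hH (mulLaw_pSeries hH)
  obtain ⟨σ, hc, hx, hy, hσ⟩ := exists_lift _ _ _ _ h0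
  refine ⟨σ, ⟨hc, ?_, ?_⟩, fun α β h f => ?_⟩
  · rw [hx]
    exact startsWith_pSeries H le_rfl
  · rw [hy]
    exact startsWith_pSeries H (by omega)
  · rw [hσ]
    change _ = MvPolynomial.eval₂ HahnSeries.C (fun n : (Set.Ici 2 : Set ℕ) => pSeries H n) f
    congr 1
    funext n
    exact (h n n.2).symm

lemma two_mem_Ici : 2 ∈ Set.Ici 2 := Set.mem_Ici.2 le_rfl

lemma three_mem_Ici : 3 ∈ Set.Ici 2 := Set.mem_Ici.2 (by omega)

lemma cubicF_eq (H : ℕ → ℤ → ℂ) {s : Set ℕ} (h2 : 2 ∈ s) (h3 : 3 ∈ s) :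
    cubicF s H = cubicValue (baseCurve H) MvPolynomial.C (MvPolynomial.X ⟨2, h2⟩)
      (MvPolynomial.X ⟨3, h3⟩) := by
  rw [cubicF, coord_of_mem h2, coord_of_mem h3]
  rfl

/-- The polynomials `α_n`, `β_n` that eliminate `p_4, p_5, …`. -/
lemma exists_towerData {H : ℕ → ℤ → ℂ} (hH : H ∈ params) :
    ∃ α β : ℕ → ℂ[X], IsTowerData α β ∧
      (∀ n, 4 ≤ n → (α n).natDegree ≤ n / 2 ∧ (β n).natDegree ≤ (n - 3) / 2) ∧
      cubicF (Set.Ici 2) H ∈ Ideal.span (quadrics H) ∧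
      ∀ n, 2 ≤ n → graphPoly (Set.Ici 2) α β n ∈ Ideal.span (quadrics H) := by
  set J := Ideal.span (quadrics H) with hJ
  set π := Ideal.Quotient.mk J with hπ
  -- Modulo the quadrics the coordinates themselves obey the multiplication law, so the cubic and
  -- the elimination of p_4, p_5, … hold in the quotient, that is, in the ideal.
  have hP : MulLaw H (π.comp MvPolynomial.C) fun n => π (coord (Set.Ici 2) n) := by
    intro i j hi hj
    rw [← map_reducedProduct, ← map_mul, ← sub_eq_zero, ← map_sub, ← quadric_eq]
    exact Ideal.Quotient.eq_zero_iff_mem.2 (Ideal.subset_span ⟨i, j, hi, hj, rfl⟩)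
  have hlow : ∀ n, ∃ a b : ℂ[X], 4 ≤ n → a.natDegree ≤ n / 2 ∧ b.natDegree ≤ (n - 3) / 2 ∧
      π (coord (Set.Ici 2) n) = a.eval₂ (π.comp MvPolynomial.C) (π (coord (Set.Ici 2) 2))
        + b.eval₂ (π.comp MvPolynomial.C) (π (coord (Set.Ici 2) 2)) * π (coord (Set.Ici 2) 3) := by
    intro n
    by_cases hn : 4 ≤ n
    · obtain ⟨a, b, ha, hb, -, h⟩ := isLowCombination_of_mulLaw (H := H)
        (P := fun n => π (coord (Set.Ici 2) n)) (fun j hj => hP 2 j le_rfl hj) n (by omega)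
      exact ⟨a, b, fun _ => ⟨ha, hb, h⟩⟩
    · exact ⟨0, 0, fun h => absurd h hn⟩
  choose a b hab using hlow
  let α : ℕ → ℂ[X] := fun n => if n = 2 then X else if n = 3 then 0 else a n
  let β : ℕ → ℂ[X] := fun n => if n = 2 then 0 else if n = 3 then 1 else b n
  have hα : ∀ n, 4 ≤ n → α n = a n := fun n hn => by
    simp only [α]
    rw [if_neg (by omega), if_neg (by omega)]
  have hβ : ∀ n, 4 ≤ n → β n = b n := fun n hn => by
    simp only [β]
    rw [if_neg (by omega), if_neg (by omega)]
  have hαβ : IsTowerData α β := ⟨rfl, rfl, rfl, rfl⟩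
  refine ⟨α, β, hαβ, fun n hn => ?_, ?_, fun n hn => ?_⟩
  · rw [hα n hn, hβ n hn]
    exact ⟨(hab n hn).1, (hab n hn).2.1⟩
  · rw [cubicF_eq H two_mem_Ici three_mem_Ici, ← Ideal.Quotient.eq_zero_iff_mem, map_cubicValue,
      ← coord_of_mem, ← coord_of_mem]
    exact cubicValue_eq_zero hH hP
  · rw [graphPoly_eq two_mem_Ici three_mem_Ici hn]
    rcases (by omega : n = 2 ∨ n = 3 ∨ 4 ≤ n) with rfl | rfl | h4
    · simp [hαβ.α_two, hαβ.β_two]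
    · simp [hαβ.α_three, hαβ.β_three]
    · rw [hα n h4, hβ n h4, ← Ideal.Quotient.eq_zero_iff_mem, map_sub, map_sub, map_mul,
        Polynomial.hom_eval₂, Polynomial.hom_eval₂]
      have h := (hab n h4).2.2
      rw [coord_of_mem (Set.mem_Ici.2 hn), coord_of_mem two_mem_Ici,
        coord_of_mem three_mem_Ici] at h
      linear_combination h

/-- The polynomials `α`, `β` describe the tower with parameters `H`. -/
structure Describes (H : ℕ → ℤ → ℂ) (α β : ℕ → ℂ[X]) : Prop where
  data : IsTowerData α β
  natDegree_le : ∀ n, 4 ≤ n → (α n).natDegree ≤ n / 2 ∧ (β n).natDegree ≤ (n - 3) / 2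
  pSeries_eq : ∀ n, 2 ≤ n → pSeries H n = (α n).eval₂ HahnSeries.C (pSeries H 2)
    + (β n).eval₂ HahnSeries.C (pSeries H 2) * pSeries H 3
  ker_eq : RingHom.ker (substSeries H) =
    RingHom.ker (towerHom (baseCurve H) α β (Set.Ici 2))
  span_eq : Ideal.span (quadrics H) = RingHom.ker (towerHom (baseCurve H) α β (Set.Ici 2))
  gammaInf_eq : gammaInf H = towerSet (baseCurve H) α β (Set.Ici 2) two_mem_Ici three_mem_Ici

lemma gammaInf_eq_zeroLocus (H : ℕ → ℤ → ℂ) :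
    gammaInf H = MvPolynomial.zeroLocus ℂ (Ideal.span (quadrics H)) := by
  rw [MvPolynomial.zeroLocus_span]
  ext v
  constructor
  · rintro hv _ ⟨i, j, hi, hj, rfl⟩
    exact hv i j hi hj
  · intro hv i j hi hj
    exact hv _ ⟨i, j, hi, hj, rfl⟩

/-- The quadrics vanish on the series p_n(z), and the ideal they span contains the cubic and the
graph equations, which generate the kernel of `towerHom`. As the expansion at infinity is injective,
this kernel is that of the substitution, so the three ideals coincide. -/
theorem exists_describes {H : ℕ → ℤ → ℂ} (hH : H ∈ params) : ∃ α β, Describes H α β := by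
  obtain ⟨α, β, hαβ, hdeg, hcubic, hgraph⟩ := exists_towerData hH
  obtain ⟨σ, hσ, hsub⟩ := exists_expansion hH
  have hq : Ideal.span (quadrics H) ≤ RingHom.ker (substSeries H) := by
    rw [Ideal.span_le]
    rintro _ ⟨i, j, hi, hj, rfl⟩
    change substSeries H _ = 0
    rw [substSeries_quadric H H hi hj, mulLaw_pSeries hH i j hi hj, sub_self]
  have hp : ∀ n, 2 ≤ n → pSeries H n = (α n).eval₂ HahnSeries.C (pSeries H 2)
      + (β n).eval₂ HahnSeries.C (pSeries H 2) * pSeries H 3 := by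
    intro n hn
    have h := RingHom.mem_ker.1 (hq (hgraph n hn))
    rw [graphPoly_eq two_mem_Ici three_mem_Ici (Set.mem_Ici.2 hn), map_sub, map_sub, map_mul,
      Polynomial.hom_eval₂, Polynomial.hom_eval₂, substSeries_comp_C, ← coord_of_mem,
      ← coord_of_mem, ← coord_of_mem, substSeries_coord H hn, substSeries_coord H le_rfl,
      substSeries_coord H (by omega)] at h
    linear_combination h
  have hker : RingHom.ker (substSeries H) =
      RingHom.ker (towerHom (baseCurve H) α β (Set.Ici 2)) := by
    ext f
    rw [RingHom.mem_ker, RingHom.mem_ker, ← hsub α β hp f]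
    exact map_eq_zero_iff σ hσ.injective
  have hspan : Ideal.span (quadrics H) =
      RingHom.ker (towerHom (baseCurve H) α β (Set.Ici 2)) := by
    refine ker_towerHom_eq_of_mem hαβ two_mem_Ici three_mem_Ici (hker ▸ hq) ?_ (fun n _ => ?_)
      fun n hn => hn
    · rw [← cubicF_eq H]
      exact hcubic
    · rw [← graphPoly_eq two_mem_Ici three_mem_Ici n.2]
      exact hgraph n n.2
  refine ⟨α, β, hαβ, hdeg, hp, hker, hspan, ?_⟩
  rw [gammaInf_eq_zeroLocus, hspan, ker_towerHom hαβ two_mem_Ici three_mem_Ici]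
  exact (isIrreducibleCurve_towerSet hαβ two_mem_Ici three_mem_Ici).1

/-- A point of the finite tower lifts to the infinite one because the further coordinates are
polynomials in its first two. -/
lemma Describes.gammaLevel_eq {H : ℕ → ℤ → ℂ} {α β : ℕ → ℂ[X]} (h : Describes H α β) {d : ℕ}
    (h2 : 2 ∈ Set.Icc 2 (d + 1)) (h3 : 3 ∈ Set.Icc 2 (d + 1)) :
    gammaLevel H d = towerSet (baseCurve H) α β (Set.Icc 2 (d + 1)) h2 h3 := by
  rw [gammaLevel, h.gammaInf_eq]
  apply Set.Subset.antisymm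
  · rintro _ ⟨v, hv, rfl⟩
    exact ⟨hv.1, fun n => hv.2 ⟨n, n.2.1⟩⟩
  · intro v hv
    exact ⟨_, towerPoint_mem h.data two_mem_Ici three_mem_Ici hv.1,
      funext fun n => (hv.2 n).symm⟩

lemma Describes.vanishingIdeal_gammaInf {H : ℕ → ℤ → ℂ} {α β : ℕ → ℂ[X]} (h : Describes H α β) :
    MvPolynomial.vanishingIdeal ℂ (gammaInf H) =
      RingHom.ker (towerHom (baseCurve H) α β (Set.Ici 2)) := by
  rw [h.gammaInf_eq, ker_towerHom h.data two_mem_Ici three_mem_Ici]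

lemma ker_substSeries {H : ℕ → ℤ → ℂ} (hH : H ∈ params) :
    RingHom.ker (substSeries H) = MvPolynomial.vanishingIdeal ℂ (gammaInf H) := by
  obtain ⟨α, β, h⟩ := exists_describes hH
  rw [h.ker_eq, h.vanishingIdeal_gammaInf]

lemma bijOn_dropLast {H : ℕ → ℤ → ℂ} (hH : H ∈ params) {d : ℕ} (hd : 2 ≤ d) :
    Set.BijOn (dropLast d) (gammaLevel H (d + 1)) (gammaLevel H d) := by
  obtain ⟨α, β, h⟩ := exists_describes hH
  refine ⟨?_, ?_, ?_⟩
  · rintro _ ⟨v, hv, rfl⟩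
    exact ⟨v, hv, rfl⟩
  · have h2 : 2 ∈ Set.Icc 2 (d + 1 + 1) := Set.mem_Icc.2 (by omega)
    have h3 : 3 ∈ Set.Icc 2 (d + 1 + 1) := Set.mem_Icc.2 (by omega)
    intro v hv w hw hvw
    rw [h.gammaLevel_eq h2 h3] at hv hw
    have e2 : v ⟨2, h2⟩ = w ⟨2, h2⟩ := congrFun hvw ⟨2, Set.mem_Icc.2 (by omega)⟩
    have e3 : v ⟨3, h3⟩ = w ⟨3, h3⟩ := congrFun hvw ⟨3, Set.mem_Icc.2 (by omega)⟩
    funext n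
    have hn := hv.2 n
    rw [e2, e3] at hn
    exact hn.trans (hw.2 n).symm
  · rintro _ ⟨v, hv, rfl⟩
    exact ⟨proj (d + 1) v, ⟨v, hv, rfl⟩, rfl⟩

/-! ### The parameters are determined by the variety -/

/-- The coefficient of z^{j+2} isolates one parameter: it comes from p_{i+1} if i = j + 1 and from
the sum over l < i if i > j + 2, and it is H^j_0 = 0 if i = j + 2. -/
lemma coeff_reducedProduct_add_two {H : ℕ → ℤ → ℂ} (hH : IsNormalized H) {H' : ℕ → ℤ → ℂ}
    (hH' : IsNormalized H') {i j : ℕ} (hj : 2 ≤ j) (hi : j < i) :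
    (reducedProduct H HahnSeries.C (pSeries H') i j).coeff (-((j + 2 : ℕ) : ℤ)) =
      H j ((i : ℤ) - (j + 2 : ℕ)) := by
  have hp : ∀ n : ℕ, (pSeries H' n).coeff (-((j + 2 : ℕ) : ℤ)) = if n = j + 2 then 1 else 0 :=
    fun n => by
      rw [hH'.coeff_pSeries, hH' n _ (by omega), add_zero]
      exact if_congr (by omega) rfl rfl
  have hs : ∀ (a : ℕ) (f : ℕ → ℂ), (∑ l ∈ Finset.Ico 2 a,
      HahnSeries.C (f l) * pSeries H' l).coeff (-((j + 2 : ℕ) : ℤ)) =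
      if j + 2 < a then f (j + 2) else 0 := by
    intro a f
    rw [HahnSeries.coeff_sum]
    simp only [coeff_C_mul, hp, mul_ite, mul_one, mul_zero]
    rw [Finset.sum_ite_eq']
    exact if_congr (by rw [Finset.mem_Ico]; omega) rfl rfl
  have hC : ∀ c : ℂ, (HahnSeries.C c : LaurentSeries ℂ).coeff (-((j + 2 : ℕ) : ℤ)) = 0 := fun c =>
    (startsWith_C c).1 _ (by omega)
  simp only [reducedProduct, HahnSeries.coeff_add]
  rw [hs i (fun l => H j ((i : ℤ) - l)), hs j (fun l => H i ((j : ℤ) - l)), hC, coeff_C_mul,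
    coeff_C_mul, coeff_C_mul, hp, hp, hp, hp, if_neg (by omega : ¬ i + j = j + 2),
    if_neg (by omega : ¬ j + 1 = j + 2), if_neg (by omega : ¬ 2 = j + 2),
    if_neg (by omega : ¬ j + 2 < j)]
  rcases (by omega : i = j + 1 ∨ i = j + 2 ∨ j + 2 < i) with rfl | rfl | h
  · rw [if_pos rfl, if_neg (by omega)]
    push_cast
    ring_nf
  · rw [if_neg (by omega), if_neg (by omega), sub_self, hH j 0 (by omega)]
    ring
  · rw [if_neg (by omega), if_pos h]
    ring

/-- Equal varieties have equal ideals, so the quadrics of H vanish on the series of H'. Both sets of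
parameters then reduce the products of these series, and comparing coefficients identifies them. -/
theorem injOn_gammaInf : Set.InjOn gammaInf params := by
  intro H hH H' hH' heq
  have h0 := (mem_params_iff.1 hH).1
  have h0' := (mem_params_iff.1 hH').1
  have hred : ∀ i j, 2 ≤ i → 2 ≤ j → reducedProduct H HahnSeries.C (pSeries H') i j =
      reducedProduct H' HahnSeries.C (pSeries H') i j := by
    intro i j hi hj
    have hmem : quadric H i j ∈ RingHom.ker (substSeries H') := by
      rw [ker_substSeries hH', ← heq, ← ker_substSeries hH, RingHom.mem_ker,
        substSeries_quadric H H hi hj, mulLaw_pSeries hH i j hi hj, sub_self]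
    rw [RingHom.mem_ker, substSeries_quadric H H' hi hj, sub_eq_zero] at hmem
    rw [← hmem, mulLaw_pSeries hH' i j hi hj]
  funext j k
  by_cases hjk : j < 2 ∨ k < -1 ∨ k = 0
  · rw [h0 j k hjk, h0' j k hjk]
  -- For i = j + 2 + k the coefficient of z^{j+2} is H^j_k, and i > j holds because k ≥ -1.
  · obtain ⟨i, hi⟩ : ∃ i : ℕ, (i : ℤ) = j + 2 + k := ⟨(j + 2 + k).toNat, by omega⟩
    have h := congrArg (fun f => HahnSeries.coeff f (-((j + 2 : ℕ) : ℤ)))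
      (hred i j (by omega) (by omega))
    rwa [coeff_reducedProduct_add_two h0 h0' (by omega) (by omega),
      coeff_reducedProduct_add_two h0' h0' (by omega) (by omega),
      show (i : ℤ) - (j + 2 : ℕ) = k by push_cast; omega] at h

end SatoStratum

end

/-! ### Assembly of the proposition -/

theorem mainTheorem5 :
    -- an infinite family, faithfully parameterized by the solutions of the associativity equations
    (SatoStratum.gammaInf '' SatoStratum.params).Infinite ∧
    Set.InjOn SatoStratum.gammaInf SatoStratum.params ∧
    -- for generic parameters the base of the tower is an elliptic curve
    IsOpen {H : SatoStratum.params | (SatoStratum.baseCurve H.1).IsElliptic} ∧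
    Dense {H : SatoStratum.params | (SatoStratum.baseCurve H.1).IsElliptic} ∧
    ∀ H ∈ SatoStratum.params,
      -- the span of the series is the part of a point of the stratum without order `-1`
      (∀ q : LaurentSeries ℂ, q.order = 1 →
        SatoStratum.spanW H ⊔ Submodule.span ℂ {q} ∈ SatoStratum.stratumOne) ∧
      -- it is a subalgebra, namely the coordinate ring of the variety with coordinates `p_n(z)`
      Set.range (SatoStratum.substSeries H) =
        (SatoStratum.spanW H : Set (LaurentSeries ℂ)) ∧
      RingHom.ker (SatoStratum.substSeries H) =
        MvPolynomial.vanishingIdeal ℂ (SatoStratum.gammaInf H) ∧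
      -- the ideals of the variety and of the levels of the tower
      (∃ α β : ℕ → ℂ[X],
        (∀ n : ℕ, 4 ≤ n → (α n).natDegree ≤ n / 2 ∧ (β n).natDegree ≤ (n - 3) / 2 ∧
          SatoStratum.pSeries H n =
            (α n).eval₂ HahnSeries.C (SatoStratum.pSeries H 2) +
              (β n).eval₂ HahnSeries.C (SatoStratum.pSeries H 2) * SatoStratum.pSeries H 3) ∧
        Ideal.span (SatoStratum.quadrics H) =
          Ideal.span (insert (SatoStratum.cubicF (Set.Ici 2) H)
            (SatoStratum.graphPoly (Set.Ici 2) α β '' Set.Ici 4)) ∧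
        MvPolynomial.vanishingIdeal ℂ (SatoStratum.gammaInf H) =
          Ideal.span (insert (SatoStratum.cubicF (Set.Ici 2) H)
            (SatoStratum.graphPoly (Set.Ici 2) α β '' Set.Ici 4)) ∧
        ∀ d : ℕ, 2 ≤ d →
          MvPolynomial.vanishingIdeal ℂ (SatoStratum.gammaLevel H d) =
            Ideal.span (insert (SatoStratum.cubicF (Set.Icc 2 (d + 1)) H)
              (SatoStratum.graphPoly (Set.Icc 2 (d + 1)) α β '' Set.Icc 4 (d + 1)))) ∧
      -- the tower of curves, with the Weierstrass cubic at its base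
      SatoStratum.IsIrreducibleCurve (SatoStratum.gammaInf H) ∧
      (∀ d : ℕ, 2 ≤ d → SatoStratum.IsIrreducibleCurve (SatoStratum.gammaLevel H d) ∧
        Set.BijOn (SatoStratum.dropLast d)
          (SatoStratum.gammaLevel H (d + 1)) (SatoStratum.gammaLevel H d)) ∧
      SatoStratum.gammaLevel H 2 =
        {x | (SatoStratum.baseCurve H).toAffine.Equation
          (x ⟨2, le_refl 2, Nat.le_succ 2⟩) (x ⟨3, Nat.le_succ 2, le_refl 3⟩)} ∧
      -- the curves have genus one when the base is an elliptic curve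
      ((SatoStratum.baseCurve H).IsElliptic →
        SatoStratum.HasGenus (SatoStratum.gammaInf H) 1 ∧
        ∀ d : ℕ, 2 ≤ d → SatoStratum.HasGenus (SatoStratum.gammaLevel H d) 1) := by
  refine ⟨SatoStratum.infinite_params.image SatoStratum.injOn_gammaInf,
    SatoStratum.injOn_gammaInf, SatoStratum.isOpen_isElliptic, SatoStratum.dense_isElliptic,
    fun H hH => ?_⟩
  obtain ⟨α, β, h⟩ := SatoStratum.exists_describes hH
  obtain ⟨σ, hσ, -⟩ := SatoStratum.exists_expansion hH
  have h2 : ∀ d : ℕ, 2 ≤ d → 2 ∈ Set.Icc 2 (d + 1) := fun d hd => Set.mem_Icc.2 (by omega)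
  have h3 : ∀ d : ℕ, 2 ≤ d → 3 ∈ Set.Icc 2 (d + 1) := fun d hd => Set.mem_Icc.2 (by omega)
  have hspan := SatoStratum.span_eq_ker_towerHom (E := SatoStratum.baseCurve H) h.data
    SatoStratum.two_mem_Ici SatoStratum.three_mem_Ici (fun n hn => hn) (T := Set.Ici 4)
    fun n => by simp only [Set.mem_Ici]; omega
  rw [← SatoStratum.cubicF_eq H] at hspan
  refine ⟨fun q hq => SatoStratum.spanW_sup_mem_stratumOne hq,
    SatoStratum.range_substSeries hH, SatoStratum.ker_substSeries hH,
    ⟨α, β, fun n hn => ⟨(h.natDegree_le n hn).1, (h.natDegree_le n hn).2,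
      h.pSeries_eq n (by omega)⟩, h.span_eq.trans hspan.symm,
      h.vanishingIdeal_gammaInf.trans hspan.symm, fun d hd => ?_⟩, ?_, fun d hd => ⟨?_,
      SatoStratum.bijOn_dropLast hH hd⟩, ?_, fun hE => ⟨?_, fun d hd => ?_⟩⟩
  · rw [h.gammaLevel_eq (h2 d hd) (h3 d hd), SatoStratum.cubicF_eq H (h2 d hd) (h3 d hd),
      SatoStratum.span_eq_ker_towerHom h.data (h2 d hd) (h3 d hd) (fun n hn => hn.1) fun n => by
        simp only [Set.mem_Icc]; omega, SatoStratum.ker_towerHom h.data]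
  · rw [h.gammaInf_eq]
    exact SatoStratum.isIrreducibleCurve_towerSet h.data _ _
  · rw [h.gammaLevel_eq (h2 d hd) (h3 d hd)]
    exact SatoStratum.isIrreducibleCurve_towerSet h.data _ _
  · rw [h.gammaLevel_eq (h2 2 le_rfl) (h3 2 le_rfl)]
    ext v
    refine Iff.trans ⟨fun hv => hv.1, fun hv => ⟨hv, ?_⟩⟩
      (SatoStratum.CubicRing.cubicValue_id_eq_zero_iff _ _)
    rintro ⟨n, hn2, hn3⟩
    rcases (by omega : n = 2 ∨ n = 3) with rfl | rfl
    · simp [h.data.α_two, h.data.β_two]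
    · simp [h.data.α_three, h.data.β_three]
  · rw [h.gammaInf_eq]
    exact SatoStratum.hasGenus_towerSet h.data _ _ hσ
  · rw [h.gammaLevel_eq (h2 d hd) (h3 d hd)]
    exact SatoStratum.hasGenus_towerSet h.data _ _ hσ
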